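/- Let $\{X_i,\ i\in\mathbb Z\}$ be a (strictly) stationary sequence of jointly Gaussian random variables with mean $0$ and variance $1$, and let $r_n=E(X_1X_{n+1})$ be its covariance function. For $\beta>0$ let $$\Upsilon(X)=\min\{i\in\mathbb Z:\ X_i>-\beta i\},\qquad \tau(X)=\max\{i\ge 0:\ X_i>\beta i\}$$ be the first crossing point and the last exit time (read as the infimum and the supremum in $[-\infty,\infty]$ when the set is unbounded or empty). For small $\beta>0$ put $$a(\beta)=\sqrt{2\left(\ln\beta^{-1}-\ln\left(2\ln\beta^{-1}\right)+\ln\left((2\pi)^{-1/2}\right)\right)}.$$ 1. If $r_n\ln n\to 0$ as $n\to\infty$, then for all $x,y\in\mathbb R$, with $u_\beta(x)=\left(a(\beta)+\frac{x}{a(\beta)}\right)\beta^{-1}$, $$\lim_{\beta\downarrow 0}P\left(\Upsilon(X)\ge -u_\beta(x),\ \tau(X)\le u_\beta(y)\right)=\exp\left(-(e^{-x}+e^{-y})\right).$$ 2. If $r_n\ln n\to\gamma$ as $n\to\infty$ for some $\gamma>0$, then for all $x,y\in\mathbb R$, with $\rho_\beta=\gamma/|\ln\beta|$, $b(\beta)=\sqrt{1-\rho_\beta}\;a\left(\beta/\sqrt{1-\rho_\beta}\right)$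 and $u_\beta(x)=\left(b(\beta)+\sqrt{\rho_\beta}\,x\right)\beta^{-1}$, $$\lim_{\beta\downarrow 0}P\left(\Upsilon(X)\ge -u_\beta(x),\ \tau(X)\le u_\beta(y)\right)=\int_{\mathbb R}\exp\left(-\left(e^{-\sqrt{2\gamma}(x-z)}+e^{-\sqrt{2\gamma}(y-z)}\right)\right)d\Phi(z),$$ where $\Phi$ is the standard normal distribution function. -/

import Mathlib

open MeasureTheory ProbabilityTheory Filter Topology

noncomputable section

namespace CrossingExit

/-- A stationary standard Gaussian sequence indexed by `ℤ`: jointly Gaussian, mean `0`, variance `1`,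
and strictly stationary, i.e. every shifted sequence has the same law on `ℤ → ℝ` as the sequence. -/
structure IsStationaryStdGaussian {Ω : Type*} [MeasurableSpace Ω] (X : ℤ → Ω → ℝ)
    (P : Measure Ω) : Prop where
  gaussian : IsGaussianProcess X P
  mean_zero : ∀ i, ∫ ω, X i ω ∂P = 0
  variance_one : ∀ i, variance (X i) P = 1
  stationary : ∀ k : ℤ, IdentDistrib (fun ω i ↦ X (i + k) ω) (fun ω i ↦ X i ω) P P

/-- The covariance function `r_n = E (X_1 X_{n+1})`. -/
def covFun {Ω : Type*} [MeasurableSpace Ω] (X : ℤ → Ω → ℝ) (P : Measure Ω) (n : ℕ) : ℝ :=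
  ∫ ω, X 1 ω * X ((n : ℤ) + 1) ω ∂P

/-- The first crossing point `min {i ∈ ℤ : X_i > -β i}`, as an infimum in the extended reals. It is
the minimum whenever there is one; it is `-∞` if the set is unbounded below and `+∞` if it is empty. -/
def firstCrossing {Ω : Type*} (X : ℤ → Ω → ℝ) (β : ℝ) (ω : Ω) : EReal :=
  sInf ((fun i : ℤ ↦ ((i : ℝ) : EReal)) '' {i : ℤ | -β * (i : ℝ) < X i ω})

/-- The last exit time `max {i ≥ 0 : X_i > β i}`, as a supremum in the extended reals. It is
the maximum whenever there is one; it is `+∞` if the set is unbounded and `-∞` if it is empty. -/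
def lastExit {Ω : Type*} (X : ℤ → Ω → ℝ) (β : ℝ) (ω : Ω) : EReal :=
  sSup ((fun i : ℤ ↦ ((i : ℝ) : EReal)) '' {i : ℤ | 0 ≤ i ∧ β * (i : ℝ) < X i ω})

theorem firstCrossing_eq_of_isLeast {Ω : Type*} (X : ℤ → Ω → ℝ) (β : ℝ) (ω : Ω) (m : ℤ)
    (h : IsLeast {i : ℤ | -β * (i : ℝ) < X i ω} m) :
    firstCrossing X β ω = ((m : ℝ) : EReal) := by
  refine IsLeast.csInf_eq ⟨⟨m, h.1, rfl⟩, ?_⟩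
  rintro _ ⟨i, hi, rfl⟩
  exact EReal.coe_le_coe_iff.2 (Int.cast_le.2 (h.2 hi))

theorem lastExit_eq_of_isGreatest {Ω : Type*} (X : ℤ → Ω → ℝ) (β : ℝ) (ω : Ω) (m : ℤ)
    (h : IsGreatest {i : ℤ | 0 ≤ i ∧ β * (i : ℝ) < X i ω} m) :
    lastExit X β ω = ((m : ℝ) : EReal) := by
  refine IsGreatest.csSup_eq ⟨⟨m, h.1, rfl⟩, ?_⟩
  rintro _ ⟨i, hi, rfl⟩
  exact EReal.coe_le_coe_iff.2 (Int.cast_le.2 (h.2 hi))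

/-- `a(β) = √(2 (ln β⁻¹ - ln (2 ln β⁻¹) + ln ((2π)^{-1/2})))`. -/
def levelA (β : ℝ) : ℝ :=
  Real.sqrt (2 * (Real.log β⁻¹ - Real.log (2 * Real.log β⁻¹)
    + Real.log ((2 * Real.pi) ^ (-(1 / 2) : ℝ))))

/-- Normalization in the weakly dependent case: `u_β(x) = (a(β) + x / a(β)) β⁻¹`. -/
def weakLevel (β x : ℝ) : ℝ :=
  (levelA β + x / levelA β) * β⁻¹

/-- `ρ_β = γ / |ln β|`. -/
def rhoLevel (γ β : ℝ) : ℝ :=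
  γ / |Real.log β|

/-- `b(β, ρ) = √(1 - ρ) a(β / √(1 - ρ))`. -/
def levelB (β ρ : ℝ) : ℝ :=
  Real.sqrt (1 - ρ) * levelA (β / Real.sqrt (1 - ρ))

/-- Normalization in the strongly dependent case: `u_β(x) = (b(β, ρ_β) + √ρ_β x) β⁻¹`. -/
def strongLevel (γ β x : ℝ) : ℝ :=
  (levelB β (rhoLevel γ β) + Real.sqrt (rhoLevel γ β) * x) * β⁻¹

end CrossingExit

end

/-! Write `β = exp (-L)`. For small `β` the event says that `X_i ≤ β|i|` for all `i < -u_β(x)` and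
all `i > u_β(y)` (`setOf_firstCrossing_lastExit_eq`). Indices with `β|i| > 3√L` cost only `O(exp
(-L/4))` by a union bound, which leaves the finite set `crossSet`.

On this set the sequence is compared with the equicorrelated vector `√(1-ρ) ξ_i + √ρ Z`, `ρ = γ/L`:
most lags `n` satisfy `log n ≈ L`, hence `r_n ≈ γ/L`. The normal comparison inequality
(`abs_measureReal_Iic_sub_le`), obtained by rotating one Gaussian family into the other and
integrating by parts, bounds the error by a double sum that tends to `0` (`tendsto_sum_compTerm`).
Short lags are few, and there `|r_n| ≤ δ < 1`, because `r_n → 0` and stationarity exclude `|r_n| =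
1`. For intermediate lags `r_n = O(1/L)`, and they are still rare. For long lags `r_n - γ/L =
o(1/L)`, while the Gaussian weights of all pairs sum to `O(L)`.

Given `Z = z`, the equicorrelated coordinates are independent, so the probability is a product of
factors `1 - Ψ(t_i)` and behaves like `exp (-∑ Ψ(t_i))`, where `Ψ` is the normal tail and `φ` the
normal density. Since `Ψ(t) ≈ φ(t)/t ≈ -(φ/t²)'`, the sum telescopes to `φ(t)/t²` at the starting
level, divided by the mesh. `IsLevel` records `t²/2` up to `o(1)`, exactly the precision needed:
conditioning turns the parameter `κ` into `κ + γ - √(2γ) z`, and the sum tends to the exponential of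
its negative. Dominated convergence in `z` gives the mixed limit.

The normalizations have `κ = x` (weak dependence, `γ = 0`) and `κ = -γ + √(2γ) x` (strong
dependence), so both parts are instances of `tendsto_measureReal_firstCrossing_lastExit`. -/

namespace CrossingExit

open scoped ENNReal NNReal

/-! ### Gaussian integration by parts -/

lemma gaussianPDFReal_zero_one (x : ℝ) :
    gaussianPDFReal 0 1 x = (√(2 * Real.pi))⁻¹ * Real.exp (-(1 / 2) * x ^ 2) := by
  simp only [gaussianPDFReal, NNReal.coe_one, mul_one, sub_zero]
  congr 2; ring

lemma hasDerivAt_gaussianPDFReal_zero_one (x : ℝ) :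
    HasDerivAt (gaussianPDFReal 0 1) (-(x * gaussianPDFReal 0 1 x)) x := by
  have h1 : HasDerivAt (fun x : ℝ ↦ -(1 / 2 : ℝ) * x ^ 2) (-x) x := by
    convert! (hasDerivAt_pow 2 x).const_mul (-(1 / 2 : ℝ)) using 1
    simp
  have h2 := h1.exp.const_mul (√(2 * Real.pi))⁻¹
  have h3 : gaussianPDFReal 0 1
      = fun x ↦ (√(2 * Real.pi))⁻¹ * Real.exp (-(1 / 2) * x ^ 2) :=
    funext gaussianPDFReal_zero_one
  rw [h3]
  convert! h2 using 1
  ring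

lemma integrable_mul_gaussianPDFReal_zero_one :
    Integrable (fun x : ℝ ↦ x * gaussianPDFReal 0 1 x) := by
  simp_rw [gaussianPDFReal_zero_one]
  have := (integrable_mul_exp_neg_mul_sq (b := 1 / 2) (by norm_num)).const_mul
    (√(2 * Real.pi))⁻¹
  refine this.congr (ae_of_all _ fun x ↦ ?_)
  simp only
  ring

/-- Stein's identity for the standard normal distribution. -/
lemma integral_mul_gaussianReal_eq_integral_deriv {h h' : ℝ → ℝ}
    (hd : ∀ x, HasDerivAt h (h' x) x) {B : ℝ} (hB : ∀ x, |h x| ≤ B) (hB' : ∀ x, |h' x| ≤ B) :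
    ∫ x, x * h x ∂(gaussianReal 0 1) = ∫ x, h' x ∂(gaussianReal 0 1) := by
  rw [integral_gaussianReal_eq_integral_smul one_ne_zero,
    integral_gaussianReal_eq_integral_smul one_ne_zero]
  have hcont : Continuous h := continuous_iff_continuousAt.2 fun x ↦ (hd x).continuousAt
  have hmeas' : Measurable h' := by
    have : h' = deriv h := funext fun x ↦ (hd x).deriv.symm
    rw [this]
    exact measurable_deriv h
  have hint1 : Integrable (fun x ↦ h x * gaussianPDFReal 0 1 x) :=
    (integrable_gaussianPDFReal 0 1).bdd_mul hcont.aestronglyMeasurable (ae_of_all _ hB)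
  have hint2 : Integrable (fun x ↦ h' x * gaussianPDFReal 0 1 x) :=
    (integrable_gaussianPDFReal 0 1).bdd_mul hmeas'.aestronglyMeasurable (ae_of_all _ hB')
  have hint3 : Integrable (fun x ↦ h x * -(x * gaussianPDFReal 0 1 x)) :=
    integrable_mul_gaussianPDFReal_zero_one.neg.bdd_mul hcont.aestronglyMeasurable
      (ae_of_all _ hB)
  have key := integral_mul_deriv_eq_deriv_mul_of_integrable (u := h) (u' := h')
    (v := gaussianPDFReal 0 1) (v' := fun x ↦ -(x * gaussianPDFReal 0 1 x))
    (fun x _ ↦ hd x) (fun x _ ↦ hasDerivAt_gaussianPDFReal_zero_one x) hint3 hint2 hint1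
  have e1 : ∫ x, gaussianPDFReal 0 1 x • (x * h x)
      = -∫ x, h x * -(x * gaussianPDFReal 0 1 x) := by
    rw [← integral_neg]
    congr with x
    simp only [smul_eq_mul]; ring
  rw [e1, key, neg_neg]
  congr with x
  simp only [smul_eq_mul]; ring

section Stein

variable {Ω : Type*} [MeasurableSpace Ω] {μ : Measure Ω} {ι : Type*} [Fintype ι]

/-- Gaussian integration by parts for a product of functions of the coordinates. -/
lemma integral_mul_prod_eq_sum_covariance [DecidableEq ι] {V : Ω → ℝ} {W : ι → Ω → ℝ}
    (hVW : HasGaussianLaw (fun ω ↦ (V ω, fun i ↦ W i ω)) μ)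
    (hV0 : ∫ ω, V ω ∂μ = 0) (hV1 : Var[V; μ] = 1)
    {G G' : ι → ℝ → ℝ} (hd : ∀ i x, HasDerivAt (G i) (G' i x) x)
    {B : ℝ} (hB : ∀ i x, |G i x| ≤ B) (hB' : ∀ i x, |G' i x| ≤ B) :
    ∫ ω, V ω * ∏ k, G k (W k ω) ∂μ
      = ∑ j, cov[V, W j; μ] *
          ∫ ω, (∏ k ∈ Finset.univ.erase j, G k (W k ω)) * G' j (W j ω) ∂μ := by
  have hP := hVW.isProbabilityMeasure
  set c : ι → ℝ := fun j ↦ cov[V, W j; μ] with hc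
  have hVg : HasGaussianLaw V μ := hVW.fst
  have hWg : HasGaussianLaw (fun ω i ↦ W i ω) μ := hVW.snd
  have hWi : ∀ i, HasGaussianLaw (W i) μ := fun i ↦ hWg.eval i
  -- Regression on `V`: the residual `R i` is uncorrelated with `V`, hence independent of it by
  -- joint normality. Conditionally on `R` the claim is the one-dimensional Stein identity for a
  -- product, and no nondegeneracy of `W` is needed.
  let R : ι → Ω → ℝ := fun i ω ↦ W i ω - c i * V ω
  -- `V` is viewed as a family over `Unit` because the independence criterion is stated for two
  -- families.
  have hVR : HasGaussianLaw (fun ω ↦ ((fun _ : Unit ↦ V ω), fun i ↦ R i ω)) μ := by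
    let T : ℝ × (ι → ℝ) →L[ℝ] (Unit → ℝ) × (ι → ℝ) :=
      ContinuousLinearMap.prod
        (ContinuousLinearMap.pi fun _ ↦ ContinuousLinearMap.fst ℝ ℝ (ι → ℝ))
        (ContinuousLinearMap.pi fun i ↦
          (ContinuousLinearMap.proj i).comp (ContinuousLinearMap.snd ℝ ℝ (ι → ℝ))
            - c i • ContinuousLinearMap.fst ℝ ℝ (ι → ℝ))
    exact hVW.map_fun T
  have hindep : IndepFun (fun ω ↦ (fun _ : Unit ↦ V ω)) (fun ω i ↦ R i ω) μ := by
    refine HasGaussianLaw.indepFun_of_covariance_eval (X := fun _ : Unit ↦ V) hVR fun _ i ↦ ?_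
    have : R i = fun ω ↦ W i ω - c i * V ω := rfl
    rw [this, covariance_fun_sub_right hVg.memLp_two (hWi i).memLp_two
      (hVg.memLp_two.const_mul _), covariance_const_mul_right, covariance_self hVg.aemeasurable,
      hV1]
    simp [hc]
  have hindep' : IndepFun V (fun ω i ↦ R i ω) μ :=
    hindep.comp (φ := fun f : Unit → ℝ ↦ f ()) (ψ := id) (by fun_prop) measurable_id
  have hRm : AEMeasurable (fun ω i ↦ R i ω) μ := hVR.snd.aemeasurable
  have hmap : μ.map (fun ω ↦ (V ω, fun i ↦ R i ω))
      = (gaussianReal 0 1).prod (μ.map fun ω i ↦ R i ω) := by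
    rw [(indepFun_iff_map_prod_eq_prod_map_map hVg.aemeasurable hRm).1 hindep',
      hVg.map_eq_gaussianReal, hV0, hV1, Real.toNNReal_one]
  have hprob : IsProbabilityMeasure (μ.map fun ω i ↦ R i ω) :=
    Measure.isProbabilityMeasure_map hRm
  have hpm : AEMeasurable (fun ω ↦ (V ω, fun i ↦ R i ω)) μ := hVg.aemeasurable.prodMk hRm
  have hGc : ∀ i, Continuous (G i) := fun i ↦
    continuous_iff_continuousAt.2 fun x ↦ (hd i x).continuousAt
  have hGm' : ∀ i, Measurable (G' i) := fun i ↦ by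
    have : G' i = deriv (G i) := funext fun x ↦ (hd i x).deriv.symm
    rw [this]
    exact measurable_deriv _
  have hGm : ∀ i, Measurable (G i) := fun i ↦ (hGc i).measurable
  have hWR : ∀ i ω, W i ω = c i * V ω + R i ω := fun i ω ↦ by simp [R]
  by_cases hne : IsEmpty ι
  · simp [hV0]
  have hB0 : 0 ≤ B := by
    rw [not_isEmpty_iff] at hne
    exact (abs_nonneg _).trans (hB hne.some 0)
  have habs : ∀ (s : Finset ι) (y : ι → ℝ), |∏ k ∈ s, G k (y k)| ≤ B ^ s.card := fun s y ↦ by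
    rw [Finset.abs_prod]
    exact (Finset.prod_le_prod (fun _ _ ↦ abs_nonneg _) fun k _ ↦ hB k _).trans (by simp)
  have intVR : ∀ F : ℝ × (ι → ℝ) → ℝ, Measurable F → 
      ∫ ω, F (V ω, fun i ↦ R i ω) ∂μ
        = ∫ z, F z ∂((gaussianReal 0 1).prod (μ.map fun ω i ↦ R i ω)) := fun F hF ↦ by
    rw [← hmap, integral_map hpm hF.aestronglyMeasurable]
  have hid : Integrable (fun x : ℝ ↦ x) (gaussianReal 0 1) :=
    (memLp_id_gaussianReal 1).integrable (by simp)
  have e1 : ∫ ω, V ω * ∏ k, G k (W k ω) ∂μ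
      = ∫ y, ∫ v, v * ∏ k, G k (c k * v + y k) ∂(gaussianReal 0 1)
          ∂(μ.map fun ω i ↦ R i ω) := by
    have := intVR (fun z ↦ z.1 * ∏ k, G k (c k * z.1 + z.2 k)) (by fun_prop)
    simp only [← hWR] at this
    rw [this, integral_prod_symm]
    refine (hid.comp_fst (μ.map fun ω i ↦ R i ω)).mul_bdd (c := B ^ (Finset.univ : Finset ι).card)
      (by fun_prop) (ae_of_all _ fun z ↦ habs _ _)
  have e2 : ∀ j, ∫ ω, (∏ k ∈ Finset.univ.erase j, G k (W k ω)) * G' j (W j ω) ∂μ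
      = ∫ y, ∫ v, (∏ k ∈ Finset.univ.erase j, G k (c k * v + y k)) * G' j (c j * v + y j)
          ∂(gaussianReal 0 1) ∂(μ.map fun ω i ↦ R i ω) := fun j ↦ by
    have := intVR (fun z ↦ (∏ k ∈ Finset.univ.erase j, G k (c k * z.1 + z.2 k)) *
      G' j (c j * z.1 + z.2 j)) (by fun_prop)
    simp only [← hWR] at this
    rw [this, integral_prod_symm]
    refine Integrable.of_bound (C := B ^ (Finset.univ.erase j).card * B) (by fun_prop)
      (ae_of_all _ fun z ↦ ?_)
    rw [Real.norm_eq_abs, abs_mul]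
    exact mul_le_mul (habs _ _) (hB' _ _) (abs_nonneg _) (by positivity)
  have hint : ∀ j (y : ι → ℝ), Integrable (fun v ↦
      (∏ k ∈ Finset.univ.erase j, G k (c k * v + y k)) * G' j (c j * v + y j))
      (gaussianReal 0 1) := fun j y ↦ by
    refine Integrable.of_bound (C := B ^ (Finset.univ.erase j).card * B) (by fun_prop)
      (ae_of_all _ fun z ↦ ?_)
    rw [Real.norm_eq_abs, abs_mul]
    exact mul_le_mul (habs _ (fun k ↦ c k * z + y k)) (hB' _ _) (abs_nonneg _) (by positivity)
  rw [e1]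
  simp_rw [e2, ← integral_const_mul]
  rw [← integral_finsetSum]
  · refine integral_congr_ae (ae_of_all _ fun y ↦ ?_)
    simp only
    rw [← integral_finsetSum _ fun j _ ↦ (hint j y).const_mul _]
    have hder : ∀ v, HasDerivAt (fun v ↦ ∏ k, G k (c k * v + y k))
        (∑ j, c j * ((∏ k ∈ Finset.univ.erase j, G k (c k * v + y k)) * G' j (c j * v + y j)))
        v := fun v ↦ by
      have h1 : ∀ k, HasDerivAt (fun v ↦ G k (c k * v + y k)) (G' k (c k * v + y k) * c k) v :=
        fun k ↦ by
          have := ((hasDerivAt_id v).const_mul (c k)).add_const (y k)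
          simpa [Function.comp_def] using! (hd k (c k * v + y k)).comp v this
      refine (HasDerivAt.fun_finsetProd fun k (_ : k ∈ Finset.univ) ↦ h1 k).congr_deriv ?_
      refine Finset.sum_congr rfl fun j _ ↦ ?_
      simp only [smul_eq_mul]; ring
    refine integral_mul_gaussianReal_eq_integral_deriv (B := max (B ^ (Finset.univ : Finset ι).card)
      (∑ j, |c j| * (B ^ (Finset.univ.erase j).card * B))) hder
      (fun v ↦ le_max_of_le_left (habs _ fun k ↦ c k * v + y k))
      (fun v ↦ le_max_of_le_right ?_)
    refine (Finset.abs_sum_le_sum_abs _ _).trans (Finset.sum_le_sum fun j _ ↦ ?_)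
    rw [abs_mul, abs_mul]
    gcongr
    · exact habs _ fun k ↦ c k * v + y k
    · exact hB' _ _
  · intro j _
    have : Measurable fun z : (ι → ℝ) × ℝ ↦
      (c j * ((∏ k ∈ Finset.univ.erase j, G k (c k * z.2 + z.1 k)) * G' j (c j * z.2 + z.1 j))) :=
        by fun_prop
    refine Integrable.of_bound (C := |c j| * (B ^ (Finset.univ.erase j).card * B))
      (this.stronglyMeasurable.integral_prod_right).aestronglyMeasurable
      (ae_of_all _ fun y ↦ ?_)
    refine (norm_integral_le_of_norm_le_const
      (C := |c j| * (B ^ (Finset.univ.erase j).card * B)) (ae_of_all _ fun v ↦ ?_)).trans (by simp)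
    rw [Real.norm_eq_abs, abs_mul, abs_mul]
    gcongr
    · exact habs _ fun k ↦ c k * v + y k
    · exact hB' _ _

end Stein

/-! ### Density bound for a correlated pair, and smoothed indicators -/

lemma gaussianPDFReal_mul_gaussianPDFReal_le {s w a b x y : ℝ} (hs : |s| ≤ w) (hw : w < 1)
    (ha : 0 ≤ a) (hb : 0 ≤ b) (hx : a ≤ x) (hy : b ≤ y) :
    gaussianPDFReal 0 1 x * gaussianPDFReal 0 (1 - s ^ 2).toNNReal (y - s * x)
      ≤ (√(1 - w ^ 2))⁻¹ * Real.exp (-(a ^ 2 + b ^ 2) / (2 * (1 + w))) := by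
  have hw0 : 0 ≤ w := (abs_nonneg s).trans hs
  have hsw : s ^ 2 ≤ w ^ 2 := sq_le_sq' (by linarith [neg_abs_le s]) ((le_abs_self s).trans hs)
  have hw2 : 0 < 1 - w ^ 2 := by nlinarith
  have hs2 : 0 < 1 - s ^ 2 := by linarith
  have hπ : (1 : ℝ) ≤ 2 * Real.pi := by linarith [Real.pi_gt_three]
  rw [gaussianPDFReal_zero_one, gaussianPDFReal, Real.coe_toNNReal _ hs2.le]
  have h1 : (√(2 * Real.pi))⁻¹ ≤ 1 := inv_le_one_of_one_le₀ (Real.one_le_sqrt.2 hπ)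
  have h2 : (√(2 * Real.pi * (1 - s ^ 2)))⁻¹ ≤ (√(1 - w ^ 2))⁻¹ := by
    gcongr
    nlinarith
  -- Completing the square gives the bivariate form `(x² + y² - 2sxy) / (2(1 - s²))`. Since `2|s|xy
  -- ≤ |s|(x² + y²)`, it is at least `(x² + y²) / (2(1 + |s|))`.
  have h3 : -(1 / 2) * x ^ 2 + -(y - s * x - 0) ^ 2 / (2 * (1 - s ^ 2))
      ≤ -(a ^ 2 + b ^ 2) / (2 * (1 + w)) := by
    have e : -(1 / 2) * x ^ 2 + -(y - s * x - 0) ^ 2 / (2 * (1 - s ^ 2))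
        = -((x ^ 2 + y ^ 2 - 2 * s * x * y) / (2 * (1 - s ^ 2))) := by
      field_simp; ring
    rw [e, neg_div, neg_le_neg_iff]
    have hxy : a ^ 2 + b ^ 2 ≤ x ^ 2 + y ^ 2 := by
      nlinarith [mul_self_le_mul_self ha hx, mul_self_le_mul_self hb hy]
    refine (div_le_div_of_nonneg_right hxy (by positivity)).trans ?_
    rw [div_le_div_iff₀ (by positivity) (by positivity)]
    have h4 : s * (x * y) ≤ |s| * (x * y) :=
      mul_le_mul_of_nonneg_right (le_abs_self s) (mul_nonneg (ha.trans hx) (hb.trans hy))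
    have h5 : (x ^ 2 + y ^ 2) * (1 - |s|) ≤ x ^ 2 + y ^ 2 - 2 * s * x * y := by
      nlinarith [mul_nonneg (abs_nonneg s) (sq_nonneg (x - y))]
    have h6 : (1 - s ^ 2) = (1 - |s|) * (1 + |s|) := by nlinarith [sq_abs s]
    rw [h6]
    have h7 : (x ^ 2 + y ^ 2) * (1 - |s|) * (1 + |s|)
        ≤ (x ^ 2 + y ^ 2 - 2 * s * x * y) * (1 + w) := by
      refine mul_le_mul h5 (by linarith) (by positivity) ?_
      exact (mul_nonneg (by positivity) (by linarith)).trans h5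
    nlinarith
  calc _ = (√(2 * Real.pi))⁻¹ * (√(2 * Real.pi * (1 - s ^ 2)))⁻¹ *
        Real.exp (-(1 / 2) * x ^ 2 + -(y - s * x - 0) ^ 2 / (2 * (1 - s ^ 2))) := by
        rw [Real.exp_add]; ring
    _ ≤ 1 * (√(1 - w ^ 2))⁻¹ * Real.exp (-(a ^ 2 + b ^ 2) / (2 * (1 + w))) := by gcongr
    _ = _ := by rw [one_mul]

/-- Two standard normal variables with correlation at most `w` in absolute value: the density is
bounded on the quadrant `[a, ∞) × [b, ∞)`. -/
lemma lintegral_mul_le_of_hasGaussianLaw {Ω : Type*} [MeasurableSpace Ω] {μ : Measure Ω}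
    {U V : Ω → ℝ} (hUV : HasGaussianLaw (fun ω ↦ (U ω, V ω)) μ)
    (hU0 : ∫ ω, U ω ∂μ = 0) (hV0 : ∫ ω, V ω ∂μ = 0) (hU1 : Var[U; μ] = 1) (hV1 : Var[V; μ] = 1)
    {w : ℝ} (hs : |cov[U, V; μ]| ≤ w) (hw : w < 1) {p q : ℝ → ℝ≥0∞} (hp : Measurable p)
    (hq : Measurable q) {a b : ℝ} (ha : 0 ≤ a) (hb : 0 ≤ b) (hpa : ∀ x < a, p x = 0)
    (hqb : ∀ x < b, q x = 0) :
    ∫⁻ ω, p (U ω) * q (V ω) ∂μ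
      ≤ ENNReal.ofReal ((√(1 - w ^ 2))⁻¹ * Real.exp (-(a ^ 2 + b ^ 2) / (2 * (1 + w))))
          * ((∫⁻ x, p x) * ∫⁻ y, q y) := by
  have hP := hUV.isProbabilityMeasure
  set s := cov[U, V; μ] with hsdef
  have hw0 : 0 ≤ w := (abs_nonneg s).trans hs
  have hs2 : 0 < 1 - s ^ 2 := by
    have : s ^ 2 < 1 := by
      rw [sq_lt_one_iff_abs_lt_one]; linarith
    linarith
  let R : Ω → ℝ := fun ω ↦ V ω - s * U ω
  have hUR : HasGaussianLaw (fun ω ↦ (U ω, R ω)) μ := by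
    let T : ℝ × ℝ →L[ℝ] ℝ × ℝ := ContinuousLinearMap.prod (ContinuousLinearMap.fst ℝ ℝ ℝ)
      (ContinuousLinearMap.snd ℝ ℝ ℝ - s • ContinuousLinearMap.fst ℝ ℝ ℝ)
    exact hUV.map_fun T
  have hU2 := hUV.fst.memLp_two
  have hV2 := hUV.snd.memLp_two
  have hindep : IndepFun U R μ := by
    refine hUR.indepFun_of_covariance_eq_zero ?_
    have : R = fun ω ↦ V ω - s * U ω := rfl
    rw [this, covariance_fun_sub_right hU2 hV2 (hU2.const_mul _), covariance_const_mul_right,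
      covariance_self hUV.fst.aemeasurable, hU1]
    simp [hsdef]
  have hR0 : ∫ ω, R ω ∂μ = 0 := by
    have : R = fun ω ↦ V ω - s * U ω := rfl
    rw [this, integral_sub hUV.snd.integrable (hUV.fst.integrable.const_mul _),
      integral_const_mul, hU0, hV0]
    simp
  have hR1 : Var[R; μ] = 1 - s ^ 2 := by
    have : R = fun ω ↦ V ω - s * U ω := rfl
    rw [← covariance_self hUR.snd.aemeasurable, this,
      covariance_fun_sub_fun_sub hV2 (hU2.const_mul _) hV2 (hU2.const_mul _),
      covariance_const_mul_left, covariance_const_mul_right, covariance_const_mul_left,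
      covariance_const_mul_right,
      covariance_self hUV.snd.aemeasurable, covariance_self hUV.fst.aemeasurable, hU1, hV1,
      covariance_comm V U, ← hsdef]
    ring
  have hmap : μ.map (fun ω ↦ (U ω, R ω))
      = (gaussianReal 0 1).prod (gaussianReal 0 (1 - s ^ 2).toNNReal) := by
    rw [(indepFun_iff_map_prod_eq_prod_map_map hUV.fst.aemeasurable hUR.snd.aemeasurable).1 hindep,
      hUV.fst.map_eq_gaussianReal, hUR.snd.map_eq_gaussianReal, hU0, hU1, hR0, hR1,
      Real.toNNReal_one]
  have hv : (1 - s ^ 2).toNNReal ≠ 0 := by simpa using hs2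
  have hVR : ∀ ω, V ω = s * U ω + R ω := fun ω ↦ by simp [R]
  set K := ENNReal.ofReal ((√(1 - w ^ 2))⁻¹ * Real.exp (-(a ^ 2 + b ^ 2) / (2 * (1 + w))))
    with hK
  have hF : Measurable fun z : ℝ × ℝ ↦ p z.1 * q (s * z.1 + z.2) := by fun_prop
  calc ∫⁻ ω, p (U ω) * q (V ω) ∂μ
      = ∫⁻ z, p z.1 * q (s * z.1 + z.2) ∂(μ.map (fun ω ↦ (U ω, R ω))) := by
        rw [lintegral_map' hF.aemeasurable hUR.aemeasurable]
        simp_rw [hVR]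
    _ = ∫⁻ x, ∫⁻ y, p x * q (s * x + y) ∂(gaussianReal 0 (1 - s ^ 2).toNNReal)
          ∂(gaussianReal 0 1) := by
        rw [hmap, lintegral_prod _ hF.aemeasurable]
    _ = ∫⁻ x, ∫⁻ y, gaussianPDF 0 1 x *
          (gaussianPDF 0 (1 - s ^ 2).toNNReal (y - s * x) * (p x * q y)) := by
        rw [gaussianReal_of_var_ne_zero _ one_ne_zero, gaussianReal_of_var_ne_zero _ hv,
          lintegral_withDensity_eq_lintegral_mul _ (measurable_gaussianPDF _ _)]
        · refine lintegral_congr fun x ↦ ?_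
          have hshift := lintegral_add_left_eq_self (μ := (volume : Measure ℝ))
            (fun y : ℝ ↦ gaussianPDF 0 (1 - s ^ 2).toNNReal (y - s * x) * (p x * q y)) (s * x)
          rw [Pi.mul_apply, lintegral_withDensity_eq_lintegral_mul _ (measurable_gaussianPDF _ _)
            (by fun_prop), lintegral_const_mul _ (by fun_prop), ← hshift]
          simp [Pi.mul_apply]
        · have : Measurable fun z : ℝ × ℝ ↦ p z.1 * q (s * z.1 + z.2) := by fun_prop
          exact Measurable.lintegral_prod_right' this
    _ ≤ ∫⁻ x, ∫⁻ y, K * (p x * q y) := by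
        refine lintegral_mono fun x ↦ lintegral_mono fun y ↦ ?_
        by_cases hx : x < a
        · simp [hpa x hx]
        by_cases hy : y < b
        · simp [hqb y hy]
        push Not at hx hy
        rw [← mul_assoc]
        gcongr
        rw [gaussianPDF, gaussianPDF, ← ENNReal.ofReal_mul (gaussianPDFReal_nonneg _ _ _), hK]
        exact ENNReal.ofReal_le_ofReal
          (gaussianPDFReal_mul_gaussianPDFReal_le hs hw ha hb hx hy)
    _ = K * ((∫⁻ x, p x) * ∫⁻ y, q y) := by
        simp_rw [← mul_assoc]
        have : ∀ x, ∫⁻ y, K * p x * q y = K * p x * ∫⁻ y, q y := fun x ↦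
          lintegral_const_mul _ hq
        simp_rw [this]
        rw [lintegral_mul_const _ (by fun_prop), lintegral_const_mul _ hp]

/-- A smooth approximation from above of the indicator function of `(-∞, u]`. -/
lemma exists_smooth_indicator_Iic (u : ℝ) {ε : ℝ} (hε : 0 < ε) :
    ∃ (g g' g'' : ℝ → ℝ) (B : ℝ), (∀ x, HasDerivAt g (g' x) x) ∧ (∀ x, HasDerivAt g' (g'' x) x) ∧
      (∀ x, 0 ≤ g x) ∧ (∀ x, g x ≤ 1) ∧ (∀ x ≤ u, g x = 1) ∧ (∀ x, u + ε ≤ x → g x = 0) ∧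
      (∀ x, |g' x| ≤ B) ∧ (∀ x, |g'' x| ≤ B) ∧ (∀ x < u, g' x = 0) ∧
      ∫⁻ x, ENNReal.ofReal |g' x| ≤ 1 := by
  let g : ℝ → ℝ := fun x ↦ Real.smoothTransition (1 - (x - u) / ε)
  have hg : ContDiff ℝ 2 g :=
    (Real.smoothTransition.contDiff (n := 2)).comp (by fun_prop)
  have hg' : ContDiff ℝ 1 (deriv g) := by
    have h2 : ContDiff ℝ (1 + 1) g := by
      rw [one_add_one_eq_two]
      exact hg
    exact (contDiff_succ_iff_deriv.1 h2).2.2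
  have hd : ∀ x, HasDerivAt g (deriv g x) x := fun x ↦
    (hg.differentiable (by norm_num) x).hasDerivAt
  have hd' : ∀ x, HasDerivAt (deriv g) (deriv (deriv g) x) x := fun x ↦
    (hg'.differentiable (by norm_num) x).hasDerivAt
  have hc' : Continuous (deriv g) := hg'.continuous
  have hc'' : Continuous (deriv (deriv g)) := hg'.continuous_deriv le_rfl
  have hone : ∀ x ≤ u, g x = 1 := fun x hx ↦ by
    refine Real.smoothTransition.one_of_one_le ?_
    have : (x - u) / ε ≤ 0 := div_nonpos_of_nonpos_of_nonneg (by linarith) hε.le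
    linarith
  have hzero : ∀ x, u + ε ≤ x → g x = 0 := fun x hx ↦ by
    refine Real.smoothTransition.zero_of_nonpos ?_
    have : 1 ≤ (x - u) / ε := by rw [le_div_iff₀ hε]; linarith
    linarith
  have hanti : Antitone g := fun x y hxy ↦ by
    refine Real.smoothTransition.monotone ?_
    gcongr
  have hl : ∀ x < u, deriv g x = 0 := fun x hx ↦ by
    have : g =ᶠ[𝓝 x] fun _ ↦ 1 := by
      filter_upwards [Iio_mem_nhds hx] with y hy using hone y (le_of_lt hy)
    rw [this.deriv_eq, deriv_const]
  have hr : ∀ x, u + ε < x → deriv g x = 0 := fun x hx ↦ by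
    have : g =ᶠ[𝓝 x] fun _ ↦ 0 := by
      filter_upwards [Ioi_mem_nhds hx] with y hy using hzero y (le_of_lt hy)
    rw [this.deriv_eq, deriv_const]
  have hl' : ∀ x < u, deriv (deriv g) x = 0 := fun x hx ↦ by
    have : deriv g =ᶠ[𝓝 x] fun _ ↦ 0 := by
      filter_upwards [Iio_mem_nhds hx] with y hy using hl y hy
    rw [this.deriv_eq, deriv_const]
  have hr' : ∀ x, u + ε < x → deriv (deriv g) x = 0 := fun x hx ↦ by
    have : deriv g =ᶠ[𝓝 x] fun _ ↦ 0 := by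
      filter_upwards [Ioi_mem_nhds hx] with y hy using hr y hy
    rw [this.deriv_eq, deriv_const]
  obtain ⟨C₁, hC₁⟩ := (isCompact_Icc (a := u) (b := u + ε)).exists_bound_of_continuousOn
    hc'.continuousOn
  obtain ⟨C₂, hC₂⟩ := (isCompact_Icc (a := u) (b := u + ε)).exists_bound_of_continuousOn
    hc''.continuousOn
  have hbound : ∀ (f : ℝ → ℝ) (C : ℝ), (∀ x < u, f x = 0) → (∀ x, u + ε < x → f x = 0) →
      (∀ x ∈ Set.Icc u (u + ε), ‖f x‖ ≤ C) → ∀ x, |f x| ≤ max C 0 := fun f C h1 h2 h3 x ↦ by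
    by_cases hx1 : x < u
    · simp [h1 x hx1]
    by_cases hx2 : u + ε < x
    · simp [h2 x hx2]
    push Not at hx1 hx2
    exact (h3 x ⟨hx1, hx2⟩).trans (le_max_left _ _)
  refine ⟨g, deriv g, deriv (deriv g), max (max C₁ 0) (max C₂ 0), hd, hd',
    fun x ↦ Real.smoothTransition.nonneg _, fun x ↦ Real.smoothTransition.le_one _, hone, hzero,
    fun x ↦ (hbound _ _ hl hr hC₁ x).trans (le_max_left _ _),
    fun x ↦ (hbound _ _ hl' hr' hC₂ x).trans (le_max_right _ _), hl, ?_⟩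
  -- By monotonicity the total variation is `g(-∞) - g(+∞) = 1`, whatever the width `ε`.
  have habs : ∀ x, |deriv g x| = -deriv g x := fun x ↦ abs_of_nonpos hanti.deriv_nonpos
  have hcs : HasCompactSupport (deriv g) :=
    HasCompactSupport.intro (isCompact_Icc (a := u) (b := u + ε)) fun x hx ↦ by
      rw [Set.mem_Icc, not_and_or, not_le, not_le] at hx
      exact hx.elim (hl x) (hr x)
  have hint : Integrable (deriv g) := hc'.integrable_of_hasCompactSupport hcs
  have htop : Tendsto g atTop (𝓝 0) := by
    refine tendsto_const_nhds.congr' ?_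
    filter_upwards [eventually_ge_atTop (u + ε)] with x hx using (hzero x hx).symm
  have hbot : Tendsto g atBot (𝓝 1) := by
    refine tendsto_const_nhds.congr' ?_
    filter_upwards [eventually_le_atBot u] with x hx using (hone x hx).symm
  have := integral_of_hasDerivAt_of_tendsto hd hint hbot htop
  simp_rw [habs]
  have hneg := ofReal_integral_eq_lintegral_ofReal (f := fun x ↦ -deriv g x) hint.neg
    (ae_of_all _ fun x ↦ by simpa using hanti.deriv_nonpos (x := x))
  rw [← hneg, integral_neg, this]
  norm_num

/-! ### The normal comparison inequality -/

section Interpolation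

variable {Ω : Type*} [MeasurableSpace Ω] {μ : Measure Ω} {ι : Type*} [Fintype ι]

/-- Meant for `p`, `q` the derivatives of smoothed indicators. Having mass at most `1`, they leave
only the supremum of the joint density over the quadrant, so the bound does not depend on the
smoothing width. -/
lemma abs_integral_comp_mul_comp_le {U V : Ω → ℝ} (hUV : HasGaussianLaw (fun ω ↦ (U ω, V ω)) μ)
    (hU0 : ∫ ω, U ω ∂μ = 0) (hV0 : ∫ ω, V ω ∂μ = 0) (hU1 : Var[U; μ] = 1) (hV1 : Var[V; μ] = 1)
    {w : ℝ} (hs : |cov[U, V; μ]| ≤ w) (hw : w < 1) {p q : ℝ → ℝ} (hp : Measurable p)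
    (hq : Measurable q) {a b : ℝ} (ha : 0 ≤ a) (hb : 0 ≤ b) (hpa : ∀ x < a, p x = 0)
    (hqb : ∀ x < b, q x = 0) (hp1 : ∫⁻ x, ENNReal.ofReal |p x| ≤ 1)
    (hq1 : ∫⁻ x, ENNReal.ofReal |q x| ≤ 1) {F : Ω → ℝ} (hF : ∀ ω, |F ω| ≤ |p (U ω)| * |q (V ω)|) :
    |∫ ω, F ω ∂μ| ≤ (√(1 - w ^ 2))⁻¹ * Real.exp (-(a ^ 2 + b ^ 2) / (2 * (1 + w))) := by
  have h1 := lintegral_mul_le_of_hasGaussianLaw hUV hU0 hV0 hU1 hV1 hs hw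
    (p := fun x ↦ ENNReal.ofReal |p x|) (q := fun x ↦ ENNReal.ofReal |q x|)
    (by fun_prop) (by fun_prop) ha hb (fun x hx ↦ by simp [hpa x hx])
    (fun x hx ↦ by simp [hqb x hx])
  have h2 : ∫⁻ ω, ENNReal.ofReal ‖F ω‖ ∂μ
      ≤ ENNReal.ofReal ((√(1 - w ^ 2))⁻¹ * Real.exp (-(a ^ 2 + b ^ 2) / (2 * (1 + w)))) := by
    refine (lintegral_mono fun ω ↦ ?_).trans (h1.trans ?_)
    · rw [← ENNReal.ofReal_mul (abs_nonneg _)]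
      exact ENNReal.ofReal_le_ofReal (hF ω)
    · refine mul_le_of_le_one_right' (mul_le_one' hp1 hq1)
  rw [← Real.norm_eq_abs]
  refine (norm_integral_le_lintegral_norm _).trans ?_
  exact ENNReal.toReal_le_of_le_ofReal (by positivity) h2

/-- Data for the interpolation between two uncorrelated, jointly Gaussian, standardised families. -/
structure IsStdGaussianPair (X Y : ι → Ω → ℝ) (μ : Measure Ω) : Prop where
  gaussian : HasGaussianLaw (fun ω ↦ ((fun i ↦ X i ω), (fun i ↦ Y i ω))) μ
  meas_left : ∀ i, Measurable (X i)
  meas_right : ∀ i, Measurable (Y i)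
  mean_left : ∀ i, ∫ ω, X i ω ∂μ = 0
  mean_right : ∀ i, ∫ ω, Y i ω ∂μ = 0
  var_left : ∀ i, Var[X i; μ] = 1
  var_right : ∀ i, Var[Y i; μ] = 1
  uncorrelated : ∀ i j, cov[X i, Y j; μ] = 0

namespace IsStdGaussianPair

variable {X Y : ι → Ω → ℝ} (h : IsStdGaussianPair X Y μ)

include h

lemma memLp_left (i : ι) : MemLp (X i) 2 μ := (h.gaussian.fst.eval i).memLp_two

lemma memLp_right (i : ι) : MemLp (Y i) 2 μ := (h.gaussian.snd.eval i).memLp_two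

lemma integral_linearComb (a b : ℝ) (i : ι) : ∫ ω, (a * X i ω + b * Y i ω) ∂μ = 0 := by
  have := h.gaussian.isProbabilityMeasure
  rw [integral_add (((h.memLp_left i).integrable (by norm_num)).const_mul a)
    (((h.memLp_right i).integrable (by norm_num)).const_mul b), integral_const_mul,
    integral_const_mul, h.mean_left, h.mean_right]
  simp

lemma covariance_linearComb (a b c d : ℝ) (i j : ι) :
    cov[fun ω ↦ a * X i ω + b * Y i ω, fun ω ↦ c * X j ω + d * Y j ω; μ]
      = a * c * cov[X i, X j; μ] + b * d * cov[Y i, Y j; μ] := by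
  have := h.gaussian.isProbabilityMeasure
  have h1 := h.memLp_left
  have h2 := h.memLp_right
  have e1 : (fun ω ↦ a * X i ω + b * Y i ω) = (fun ω ↦ a * X i ω) + fun ω ↦ b * Y i ω := rfl
  have e2 : (fun ω ↦ c * X j ω + d * Y j ω) = (fun ω ↦ c * X j ω) + fun ω ↦ d * Y j ω := rfl
  rw [e1, e2, covariance_add_left ((h1 i).const_mul a) ((h2 i).const_mul b)
    (((h1 j).const_mul c).add ((h2 j).const_mul d)),
    covariance_add_right ((h1 i).const_mul a) ((h1 j).const_mul c) ((h2 j).const_mul d),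
    covariance_add_right ((h2 i).const_mul b) ((h1 j).const_mul c) ((h2 j).const_mul d)]
  simp only [covariance_const_mul_left, covariance_const_mul_right]
  rw [h.uncorrelated, covariance_comm (Y i), h.uncorrelated]
  ring

lemma variance_linearComb {a b : ℝ} (hab : a ^ 2 + b ^ 2 = 1) (i : ι) :
    Var[fun ω ↦ a * X i ω + b * Y i ω; μ] = 1 := by
  have m1 := h.meas_left i
  have m2 := h.meas_right i
  rw [← covariance_self (by fun_prop), h.covariance_linearComb, covariance_self m1.aemeasurable,
    covariance_self m2.aemeasurable, h.var_left, h.var_right]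
  linarith

lemma hasGaussianLaw_linearComb (a b c d : ℝ) (i : ι) :
    HasGaussianLaw (fun ω ↦ (a * X i ω + b * Y i ω, fun j ↦ c * X j ω + d * Y j ω)) μ := by
  let p₁ : (ι → ℝ) × (ι → ℝ) →L[ℝ] ι → ℝ := ContinuousLinearMap.fst ℝ _ _
  let p₂ : (ι → ℝ) × (ι → ℝ) →L[ℝ] ι → ℝ := ContinuousLinearMap.snd ℝ _ _
  let T : (ι → ℝ) × (ι → ℝ) →L[ℝ] ℝ × (ι → ℝ) :=
    ContinuousLinearMap.prod
      (a • (ContinuousLinearMap.proj i).comp p₁ + b • (ContinuousLinearMap.proj i).comp p₂)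
      (c • p₁ + d • p₂)
  exact h.gaussian.map_fun T

/-- The path `Z = sin θ X + cos θ Y` keeps unit variances, and its velocity `Z'` is also standard
with `cov(Z'_i, Z_j) = sin θ cos θ (cov(X_i, X_j) - cov(Y_i, Y_j))`. Integrating by parts against
`Z'_i` therefore produces exactly the differences of covariances. Working with the angle avoids
singularities at the ends, and degenerate families are allowed. -/
lemma exists_hasDerivAt_interpolation [DecidableEq ι] {g g' g'' : ι → ℝ → ℝ} {B : ℝ}
    (hB1 : 1 ≤ B) (hd : ∀ i x, HasDerivAt (g i) (g' i x) x)
    (hd' : ∀ i x, HasDerivAt (g' i) (g'' i x) x)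
    (hg0 : ∀ i x, 0 ≤ g i x) (hg1 : ∀ i x, g i x ≤ 1) (hB' : ∀ i x, |g' i x| ≤ B)
    (hB'' : ∀ i x, |g'' i x| ≤ B) {u : ι → ℝ} (hu : ∀ i, 0 ≤ u i)
    (hgu : ∀ i, ∀ x < u i, g' i x = 0) (hgi : ∀ i, ∫⁻ x, ENNReal.ofReal |g' i x| ≤ 1)
    {w : ι → ι → ℝ} (hXw : ∀ i j, i ≠ j → |cov[X i, X j; μ]| ≤ w i j)
    (hYw : ∀ i j, i ≠ j → |cov[Y i, Y j; μ]| ≤ w i j) (hw : ∀ i j, i ≠ j → w i j < 1) (θ : ℝ) :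
    ∃ D', HasDerivAt
        (fun θ ↦ ∫ ω, ∏ k, g k (Real.sin θ * X k ω + Real.cos θ * Y k ω) ∂μ) D' θ ∧
      |D'| ≤ ∑ i, ∑ j ∈ Finset.univ.erase i, 1 / 2 * (|cov[X i, X j; μ] - cov[Y i, Y j; μ]| *
        ((√(1 - w i j ^ 2))⁻¹ * Real.exp (-(u i ^ 2 + u j ^ 2) / (2 * (1 + w i j))))) := by
  have hP := h.gaussian.isProbabilityMeasure
  let Z : ℝ → ι → Ω → ℝ := fun θ i ω ↦ Real.sin θ * X i ω + Real.cos θ * Y i ω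
  let Z' : ℝ → ι → Ω → ℝ := fun θ i ω ↦ Real.cos θ * X i ω + -Real.sin θ * Y i ω
  have hXm := h.meas_left
  have hYm := h.meas_right
  have hgm : ∀ i, Measurable (g i) := fun i ↦
    (continuous_iff_continuousAt.2 fun x ↦ (hd i x).continuousAt).measurable
  have hgm' : ∀ i, Measurable (g' i) := fun i ↦
    (continuous_iff_continuousAt.2 fun x ↦ (hd' i x).continuousAt).measurable
  have habs : ∀ (s : Finset ι) (y : ι → ℝ), |∏ k ∈ s, g k (y k)| ≤ 1 := fun s y ↦ by
    rw [Finset.abs_prod]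
    exact Finset.prod_le_one (fun _ _ ↦ abs_nonneg _)
      fun k _ ↦ by rw [abs_of_nonneg (hg0 _ _)]; exact hg1 _ _
  have hZm : ∀ θ i, Measurable (Z θ i) := fun θ i ↦ by fun_prop
  have hZm' : ∀ θ i, Measurable (Z' θ i) := fun θ i ↦ by fun_prop
  have hZd : ∀ i ω θ, HasDerivAt (fun θ ↦ Z θ i ω) (Z' θ i ω) θ := fun i ω θ ↦ by
    have := ((Real.hasDerivAt_sin θ).mul_const (X i ω)).add
      ((Real.hasDerivAt_cos θ).mul_const (Y i ω))
    exact this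
  have hZ'le : ∀ θ i ω, |Z' θ i ω| ≤ |X i ω| + |Y i ω| := fun θ i ω ↦ by
    refine (abs_add_le _ _).trans ?_
    rw [abs_mul, abs_mul, abs_neg]
    gcongr
    · exact mul_le_of_le_one_left (abs_nonneg _) (Real.abs_cos_le_one _)
    · exact mul_le_of_le_one_left (abs_nonneg _) (Real.abs_sin_le_one _)
  have hXi : ∀ i, Integrable (X i) μ := fun i ↦ (h.memLp_left i).integrable (by norm_num)
  have hYi : ∀ i, Integrable (Y i) μ := fun i ↦ (h.memLp_right i).integrable (by norm_num)
  let T : ℝ → ι → Ω → ℝ := fun θ i ω ↦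
    (∏ k ∈ Finset.univ.erase i, g k (Z θ k ω)) * (g' i (Z θ i ω) * Z' θ i ω)
  have hTle : ∀ θ i ω, |T θ i ω| ≤ B * (|X i ω| + |Y i ω|) := fun θ i ω ↦ by
    rw [abs_mul, abs_mul]
    calc _ ≤ 1 * (B * (|X i ω| + |Y i ω|)) := by
          gcongr
          · exact habs _ fun k ↦ Z θ k ω
          · exact hB' _ _
          · exact hZ'le θ i ω
      _ = _ := one_mul _
  have hbi : ∀ i, Integrable (fun ω ↦ B * (|X i ω| + |Y i ω|)) μ := fun i ↦
    (((hXi i).abs).add ((hYi i).abs)).const_mul B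
  have hTm : ∀ θ i, Measurable (T θ i) := fun θ i ↦ by fun_prop
  have hTi : ∀ θ i, Integrable (T θ i) μ := fun θ i ↦
    (hbi i).mono' (hTm θ i).aestronglyMeasurable (ae_of_all _ (hTle θ i))
  have hFm : ∀ θ, Measurable fun ω ↦ ∏ k, g k (Z θ k ω) := fun θ ↦ by fun_prop
  have hder := hasDerivAt_integral_of_dominated_loc_of_deriv_le (μ := μ) (x₀ := θ) (s := Set.univ)
    (F := fun θ ω ↦ ∏ k, g k (Z θ k ω)) (F' := fun θ ω ↦ ∑ i, T θ i ω)
    (bound := fun ω ↦ ∑ i, B * (|X i ω| + |Y i ω|)) Filter.univ_mem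
    (Eventually.of_forall fun θ ↦ (hFm θ).aestronglyMeasurable)
    (Integrable.of_bound (C := 1) (hFm θ).aestronglyMeasurable (ae_of_all _ fun ω ↦ habs _ fun k ↦ Z θ k ω))
    (by fun_prop)
    (ae_of_all _ fun ω θ _ ↦ (Finset.abs_sum_le_sum_abs _ _).trans
      (Finset.sum_le_sum fun i _ ↦ hTle θ i ω))
    (integrable_finsetSum _ fun i _ ↦ hbi i)
    (ae_of_all _ fun ω θ _ ↦ by
      have h1 : ∀ k, HasDerivAt (fun θ ↦ g k (Z θ k ω)) (g' k (Z θ k ω) * Z' θ k ω) θ :=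
        fun k ↦ by
          simpa [Function.comp_def] using! (hd k (Z θ k ω)).comp θ (hZd k ω θ)
      refine (HasDerivAt.fun_finsetProd fun k (_ : k ∈ Finset.univ) ↦ h1 k).congr_deriv ?_
      simp [T])
  refine ⟨_, hder.2, ?_⟩
  rw [integral_finsetSum _ fun i _ ↦ hTi θ i]
  refine (Finset.abs_sum_le_sum_abs _ _).trans (Finset.sum_le_sum fun i _ ↦ ?_)
  -- The `i`-th factor has already been differentiated once, so it enters as `g' i`, with derivative
  -- `g'' i`.
  have hstein := integral_mul_prod_eq_sum_covariance (V := Z' θ i) (W := Z θ)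
    (h.hasGaussianLaw_linearComb _ _ _ _ i) (h.integral_linearComb _ _ i)
    (h.variance_linearComb (by rw [neg_sq]; exact Real.cos_sq_add_sin_sq θ) i)
    (G := fun k ↦ if k = i then g' i else g k) (G' := fun k ↦ if k = i then g'' i else g' k)
    (B := B) (fun k x ↦ by
      by_cases hk : k = i
      · simpa [hk] using hd' i x
      · simpa [hk] using hd k x)
    (fun k x ↦ by
      by_cases hk : k = i
      · simpa [hk] using hB' i x
      · simp only [hk, if_false]
        rw [abs_of_nonneg (hg0 _ _)]
        exact (hg1 _ _).trans hB1)
    (fun k x ↦ by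
      by_cases hk : k = i
      · simpa [hk] using hB'' i x
      · simpa [hk] using hB' k x)
  have eT : ∫ ω, T θ i ω ∂μ
      = ∫ ω, Z' θ i ω * ∏ k, (if k = i then g' i else g k) (Z θ k ω) ∂μ := by
    refine integral_congr_ae (ae_of_all _ fun ω ↦ ?_)
    simp only [T]
    rw [← Finset.mul_prod_erase _ _ (Finset.mem_univ i)]
    have : ∏ k ∈ Finset.univ.erase i, (if k = i then g' i else g k) (Z θ k ω)
        = ∏ k ∈ Finset.univ.erase i, g k (Z θ k ω) :=
      Finset.prod_congr rfl fun k hk ↦ by simp [(Finset.mem_erase.1 hk).1]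
    rw [this]
    simp only [if_true]
    ring
  have hcov : ∀ j, cov[Z' θ i, Z θ j; μ]
      = Real.sin θ * Real.cos θ * (cov[X i, X j; μ] - cov[Y i, Y j; μ]) := fun j ↦ by
    rw [h.covariance_linearComb]
    ring
  have hsc : |Real.sin θ * Real.cos θ| ≤ 1 / 2 := by
    rw [abs_le]
    constructor <;> nlinarith [sq_nonneg (Real.sin θ + Real.cos θ),
      sq_nonneg (Real.sin θ - Real.cos θ), Real.sin_sq_add_cos_sq θ]
  -- The diagonal term, the only one with a second derivative, vanishes because both variances are
  -- `1`.
  rw [eT, hstein, ← Finset.add_sum_erase _ _ (Finset.mem_univ i), hcov,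
    covariance_self (hXm i).aemeasurable, covariance_self (hYm i).aemeasurable, h.var_left,
    h.var_right, sub_self, mul_zero, zero_mul, zero_add]
  refine (Finset.abs_sum_le_sum_abs _ _).trans (Finset.sum_le_sum fun j hj ↦ ?_)
  have hji : j ≠ i := (Finset.mem_erase.1 hj).1
  rw [hcov, abs_mul, abs_mul, mul_assoc]
  refine mul_le_mul hsc (mul_le_mul_of_nonneg_left ?_ (abs_nonneg _)) (by positivity) (by norm_num)
  have hc : |cov[Z θ i, Z θ j; μ]| ≤ w i j := by
    rw [h.covariance_linearComb]
    refine (abs_add_le _ _).trans ?_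
    rw [abs_mul, abs_mul (Real.cos θ * Real.cos θ), abs_of_nonneg (mul_self_nonneg (Real.sin θ)),
      abs_of_nonneg (mul_self_nonneg (Real.cos θ))]
    have h1 := mul_le_mul_of_nonneg_left (hXw i j hji.symm) (mul_self_nonneg (Real.sin θ))
    have h2 := mul_le_mul_of_nonneg_left (hYw i j hji.symm) (mul_self_nonneg (Real.cos θ))
    have h3 := Real.sin_sq_add_cos_sq θ
    calc _ ≤ Real.sin θ * Real.sin θ * w i j + Real.cos θ * Real.cos θ * w i j := add_le_add h1 h2
      _ = (Real.sin θ ^ 2 + Real.cos θ ^ 2) * w i j := by ring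
      _ = w i j := by rw [h3, one_mul]
  -- Only the second component of the joint law is used, so the coefficients of the first are set to
  -- `0`.
  refine abs_integral_comp_mul_comp_le (U := Z θ i) (V := Z θ j)
    ((h.hasGaussianLaw_linearComb 0 0 _ _ i).snd.prodMk i j)
    (h.integral_linearComb _ _ i) (h.integral_linearComb _ _ j)
    (h.variance_linearComb (Real.sin_sq_add_cos_sq θ) i)
    (h.variance_linearComb (Real.sin_sq_add_cos_sq θ) j) hc (hw i j hji.symm) (hgm' i) (hgm' j)
    (hu i) (hu j) (hgu i) (hgu j) (hgi i) (hgi j) fun ω ↦ ?_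
  have hij : i ∈ Finset.univ.erase j := Finset.mem_erase.2 ⟨hji.symm, Finset.mem_univ i⟩
  rw [← Finset.mul_prod_erase _ _ hij, abs_mul, abs_mul]
  have : ∏ k ∈ (Finset.univ.erase j).erase i, (if k = i then g' i else g k) (Z θ k ω)
      = ∏ k ∈ (Finset.univ.erase j).erase i, g k (Z θ k ω) :=
    Finset.prod_congr rfl fun k hk ↦ by simp [(Finset.mem_erase.1 hk).1]
  rw [this]
  simp only [if_true, hji, if_false]
  refine mul_le_mul_of_nonneg_right ?_ (abs_nonneg _)
  exact mul_le_of_le_one_right (abs_nonneg _) (habs _ fun k ↦ Z θ k ω)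

/-- The normal comparison inequality, for smooth approximations of the indicator functions. -/
lemma abs_integral_prod_sub_integral_prod_le [DecidableEq ι] {g g' g'' : ι → ℝ → ℝ} {B : ℝ}
    (hB1 : 1 ≤ B) (hd : ∀ i x, HasDerivAt (g i) (g' i x) x)
    (hd' : ∀ i x, HasDerivAt (g' i) (g'' i x) x)
    (hg0 : ∀ i x, 0 ≤ g i x) (hg1 : ∀ i x, g i x ≤ 1) (hB' : ∀ i x, |g' i x| ≤ B)
    (hB'' : ∀ i x, |g'' i x| ≤ B) {u : ι → ℝ} (hu : ∀ i, 0 ≤ u i)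
    (hgu : ∀ i, ∀ x < u i, g' i x = 0) (hgi : ∀ i, ∫⁻ x, ENNReal.ofReal |g' i x| ≤ 1)
    {w : ι → ι → ℝ} (hXw : ∀ i j, i ≠ j → |cov[X i, X j; μ]| ≤ w i j)
    (hYw : ∀ i j, i ≠ j → |cov[Y i, Y j; μ]| ≤ w i j) (hw : ∀ i j, i ≠ j → w i j < 1) :
    |∫ ω, ∏ k, g k (X k ω) ∂μ - ∫ ω, ∏ k, g k (Y k ω) ∂μ|
      ≤ ∑ i, ∑ j ∈ Finset.univ.erase i, (|cov[X i, X j; μ] - cov[Y i, Y j; μ]| *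
        ((√(1 - w i j ^ 2))⁻¹ * Real.exp (-(u i ^ 2 + u j ^ 2) / (2 * (1 + w i j))))) := by
  choose D' hD' hDle using fun θ ↦ h.exists_hasDerivAt_interpolation hB1 hd hd' hg0 hg1 hB' hB'' hu
    hgu hgi hXw hYw hw θ
  have key := norm_image_sub_le_of_norm_deriv_le_segment' (a := 0) (b := Real.pi / 2)
    (fun θ _ ↦ (hD' θ).hasDerivWithinAt) (fun θ _ ↦ hDle θ) (Real.pi / 2)
    ⟨by positivity, le_rfl⟩
  simp only [Real.sin_pi_div_two, Real.cos_pi_div_two, Real.sin_zero, Real.cos_zero, one_mul,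
    zero_mul, add_zero, zero_add, sub_zero] at key
  refine key.trans ?_
  simp_rw [← Finset.mul_sum]
  -- The interval length `π/2` times the factor `1/2` is `π/4 ≤ 1`.
  have hpi := Real.pi_le_four
  have hs : 0 ≤ ∑ i, ∑ j ∈ Finset.univ.erase i, (|cov[X i, X j; μ] - cov[Y i, Y j; μ]| *
      ((√(1 - w i j ^ 2))⁻¹ * Real.exp (-(u i ^ 2 + u j ^ 2) / (2 * (1 + w i j))))) :=
    Finset.sum_nonneg fun i _ ↦ Finset.sum_nonneg fun j _ ↦ by positivity
  nlinarith

end IsStdGaussianPair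

end Interpolation

/-- The normal comparison inequality for two standardised Gaussian measures. -/
theorem abs_measureReal_Iic_sub_le {ι : Type*} [Fintype ι] [DecidableEq ι]
    (μ ν : Measure (ι → ℝ)) [IsGaussian μ] [IsGaussian ν]
    (hμ0 : ∀ i, ∫ x, x i ∂μ = 0) (hν0 : ∀ i, ∫ x, x i ∂ν = 0)
    (hμ1 : ∀ i, Var[fun x ↦ x i; μ] = 1) (hν1 : ∀ i, Var[fun x ↦ x i; ν] = 1)
    {w : ι → ι → ℝ} (hμw : ∀ i j, i ≠ j → |cov[fun x ↦ x i, fun x ↦ x j; μ]| ≤ w i j)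
    (hνw : ∀ i j, i ≠ j → |cov[fun x ↦ x i, fun x ↦ x j; ν]| ≤ w i j)
    (hw : ∀ i j, i ≠ j → w i j < 1) {u : ι → ℝ} (hu : ∀ i, 0 ≤ u i) :
    |μ.real (Set.Iic u) - ν.real (Set.Iic u)|
      ≤ ∑ i, ∑ j ∈ Finset.univ.erase i,
        (|cov[fun x ↦ x i, fun x ↦ x j; μ] - cov[fun x ↦ x i, fun x ↦ x j; ν]| *
        ((√(1 - w i j ^ 2))⁻¹ * Real.exp (-(u i ^ 2 + u j ^ 2) / (2 * (1 + w i j))))) := by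
  let X : ι → (ι → ℝ) × (ι → ℝ) → ℝ := fun i ω ↦ ω.1 i
  let Y : ι → (ι → ℝ) × (ι → ℝ) → ℝ := fun i ω ↦ ω.2 i
  have hmX : ∀ i, MemLp (fun x : ι → ℝ ↦ x i) 2 μ := fun i ↦
    ((IsGaussian.hasGaussianLaw_id (μ := μ)).eval i).memLp_two
  have hmY : ∀ i, MemLp (fun x : ι → ℝ ↦ x i) 2 ν := fun i ↦
    ((IsGaussian.hasGaussianLaw_id (μ := ν)).eval i).memLp_two
  have hf : (μ.prod ν).map Prod.fst = μ := measurePreserving_fst.map_eq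
  have hs : (μ.prod ν).map Prod.snd = ν := measurePreserving_snd.map_eq
  have hcX : ∀ i j, cov[X i, X j; μ.prod ν] = cov[fun x ↦ x i, fun x ↦ x j; μ] := fun i j ↦ by
    conv_rhs => rw [← hf]
    rw [covariance_map_fun (measurable_pi_apply i).aestronglyMeasurable
      (measurable_pi_apply j).aestronglyMeasurable (by fun_prop)]
  have hcY : ∀ i j, cov[Y i, Y j; μ.prod ν] = cov[fun x ↦ x i, fun x ↦ x j; ν] := fun i j ↦ by
    conv_rhs => rw [← hs]
    rw [covariance_map_fun (measurable_pi_apply i).aestronglyMeasurable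
      (measurable_pi_apply j).aestronglyMeasurable (by fun_prop)]
  have hXm : ∀ i, Measurable (X i) := fun i ↦ by fun_prop
  have hYm : ∀ i, Measurable (Y i) := fun i ↦ by fun_prop
  have h : IsStdGaussianPair X Y (μ.prod ν) :=
    { gaussian := IsGaussian.hasGaussianLaw_id (μ := μ.prod ν)
      meas_left := hXm
      meas_right := hYm
      mean_left := fun i ↦ by
        have := integral_fun_fst (μ := μ) (ν := ν) (fun x : ι → ℝ ↦ x i)
        simpa [hμ0 i] using this
      mean_right := fun i ↦ by
        have := integral_fun_snd (μ := μ) (ν := ν) (fun x : ι → ℝ ↦ x i)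
        simpa [hν0 i] using this
      var_left := fun i ↦ by
        rw [← covariance_self (hXm i).aemeasurable, hcX, covariance_self (measurable_pi_apply i).aemeasurable, hμ1]
      var_right := fun i ↦ by
        rw [← covariance_self (hYm i).aemeasurable, hcY, covariance_self (measurable_pi_apply i).aemeasurable, hν1]
      uncorrelated := fun i j ↦ covariance_fst_snd_prod (hmX i) (hmY j) }
  -- The indicators are smoothed at width `1/(n+1)`. The resulting bound involves neither `n` nor
  -- the bounds `B` on the derivatives, so it survives the limit.
  have hε : ∀ n : ℕ, (0 : ℝ) < 1 / ((n : ℝ) + 1) := fun n ↦ by positivity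
  choose g g' g'' B h1 h2 h3 h4 h5 h6 h7 h8 h9 h10 using
    fun (n : ℕ) (i : ι) ↦ exists_smooth_indicator_Iic (u i) (hε n)
  have hBle : ∀ n i, B n i ≤ max 1 (∑ i, |B n i|) := fun n i ↦
    ((le_abs_self _).trans (Finset.single_le_sum (f := fun i ↦ |B n i|)
      (fun _ _ ↦ abs_nonneg _) (Finset.mem_univ i))).trans (le_max_right _ _)
  have key : ∀ n, _ := fun n ↦ h.abs_integral_prod_sub_integral_prod_le
    (g := g n) (g' := g' n) (g'' := g'' n) (B := max 1 (∑ i, |B n i|)) (le_max_left _ _)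
    (h1 n) (h2 n) (h3 n) (h4 n) (fun i x ↦ (h7 n i x).trans (hBle n i))
    (fun i x ↦ (h8 n i x).trans (hBle n i)) hu (h9 n) (h10 n) (w := w)
    (fun i j hij ↦ by rw [hcX]; exact hμw i j hij) (fun i j hij ↦ by rw [hcY]; exact hνw i j hij) hw
  simp only [hcX, hcY] at key
  have hlim : ∀ (κ : Measure (ι → ℝ)) [IsProbabilityMeasure κ],
      Tendsto (fun n ↦ ∫ x, ∏ k, g n k (x k) ∂κ) atTop (𝓝 (κ.real (Set.Iic u))) := fun κ _ ↦ by
    rw [← integral_indicator_one measurableSet_Iic]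
    refine tendsto_integral_of_dominated_convergence (fun _ ↦ 1) (fun n ↦ ?_) (integrable_const _)
      (fun n ↦ ae_of_all _ fun x ↦ ?_) (ae_of_all _ fun x ↦ ?_)
    · have : ∀ k, Measurable (g n k) := fun k ↦
        (continuous_iff_continuousAt.2 fun x ↦ (h1 n k x).continuousAt).measurable
      exact Measurable.aestronglyMeasurable (by fun_prop)
    · rw [Real.norm_eq_abs, Finset.abs_prod]
      exact Finset.prod_le_one (fun _ _ ↦ abs_nonneg _)
        fun k _ ↦ by rw [abs_of_nonneg (h3 _ _ _)]; exact h4 _ _ _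
    · by_cases hx : x ∈ Set.Iic u
      · rw [Set.indicator_of_mem hx]
        refine tendsto_const_nhds.congr fun n ↦ ?_
        rw [Finset.prod_eq_one fun k _ ↦ h5 n k (x k) (hx k)]
        rfl
      · rw [Set.indicator_of_notMem hx]
        simp only [Set.mem_Iic, Pi.le_def, not_forall, not_le] at hx
        obtain ⟨k, hk⟩ := hx
        refine tendsto_const_nhds.congr' ?_
        have ht := tendsto_one_div_add_atTop_nhds_zero_nat (𝕜 := ℝ)
        filter_upwards [ht.eventually_lt_const (sub_pos.2 hk)] with n hn
        rw [Finset.prod_eq_zero (Finset.mem_univ k) (h6 n k (x k) (by linarith))]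
  have eX : ∀ n, ∫ ω, ∏ k, g n k (X k ω) ∂(μ.prod ν) = ∫ x, ∏ k, g n k (x k) ∂μ := fun n ↦ by
    have := integral_fun_fst (μ := μ) (ν := ν) (fun x : ι → ℝ ↦ ∏ k, g n k (x k))
    simpa using this
  have eY : ∀ n, ∫ ω, ∏ k, g n k (Y k ω) ∂(μ.prod ν) = ∫ x, ∏ k, g n k (x k) ∂ν := fun n ↦ by
    have := integral_fun_snd (μ := μ) (ν := ν) (fun x : ι → ℝ ↦ ∏ k, g n k (x k))
    simpa using this
  simp only [eX, eY] at key
  exact le_of_tendsto (((hlim μ).sub (hlim ν)).abs) (Eventually.of_forall key)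

/-! ### Mills bounds and sums of normal tails along arithmetic progressions -/

/-- The tail of the standard normal distribution. -/
noncomputable def normalTail (t : ℝ) : ℝ := (gaussianReal 0 1).real (Set.Ioi t)

lemma normalTail_nonneg (t : ℝ) : 0 ≤ normalTail t := measureReal_nonneg

lemma normalTail_antitone : Antitone normalTail := fun _ _ hst ↦
  measureReal_mono (Set.Ioi_subset_Ioi hst)

lemma normalTail_eq_integral (t : ℝ) :
    normalTail t = ∫ x in Set.Ioi t, gaussianPDFReal 0 1 x := by
  rw [normalTail, measureReal_def, gaussianReal_apply_eq_integral _ one_ne_zero,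
    ENNReal.toReal_ofReal]
  exact setIntegral_nonneg measurableSet_Ioi fun x _ ↦ gaussianPDFReal_nonneg _ _ _

lemma gaussianPDFReal_zero_one_le (x : ℝ) :
    gaussianPDFReal 0 1 x ≤ Real.exp (-(1 / 2) * x ^ 2) := by
  rw [gaussianPDFReal_zero_one]
  refine mul_le_of_le_one_left (Real.exp_nonneg _) (inv_le_one_of_one_le₀ (Real.one_le_sqrt.2 ?_))
  linarith [Real.pi_gt_three]

lemma gaussianPDFReal_zero_one_antitoneOn {x y : ℝ} (hx : 0 ≤ x) (hxy : x ≤ y) :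
    gaussianPDFReal 0 1 y ≤ gaussianPDFReal 0 1 x := by
  rw [gaussianPDFReal_zero_one, gaussianPDFReal_zero_one]
  gcongr _ * Real.exp ?_
  nlinarith

lemma tendsto_gaussianPDFReal_zero_one_atTop :
    Tendsto (gaussianPDFReal 0 1) atTop (𝓝 0) := by
  refine squeeze_zero' (Eventually.of_forall fun x ↦ gaussianPDFReal_nonneg _ _ _) ?_
    (tendsto_inv_atTop_zero)
  filter_upwards [eventually_gt_atTop 2] with x hx
  refine (gaussianPDFReal_zero_one_le x).trans ?_
  rw [neg_mul, Real.exp_neg]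
  gcongr
  have := Real.add_one_le_exp (1 / 2 * x ^ 2)
  nlinarith

/-- The upper Mills bound. -/
lemma normalTail_le {t : ℝ} (ht : 0 < t) : normalTail t ≤ gaussianPDFReal 0 1 t / t := by
  have h1 : ∫ x in Set.Ioi t, x * gaussianPDFReal 0 1 x = 0 - -gaussianPDFReal 0 1 t := by
    refine integral_Ioi_of_hasDerivAt_of_tendsto' (f := fun x ↦ -gaussianPDFReal 0 1 x)
      (fun x _ ↦ ?_) integrable_mul_gaussianPDFReal_zero_one.integrableOn ?_
    · simpa using! (hasDerivAt_gaussianPDFReal_zero_one x).neg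
    · simpa using tendsto_gaussianPDFReal_zero_one_atTop.neg
  rw [normalTail_eq_integral, le_div_iff₀ ht, ← integral_mul_const]
  calc _ ≤ ∫ x in Set.Ioi t, x * gaussianPDFReal 0 1 x := by
        refine setIntegral_mono_on ((integrable_gaussianPDFReal 0 1).mul_const t).integrableOn
          integrable_mul_gaussianPDFReal_zero_one.integrableOn measurableSet_Ioi fun x hx ↦ ?_
        rw [mul_comm]
        exact mul_le_mul_of_nonneg_right (le_of_lt hx) (gaussianPDFReal_nonneg _ _ _)
    _ = _ := by rw [h1]; ring

/-- The lower Mills bound. -/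
lemma le_normalTail {t : ℝ} (ht : 0 < t) :
    gaussianPDFReal 0 1 t / t * (1 - 1 / t ^ 2) ≤ normalTail t := by
  have hint : IntegrableOn (fun x ↦ gaussianPDFReal 0 1 x * (1 - 3 / x ^ 4)) (Set.Ioi t) := by
    refine Integrable.mul_bdd (c := 1 + 3 / t ^ 4) (integrable_gaussianPDFReal 0 1).integrableOn
      (Measurable.aestronglyMeasurable (by fun_prop)) ?_
    refine (ae_restrict_iff' measurableSet_Ioi).2 (ae_of_all _ fun x hx ↦ ?_)
    have hx' : t < x := hx
    have h0 : 0 < x := ht.trans hx'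
    have h1 : 3 / x ^ 4 ≤ 3 / t ^ 4 := by gcongr
    have h2 : 0 ≤ 3 / x ^ 4 := by positivity
    rw [Real.norm_eq_abs, abs_le]
    constructor <;> linarith
  -- Here `φ(x)(1 - 3/x⁴)`, which is at most `φ(x)`, is the derivative of `-φ(x)(1/x - 1/x³)`.
  have h1 : ∫ x in Set.Ioi t, gaussianPDFReal 0 1 x * (1 - 3 / x ^ 4)
      = 0 - -(gaussianPDFReal 0 1 t * (t⁻¹ - (t ^ 3)⁻¹)) := by
    refine integral_Ioi_of_hasDerivAt_of_tendsto'
      (f := fun x ↦ -(gaussianPDFReal 0 1 x * (x⁻¹ - (x ^ 3)⁻¹))) (fun x hx ↦ ?_) hint ?_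
    · have hx0 : x ≠ 0 := (ht.trans_le hx).ne'
      have hd := ((hasDerivAt_gaussianPDFReal_zero_one x).mul
        ((hasDerivAt_inv hx0).sub ((hasDerivAt_pow 3 x).inv (pow_ne_zero 3 hx0)))).neg
      refine hd.congr_deriv ?_
      simp
      field_simp
      ring
    · have h3 : Tendsto (fun x : ℝ ↦ (x ^ 3)⁻¹) atTop (𝓝 0) :=
        (tendsto_pow_atTop (by norm_num)).inv_tendsto_atTop
      simpa using (tendsto_gaussianPDFReal_zero_one_atTop.mul
        (tendsto_inv_atTop_zero.sub h3)).neg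
  rw [normalTail_eq_integral]
  calc _ = ∫ x in Set.Ioi t, gaussianPDFReal 0 1 x * (1 - 3 / x ^ 4) := by
        rw [h1]; field_simp; ring
    _ ≤ _ := by
        refine setIntegral_mono_on hint (integrable_gaussianPDFReal 0 1).integrableOn
          measurableSet_Ioi fun x hx ↦ ?_
        have h0 : 0 < x := ht.trans hx
        refine mul_le_of_le_one_right (gaussianPDFReal_nonneg _ _ _) ?_
        have : 0 ≤ 3 / x ^ 4 := by positivity
        linarith

lemma normalTail_le_inv {t : ℝ} (ht : 0 < t) : normalTail t ≤ 1 / t := by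
  refine (normalTail_le ht).trans ?_
  gcongr
  refine (gaussianPDFReal_zero_one_le t).trans (Real.exp_le_one_iff.2 ?_)
  nlinarith [sq_nonneg t]

/-- Mean value theorem for `φ/t²`, whose derivative is `-(φ/t)(1 + 2/t²)`. By the Mills bounds this
is nearly minus the tail, which makes `φ/t²` the function along which tail sums telescope. -/
lemma exists_gaussianPDFReal_div_sq_sub_eq {t h : ℝ} (ht : 0 < t) (hh : 0 < h) :
    ∃ c ∈ Set.Ioo t (t + h), gaussianPDFReal 0 1 t / t ^ 2 -
      gaussianPDFReal 0 1 (t + h) / (t + h) ^ 2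
        = h * (gaussianPDFReal 0 1 c / c * (1 + 2 / c ^ 2)) := by
  have hd : ∀ x, 0 < x → HasDerivAt (fun x ↦ gaussianPDFReal 0 1 x / x ^ 2)
      (-(gaussianPDFReal 0 1 x / x * (1 + 2 / x ^ 2))) x := fun x hx ↦ by
    refine ((hasDerivAt_gaussianPDFReal_zero_one x).div (hasDerivAt_pow 2 x)
      (pow_ne_zero 2 hx.ne')).congr_deriv ?_
    simp
    field_simp
    ring
  obtain ⟨c, hc, hce⟩ := exists_hasDerivAt_eq_slope (fun x ↦ gaussianPDFReal 0 1 x / x ^ 2)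
    (fun x ↦ -(gaussianPDFReal 0 1 x / x * (1 + 2 / x ^ 2))) (a := t) (b := t + h) (by linarith)
    (fun x hx ↦ (hd x (ht.trans_le hx.1)).continuousAt.continuousWithinAt)
    (fun x hx ↦ hd x (ht.trans hx.1))
  refine ⟨c, hc, ?_⟩
  rw [add_sub_cancel_left, eq_div_iff hh.ne'] at hce
  linarith

lemma mul_normalTail_le {t h : ℝ} (ht : 0 < t) (hh : 0 < h) :
    h * normalTail (t + h) ≤ gaussianPDFReal 0 1 t / t ^ 2 -
      gaussianPDFReal 0 1 (t + h) / (t + h) ^ 2 := by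
  obtain ⟨c, hc, hce⟩ := exists_gaussianPDFReal_div_sq_sub_eq ht hh
  have hc0 : 0 < c := ht.trans hc.1
  rw [hce]
  refine mul_le_mul_of_nonneg_left ?_ hh.le
  refine (normalTail_antitone hc.2.le).trans ((normalTail_le hc0).trans ?_)
  refine le_mul_of_one_le_right (div_nonneg (gaussianPDFReal_nonneg _ _ _) hc0.le) ?_
  have : 0 ≤ 2 / c ^ 2 := by positivity
  linarith

/-- The prefactor absorbs both the Mills error and the error of the mean value theorem, uniformly
beyond `T`. It tends to `1` as `T → ∞`. -/
lemma le_mul_normalTail {T t h : ℝ} (hT : 1 ≤ T) (hTt : T ≤ t) (hh : 0 < h) :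
    (1 - 1 / T ^ 2) / (1 + 2 / T ^ 2) * (gaussianPDFReal 0 1 t / t ^ 2 -
      gaussianPDFReal 0 1 (t + h) / (t + h) ^ 2) ≤ h * normalTail t := by
  have hT0 : 0 < T := by linarith
  have ht : 0 < t := by linarith
  obtain ⟨c, hc, hce⟩ := exists_gaussianPDFReal_div_sq_sub_eq ht hh
  have hc0 : 0 < c := ht.trans hc.1
  have hTc : T ≤ c := hTt.trans hc.1.le
  have hA : 0 ≤ 1 - 1 / T ^ 2 := by
    rw [sub_nonneg, div_le_one (by positivity)]
    exact one_le_pow₀ hT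
  rw [hce]
  have h1 : gaussianPDFReal 0 1 c / c ≤ gaussianPDFReal 0 1 t / t :=
    div_le_div₀ (gaussianPDFReal_nonneg _ _ _)
      (gaussianPDFReal_zero_one_antitoneOn ht.le hc.1.le) ht hc.1.le
  have h2 : 2 / c ^ 2 ≤ 2 / T ^ 2 := by gcongr
  have h3 : 1 / t ^ 2 ≤ 1 / T ^ 2 := by gcongr
  have hp : 0 ≤ gaussianPDFReal 0 1 t / t := div_nonneg (gaussianPDFReal_nonneg _ _ _) ht.le
  calc _ ≤ (1 - 1 / T ^ 2) / (1 + 2 / T ^ 2) *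
          (h * (gaussianPDFReal 0 1 t / t * (1 + 2 / T ^ 2))) := by gcongr
    _ = h * (gaussianPDFReal 0 1 t / t * (1 - 1 / T ^ 2)) := by
        have : (1 + 2 / T ^ 2) ≠ 0 := by positivity
        field_simp
    _ ≤ h * (gaussianPDFReal 0 1 t / t * (1 - 1 / t ^ 2)) := by gcongr
    _ ≤ _ := by
        gcongr
        exact le_normalTail ht

/-- Telescoping of `mul_normalTail_le`. The tail at `i` is paid for by the cell on its left, so the
bound starts at `n`; in `le_sum_normalTail` the cell lies on the right and the bound starts at `n +
1`. -/
lemma sum_normalTail_le {h s : ℝ} (hh : 0 < h) {n N : ℕ} (hn : 0 < h * n - s) :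
    h * ∑ i ∈ Finset.Ioc n N, normalTail (h * i - s)
      ≤ gaussianPDFReal 0 1 (h * n - s) / (h * n - s) ^ 2 := by
  rcases le_total N n with hNn | hnN
  · rw [Finset.Ioc_eq_empty_of_le hNn]
    simp only [Finset.sum_empty, mul_zero]
    exact div_nonneg (gaussianPDFReal_nonneg _ _ _) (sq_nonneg _)
  · suffices H : h * ∑ i ∈ Finset.Ioc n N, normalTail (h * i - s)
        ≤ gaussianPDFReal 0 1 (h * n - s) / (h * n - s) ^ 2 -
          gaussianPDFReal 0 1 (h * N - s) / (h * N - s) ^ 2 by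
      refine H.trans (sub_le_self _ (div_nonneg (gaussianPDFReal_nonneg _ _ _) (sq_nonneg _)))
    induction N, hnN using Nat.le_induction with
    | base => simp
    | succ N hnN ih =>
      rw [← Finset.insert_Ioc_right_eq_Ioc_add_one hnN, Finset.sum_insert (by simp), mul_add]
      have hN : 0 < h * N - s := by
        have : h * (n : ℝ) ≤ h * N := by gcongr
        linarith
      have := mul_normalTail_le hN hh
      have e : h * (N : ℝ) - s + h = h * ((N + 1 : ℕ) : ℝ) - s := by push_cast; ring
      rw [e] at this
      linarith

lemma le_sum_normalTail {h s T : ℝ} (hh : 0 < h) (hT : 1 ≤ T) {n N : ℕ} (hnN : n ≤ N)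
    (hn : T ≤ h * (n + 1 : ℕ) - s) :
    (1 - 1 / T ^ 2) / (1 + 2 / T ^ 2) *
        (gaussianPDFReal 0 1 (h * (n + 1 : ℕ) - s) / (h * (n + 1 : ℕ) - s) ^ 2 -
          gaussianPDFReal 0 1 (h * (N + 1 : ℕ) - s) / (h * (N + 1 : ℕ) - s) ^ 2)
      ≤ h * ∑ i ∈ Finset.Ioc n N, normalTail (h * i - s) := by
  induction N, hnN using Nat.le_induction with
  | base => simp
  | succ N hnN ih =>
    rw [← Finset.insert_Ioc_right_eq_Ioc_add_one hnN, Finset.sum_insert (by simp), mul_add]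
    have hN : T ≤ h * (N + 1 : ℕ) - s := by
      have : h * ((n + 1 : ℕ) : ℝ) ≤ h * (N + 1 : ℕ) := by gcongr
      linarith
    have := le_mul_normalTail hT hN hh
    have e : h * ((N + 1 : ℕ) : ℝ) - s + h = h * ((N + 1 + 1 : ℕ) : ℝ) - s := by push_cast; ring
    rw [e] at this
    rw [mul_sub] at this ih ⊢
    linarith

lemma prod_one_sub_le_exp {ι : Type*} (s : Finset ι) {p : ι → ℝ} (hp1 : ∀ i ∈ s, p i ≤ 1) :
    ∏ i ∈ s, (1 - p i) ≤ Real.exp (-∑ i ∈ s, p i) := by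
  rw [← Finset.sum_neg_distrib, Real.exp_sum]
  exact Finset.prod_le_prod (fun i hi ↦ by linarith [hp1 i hi])
    fun i _ ↦ Real.one_sub_le_exp_neg _

/-- From `1/(1-p) = 1 + p/(1-p) ≤ exp (p/(1-p))` and `1 - p ≥ 1 - η`. -/
lemma exp_le_prod_one_sub {ι : Type*} (s : Finset ι) {p : ι → ℝ} {η : ℝ} (hη : η < 1)
    (hp0 : ∀ i ∈ s, 0 ≤ p i) (hp1 : ∀ i ∈ s, p i ≤ η) :
    Real.exp (-((∑ i ∈ s, p i) / (1 - η))) ≤ ∏ i ∈ s, (1 - p i) := by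
  rw [Finset.sum_div, ← Finset.sum_neg_distrib, Real.exp_sum]
  refine Finset.prod_le_prod (fun i _ ↦ Real.exp_nonneg _) fun i hi ↦ ?_
  have h0 := hp0 i hi
  have h1 := hp1 i hi
  have hpos : 0 < 1 - p i := by linarith
  have hle : p i / (1 - p i) ≤ p i / (1 - η) := by
    gcongr
  have h2 : 1 / (1 - p i) ≤ Real.exp (p i / (1 - η)) := by
    refine le_trans ?_ (Real.add_one_le_exp _)
    refine le_trans (le_of_eq ?_) (add_le_add_left hle 1)
    field_simp
    ring
  rw [Real.exp_neg, inv_le_comm₀ (Real.exp_pos _) hpos, ← one_div]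
  exact h2

/-! ### Levels and their perturbation -/

/-- The function `τ` of `L = ln β⁻¹` is a level whose expected number of crossings of the line of
slope `β = exp (-L)` converges to `exp (-κ)`. -/
def IsLevel (τ : ℝ → ℝ) (κ : ℝ) : Prop :=
  Tendsto (fun L ↦ τ L ^ 2 / 2 - (L - Real.log (2 * L) - Real.log (2 * Real.pi) / 2)) atTop (𝓝 κ)

lemma tendsto_log_two_mul_div_atTop : Tendsto (fun L : ℝ ↦ Real.log (2 * L) / L) atTop (𝓝 0) := by
  have h1 : Tendsto (fun x : ℝ ↦ Real.log x / x) atTop (𝓝 0) := by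
    simpa using Real.isLittleO_log_id_atTop.tendsto_div_nhds_zero
  have h2 : Tendsto (fun L : ℝ ↦ 2 * L) atTop atTop := tendsto_id.const_mul_atTop two_pos
  have h3 := (h1.comp h2).const_mul 2
  rw [mul_zero] at h3
  refine h3.congr fun L ↦ ?_
  simp only [Function.comp_apply]
  rcases eq_or_ne L 0 with rfl | hL
  · simp
  · field_simp

lemma tendsto_sqrt_two_mul_atTop : Tendsto (fun L : ℝ ↦ √(2 * L)) atTop atTop :=
  Real.tendsto_sqrt_atTop.comp (tendsto_id.const_mul_atTop two_pos)

lemma tendsto_exp_neg_mul_sqrt : Tendsto (fun L : ℝ ↦ Real.exp (-L) * √(2 * L)) atTop (𝓝 0) := by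
  have h := (Real.tendsto_pow_mul_exp_neg_atTop_nhds_zero 1).const_mul 2
  rw [mul_zero] at h
  refine squeeze_zero' (Eventually.of_forall fun L ↦ by positivity) ?_ h
  filter_upwards [eventually_ge_atTop 1] with L hL
  have : √(2 * L) ≤ 2 * L := Real.sqrt_le_iff.2 ⟨by linarith, by nlinarith⟩
  calc _ ≤ Real.exp (-L) * (2 * L) := by gcongr
    _ = _ := by ring

lemma tendsto_div_id_atTop (γ : ℝ) : Tendsto (fun L : ℝ ↦ γ / L) atTop (𝓝 0) :=
  tendsto_const_nhds.div_atTop tendsto_id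

lemma tendsto_one_sub_div_atTop (γ : ℝ) : Tendsto (fun L : ℝ ↦ 1 - γ / L) atTop (𝓝 1) := by
  simpa using (tendsto_div_id_atTop γ).const_sub 1

namespace IsLevel

variable {τ : ℝ → ℝ} {κ : ℝ}

lemma tendsto_sq_div (h : IsLevel τ κ) : Tendsto (fun L ↦ τ L ^ 2 / (2 * L)) atTop (𝓝 1) := by
  have h1 := (h.mul tendsto_inv_atTop_zero).sub (tendsto_log_two_mul_div_atTop.add
    (tendsto_div_id_atTop (Real.log (2 * Real.pi) / 2)))
  have h2 := h1.const_add 1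
  simp only [mul_zero, add_zero, sub_zero] at h2
  refine h2.congr' ?_
  filter_upwards [eventually_gt_atTop 0] with L hL
  field_simp
  ring

lemma tendsto_div_sqrt (h : IsLevel τ κ) (h0 : ∀ᶠ L in atTop, 0 ≤ τ L) :
    Tendsto (fun L ↦ τ L / √(2 * L)) atTop (𝓝 1) := by
  have h1 := h.tendsto_sq_div.sqrt
  rw [Real.sqrt_one] at h1
  refine h1.congr' ?_
  filter_upwards [h0] with L hL
  rw [Real.sqrt_div (sq_nonneg _), Real.sqrt_sq hL]

lemma tendsto_atTop (h : IsLevel τ κ) (h0 : ∀ᶠ L in atTop, 0 ≤ τ L) : Tendsto τ atTop atTop := by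
  refine ((h.tendsto_div_sqrt h0).pos_mul_atTop one_pos tendsto_sqrt_two_mul_atTop).congr' ?_
  filter_upwards [eventually_gt_atTop 0] with L hL
  have : 0 < √(2 * L) := Real.sqrt_pos.2 (by linarith)
  field_simp

/-- In `(τ + d)² / (2(1 - γ/L))`, since `τ ~ √(2L)`, the division adds `γτ²/(2L) → γ`, the cross
term `τd` tends to `δ`, and `d²` vanishes. -/
lemma add_div_sqrt (h : IsLevel τ κ) (h0 : ∀ᶠ L in atTop, 0 ≤ τ L) {d : ℝ → ℝ} {δ : ℝ}
    (hd : Tendsto (fun L ↦ d L * √(2 * L)) atTop (𝓝 δ)) (γ : ℝ) :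
    IsLevel (fun L ↦ (τ L + d L) / √(1 - γ / L)) (κ + γ + δ) := by
  have hρ := tendsto_one_sub_div_atTop γ
  have hs := h.tendsto_div_sqrt h0
  have hd0 : Tendsto d atTop (𝓝 0) := by
    refine (hd.div_atTop tendsto_sqrt_two_mul_atTop).congr' ?_
    filter_upwards [eventually_gt_atTop 0] with L hL
    have : 0 < √(2 * L) := Real.sqrt_pos.2 (by linarith)
    field_simp
  have h1 := ((h.tendsto_sq_div.mul_const γ).div hρ one_ne_zero)
  have h2 := (hs.mul hd).div hρ one_ne_zero
  have h3 := (hd0.pow 2).div (hρ.const_mul 2) (by norm_num)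
  have h4 := ((Tendsto.add (show Tendsto _ _ _ from h) h1).add h2).add h3
  simp only [one_mul, div_one] at h4
  norm_num at h4
  refine h4.congr' ?_
  filter_upwards [eventually_gt_atTop 0, eventually_gt_atTop γ] with L hL hLγ
  have hs0 : 0 < √(2 * L) := Real.sqrt_pos.2 (by linarith)
  have hρ0 : 0 < 1 - γ / L := by rw [sub_pos, div_lt_one hL]; exact hLγ
  have hρ1 : L - γ ≠ 0 := by linarith
  rw [div_pow, Real.sq_sqrt hρ0.le]
  field_simp
  ring

/-- The definition of a level gives `exp (-τ²/2) ≈ exp (-κ) · 2L √(2π) exp (-L)`, and `τ² ~ 2L`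
cancels the factor `2L`. The denominator is the mesh of the conditional levels `condLevel γ z L i`
in `i`. -/
lemma tendsto_density (h : IsLevel τ κ) (γ : ℝ) :
    Tendsto (fun L ↦ gaussianPDFReal 0 1 (τ L) / τ L ^ 2 / (Real.exp (-L) / √(1 - γ / L)))
      atTop (𝓝 (Real.exp (-κ))) := by
  have h1 : Tendsto (fun L ↦ (τ L ^ 2 / (2 * L))⁻¹) atTop (𝓝 1) := by
    simpa using h.tendsto_sq_div.inv₀ one_ne_zero
  have h2 : Tendsto (fun L ↦ √(1 - γ / L)) atTop (𝓝 1) := by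
    simpa using (tendsto_one_sub_div_atTop γ).sqrt
  have h3 := (Real.continuous_exp.tendsto _).comp (Tendsto.neg (show Tendsto _ _ _ from h))
  have h4 := (h1.mul h2).mul h3
  simp only [one_mul] at h4
  refine h4.congr' ?_
  filter_upwards [eventually_gt_atTop 0] with L hL
  have e : Real.exp (-(τ L ^ 2 / 2 - (L - Real.log (2 * L) - Real.log (2 * Real.pi) / 2)))
      = Real.exp (-(1 / 2) * τ L ^ 2) * Real.exp L / (2 * L) / √(2 * Real.pi) := by
    have e1 : Real.exp (Real.log (2 * L)) = 2 * L := Real.exp_log (by linarith)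
    have e2 : Real.exp (Real.log (2 * Real.pi) / 2) = √(2 * Real.pi) := by
      rw [← Real.log_sqrt (by positivity), Real.exp_log (Real.sqrt_pos.2 (by positivity))]
    rw [← e2]
    nth_rw 2 [← e1]
    rw [← Real.exp_add, ← Real.exp_sub, ← Real.exp_sub]
    congr 1
    ring
  simp only [Function.comp_apply]
  rw [e, gaussianPDFReal_zero_one, Real.exp_neg L]
  field_simp

end IsLevel

/-! ### Tail sums and products along the line, given the common component -/

/-- The largest index up to which the line of slope `exp (-L)` is below `t`. -/
noncomputable def lineIndex (L t : ℝ) : ℕ := ⌊t * Real.exp L⌋₊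

lemma lineIndex_lt_iff {L t : ℝ} (ht : 0 ≤ t) (i : ℕ) :
    lineIndex L t < i ↔ t < Real.exp (-L) * i := by
  rw [lineIndex, Nat.floor_lt (by positivity), Real.exp_neg, ← div_eq_inv_mul,
    lt_div_iff₀ (Real.exp_pos L)]

lemma le_lineIndex_iff {L t : ℝ} (ht : 0 ≤ t) (i : ℕ) :
    i ≤ lineIndex L t ↔ Real.exp (-L) * i ≤ t := by
  rw [← not_lt, lineIndex_lt_iff ht, not_lt]

lemma mem_Ioc_lineIndex {L s t : ℝ} (hs : 0 ≤ s) (ht : 0 ≤ t) {i : ℕ} :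
    i ∈ Finset.Ioc (lineIndex L s) (lineIndex L t) ↔
      s < Real.exp (-L) * i ∧ Real.exp (-L) * i ≤ t := by
  rw [Finset.mem_Ioc, lineIndex_lt_iff hs, le_lineIndex_iff ht]

section TailSum

variable {v : ℝ → ℝ} {κ γ : ℝ}

lemma sqrt_div_mul_sqrt (hγ : 0 ≤ γ) {L : ℝ} (hL : 0 < L) : √(γ / L) * √(2 * L) = √(2 * γ) := by
  rw [← Real.sqrt_mul (by positivity)]
  congr 1
  field_simp

/-- Rounding `v` to the mesh moves it by at most `exp (-L)`, negligible against `1/√(2L)`, while the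
shift `√(γ/L) z` times `√(2L)` is `√(2γ) z`. -/
lemma isLevel_of_abs_sub_le (hv : IsLevel v κ) (hv0 : ∀ᶠ L in atTop, 0 ≤ v L) (hγ : 0 ≤ γ) (z : ℝ)
    {m : ℝ → ℕ} (hm : ∀ᶠ L in atTop, |Real.exp (-L) * m L - v L| ≤ Real.exp (-L)) :
    IsLevel (fun L ↦ Real.exp (-L) / √(1 - γ / L) * m L - √(γ / L) * z / √(1 - γ / L))
      (κ + γ - √(2 * γ) * z) := by
  have hd : Tendsto (fun L ↦ (Real.exp (-L) * m L - v L - √(γ / L) * z) * √(2 * L)) atTop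
      (𝓝 (-(√(2 * γ) * z))) := by
    have h1 : Tendsto (fun L ↦ (Real.exp (-L) * m L - v L) * √(2 * L)) atTop (𝓝 0) := by
      refine squeeze_zero_norm' ?_ tendsto_exp_neg_mul_sqrt
      filter_upwards [hm] with L hL
      rw [Real.norm_eq_abs, abs_mul, abs_of_nonneg (Real.sqrt_nonneg _)]
      gcongr
    have h2 := h1.sub_const (√(2 * γ) * z)
    rw [zero_sub] at h2
    refine h2.congr' ?_
    filter_upwards [eventually_gt_atTop 0] with L hL
    rw [← sqrt_div_mul_sqrt hγ hL]
    ring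
  have := hv.add_div_sqrt hv0 hd γ
  rw [← sub_eq_add_neg] at this
  convert this using 2 with L
  ring

/-- The lower and upper tail-sum bounds start at adjacent indices. Both lie within one mesh of `v`,
so they yield the same limit. -/
lemma eventually_lineIndex (hv0 : ∀ᶠ L in atTop, 0 ≤ v L) :
    (∀ᶠ L in atTop, |Real.exp (-L) * lineIndex L (v L) - v L| ≤ Real.exp (-L)) ∧
    (∀ᶠ L in atTop, |Real.exp (-L) * (lineIndex L (v L) + 1 : ℕ) - v L| ≤ Real.exp (-L)) := by
  have key : ∀ L, 0 ≤ v L → Real.exp (-L) * lineIndex L (v L) ≤ v L ∧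
      v L ≤ Real.exp (-L) * lineIndex L (v L) + Real.exp (-L) := fun L hL ↦ by
    refine ⟨(le_lineIndex_iff hL _).1 le_rfl, ?_⟩
    have := (lineIndex_lt_iff (L := L) hL (lineIndex L (v L) + 1)).1 (Nat.lt_succ_self _)
    push_cast at this
    linarith
  constructor
  · filter_upwards [hv0] with L hL
    obtain ⟨h1, h2⟩ := key L hL
    rw [abs_le]
    constructor <;> linarith [Real.exp_pos (-L)]
  · filter_upwards [hv0] with L hL
    obtain ⟨h1, h2⟩ := key L hL
    push_cast
    rw [abs_le]
    constructor <;> linarith [Real.exp_pos (-L)]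

lemma IsLevel.eventually_lt_three_mul_sqrt (hv : IsLevel v κ) :
    ∀ᶠ L in atTop, v L < 3 * √L := by
  filter_upwards [hv.tendsto_sq_div.eventually_lt_const (show (1 : ℝ) < 2 by norm_num),
    eventually_gt_atTop 0] with L h1 h2
  rw [div_lt_iff₀ (by positivity)] at h1
  refine lt_of_pow_lt_pow_left₀ 2 (by positivity) ?_
  rw [mul_pow, Real.sq_sqrt h2.le]
  linarith

/-- The argument of the normal tail for the crossing of the line at `i`, given the value `z` of the
common component. -/
noncomputable def condLevel (γ z L : ℝ) (i : ℕ) : ℝ :=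
  (Real.exp (-L) * i - √(γ / L) * z) / √(1 - γ / L)

lemma condLevel_eq (γ z L : ℝ) (i : ℕ) : condLevel γ z L i =
    Real.exp (-L) / √(1 - γ / L) * i - √(γ / L) * z / √(1 - γ / L) := by
  rw [condLevel]; ring

lemma condLevel_mono (γ z L : ℝ) {i j : ℕ} (hij : i ≤ j) :
    condLevel γ z L i ≤ condLevel γ z L j := by
  unfold condLevel
  gcongr

lemma isLevel_condLevel (hv : IsLevel v κ) (hv0 : ∀ᶠ L in atTop, 0 ≤ v L) (hγ : 0 ≤ γ) (z : ℝ)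
    {m : ℝ → ℕ} (hm : ∀ᶠ L in atTop, |Real.exp (-L) * m L - v L| ≤ Real.exp (-L)) :
    IsLevel (fun L ↦ condLevel γ z L (m L)) (κ + γ - √(2 * γ) * z) := by
  simp_rw [condLevel_eq]
  exact isLevel_of_abs_sub_le hv hv0 hγ z hm

/-- `IsLevel` sees only `τ²`, so the sign, needed for divergence to `+∞`, has to be supplied
separately. -/
lemma eventually_condLevel_nonneg (hv : IsLevel v κ) (hv0 : ∀ᶠ L in atTop, 0 ≤ v L) (z : ℝ)
    {m : ℝ → ℕ} (hm : ∀ᶠ L in atTop, |Real.exp (-L) * m L - v L| ≤ Real.exp (-L)) :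
    ∀ᶠ L in atTop, 0 ≤ condLevel γ z L (m L) := by
  have hρ : Tendsto (fun L ↦ √(γ / L) * z) atTop (𝓝 0) := by
    simpa using (tendsto_div_id_atTop γ).sqrt.mul_const z
  filter_upwards [hm, (hv.tendsto_atTop hv0).eventually_gt_atTop 2,
    hρ.eventually_lt_const one_pos, eventually_gt_atTop 0] with L h1 h2 h3 h4
  refine div_nonneg ?_ (Real.sqrt_nonneg _)
  have h5 : Real.exp (-L) ≤ 1 := Real.exp_le_one_iff.2 (by linarith)
  linarith [(abs_le.1 h1).1]

/-- Beyond the cutoff the conditional level is at least `2√L`, so the density is at most `exp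
(-2L)`, against a mesh of order `exp (-L)`. The upper end of the telescoping sum is thus negligible.
-/
lemma tendsto_density_cutoff (hγ : 0 ≤ γ) (z : ℝ) :
    Tendsto (fun L ↦ gaussianPDFReal 0 1 (condLevel γ z L (lineIndex L (3 * √L) + 1)) /
      condLevel γ z L (lineIndex L (3 * √L) + 1) ^ 2 / (Real.exp (-L) / √(1 - γ / L)))
      atTop (𝓝 0) := by
  have hρ : Tendsto (fun L ↦ √(γ / L) * z) atTop (𝓝 0) := by
    simpa using (tendsto_div_id_atTop γ).sqrt.mul_const z
  have he : Tendsto (fun L : ℝ ↦ Real.exp (-L)) atTop (𝓝 0) := Real.tendsto_exp_neg_atTop_nhds_zero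
  refine squeeze_zero' (Eventually.of_forall fun L ↦ ?_) ?_ he
  · exact div_nonneg (div_nonneg (gaussianPDFReal_nonneg _ _ _) (sq_nonneg _)) (by positivity)
  filter_upwards [hρ.eventually_lt_const one_pos, eventually_gt_atTop 1, eventually_gt_atTop γ]
    with L h1 h2 h3
  have hL : 0 < L := by linarith
  have hρ0 : 0 < 1 - γ / L := by rw [sub_pos, div_lt_one hL]; exact h3
  have hs1 : √(1 - γ / L) ≤ 1 := Real.sqrt_le_one.2 (by linarith [div_nonneg hγ hL.le])
  have hs0 : 0 < √(1 - γ / L) := Real.sqrt_pos.2 hρ0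
  have hL1 : 1 ≤ √L := Real.one_le_sqrt.2 h2.le
  set t := condLevel γ z L (lineIndex L (3 * √L) + 1) with ht
  have ht2 : 2 * √L ≤ t := by
    rw [ht, condLevel, le_div_iff₀ hs0]
    have := (lineIndex_lt_iff (L := L) (t := 3 * √L) (by positivity)
      (lineIndex L (3 * √L) + 1)).1 (Nat.lt_succ_self _)
    calc _ ≤ 2 * √L * 1 := by gcongr
      _ ≤ _ := by linarith
  have hsq : 4 * L ≤ t ^ 2 := by
    have := pow_le_pow_left₀ (by positivity) ht2 2
    rw [mul_pow, Real.sq_sqrt hL.le] at this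
    linarith
  rw [div_div, div_le_iff₀ (mul_pos (by linarith) (by positivity))]
  calc gaussianPDFReal 0 1 t ≤ Real.exp (-(1 / 2) * t ^ 2) := gaussianPDFReal_zero_one_le t
    _ ≤ Real.exp (-L + -L) := Real.exp_le_exp.2 (by linarith)
    _ = Real.exp (-L) * (1 * (Real.exp (-L) / 1)) := by rw [Real.exp_add]; ring
    _ ≤ _ := by
        gcongr
        linarith

lemma tendsto_sum_normalTail (hv : IsLevel v κ) (hv0 : ∀ᶠ L in atTop, 0 ≤ v L) (hγ : 0 ≤ γ)
    (z : ℝ) :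
    Tendsto (fun L ↦ ∑ i ∈ Finset.Ioc (lineIndex L (v L)) (lineIndex L (3 * √L)),
      normalTail (condLevel γ z L i)) atTop (𝓝 (Real.exp (-(κ + γ - √(2 * γ) * z)))) := by
  obtain ⟨hm0, hm1⟩ := eventually_lineIndex hv0
  have l0 := isLevel_condLevel hv hv0 hγ z hm0
  have l1 := isLevel_condLevel hv hv0 hγ z hm1
  have p0 := eventually_condLevel_nonneg (γ := γ) hv hv0 z hm0
  have p1 := eventually_condLevel_nonneg (γ := γ) hv hv0 z hm1
  have t0 := l0.tendsto_atTop p0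
  have t1 := l1.tendsto_atTop p1
  have hfac : Tendsto (fun T : ℝ ↦ (1 - 1 / T ^ 2) / (1 + 2 / T ^ 2)) atTop (𝓝 1) := by
    have h1 : Tendsto (fun T : ℝ ↦ T ^ 2) atTop atTop := tendsto_pow_atTop (by norm_num)
    have := ((tendsto_const_nhds (x := (1 : ℝ))).div_atTop h1).const_sub 1
    have h2 := ((tendsto_const_nhds (x := (2 : ℝ))).div_atTop h1).const_add 1
    simpa using! this.div h2 (by norm_num)
  have lower := (hfac.comp t1).mul ((l1.tendsto_density γ).sub (tendsto_density_cutoff hγ z))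
  rw [sub_zero, one_mul] at lower
  refine tendsto_of_tendsto_of_tendsto_of_le_of_le' lower (l0.tendsto_density γ) ?_ ?_
  · filter_upwards [t1.eventually_ge_atTop 1, hv.eventually_lt_three_mul_sqrt, hv0,
      eventually_gt_atTop 0, eventually_gt_atTop γ] with L h1 h2 h3 h4 h5
    have hs0 : 0 < √(1 - γ / L) := Real.sqrt_pos.2 (by rw [sub_pos, div_lt_one h4]; exact h5)
    have hh : 0 < Real.exp (-L) / √(1 - γ / L) := by positivity
    have hnN : lineIndex L (v L) ≤ lineIndex L (3 * √L) :=
      Nat.floor_le_floor (by gcongr)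
    have := le_sum_normalTail hh h1 hnN (s := √(γ / L) * z / √(1 - γ / L))
      (by rw [← condLevel_eq])
    simp only [← condLevel_eq] at this
    rw [Function.comp_apply, ← sub_div, ← mul_div_assoc, div_le_iff₀ hh, mul_comm _ (_ / _)]
    exact this
  · filter_upwards [t0.eventually_gt_atTop 0, eventually_gt_atTop 0, eventually_gt_atTop γ]
      with L h1 h4 h5
    have hs0 : 0 < √(1 - γ / L) := Real.sqrt_pos.2 (by rw [sub_pos, div_lt_one h4]; exact h5)
    have hh : 0 < Real.exp (-L) / √(1 - γ / L) := by positivity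
    have := sum_normalTail_le hh (s := √(γ / L) * z / √(1 - γ / L)) (N := lineIndex L (3 * √L))
      (n := lineIndex L (v L)) (by rw [← condLevel_eq]; exact h1)
    simp only [← condLevel_eq] at this
    rw [le_div_iff₀ hh, mul_comm]
    exact this

/-- The product lies between `exp (-∑/(1-η))` and `exp (-∑)`, where `η`, the reciprocal of the
lowest conditional level, bounds every tail and tends to `0`. -/
lemma tendsto_prod_one_sub_normalTail (hv : IsLevel v κ) (hv0 : ∀ᶠ L in atTop, 0 ≤ v L)
    (hγ : 0 ≤ γ) (z : ℝ) :
    Tendsto (fun L ↦ ∏ i ∈ Finset.Ioc (lineIndex L (v L)) (lineIndex L (3 * √L)),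
      (1 - normalTail (condLevel γ z L i))) atTop
      (𝓝 (Real.exp (-Real.exp (-(κ + γ - √(2 * γ) * z))))) := by
  obtain ⟨-, hm1⟩ := eventually_lineIndex hv0
  have t1 := (isLevel_condLevel hv hv0 hγ z hm1).tendsto_atTop
    (eventually_condLevel_nonneg (γ := γ) hv hv0 z hm1)
  have hsum := tendsto_sum_normalTail hv hv0 hγ z
  have hη : Tendsto (fun L ↦ 1 - 1 / condLevel γ z L (lineIndex L (v L) + 1)) atTop (𝓝 1) := by
    simpa using ((tendsto_const_nhds (x := (1 : ℝ))).div_atTop t1).const_sub 1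
  have lower := (Real.continuous_exp.tendsto _).comp (hsum.div hη one_ne_zero).neg
  have upper := (Real.continuous_exp.tendsto _).comp hsum.neg
  rw [div_one] at lower
  refine tendsto_of_tendsto_of_tendsto_of_le_of_le' lower upper ?_ ?_
  · filter_upwards [t1.eventually_gt_atTop 1] with L h1
    refine exp_le_prod_one_sub _ (by rw [div_lt_one (by linarith)]; exact h1)
      (fun i _ ↦ normalTail_nonneg _) fun i hi ↦ ?_
    refine (normalTail_antitone (condLevel_mono γ z L (Finset.mem_Ioc.1 hi).1)).trans ?_
    exact normalTail_le_inv (by linarith)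
  · refine Eventually.of_forall fun L ↦ prod_one_sub_le_exp _ fun i _ ↦ ?_
    exact measureReal_le_one

end TailSum

/-! ### The equicorrelated Gaussian family -/

section Equicorrelated

variable {ι : Type*} [Fintype ι]

instance isGaussian_pi_gaussianReal :
    IsGaussian (Measure.pi fun _ : ι ↦ gaussianReal 0 1) := by
  have h := (iIndepFun_pi (μ := fun _ : ι ↦ gaussianReal 0 1) (X := fun _ x ↦ x)
    fun _ ↦ aemeasurable_id).hasGaussianLaw (fun i ↦ by
      have : HasLaw (fun x : ι → ℝ ↦ x i) (gaussianReal 0 1)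
          (Measure.pi fun _ : ι ↦ gaussianReal 0 1) :=
        ⟨(measurable_pi_apply i).aemeasurable,
          (measurePreserving_eval (fun _ : ι ↦ gaussianReal 0 1) i).map_eq⟩
      exact this.hasGaussianLaw)
  simpa using h.isGaussian_map

/-- The pair of an i.i.d. standard normal family and a common standard normal variable. -/
lemma isStdGaussianPair_noise_common :
    IsStdGaussianPair (fun (i : ι) (p : ℝ × (ι → ℝ)) ↦ p.2 i) (fun _ p ↦ p.1)
      ((gaussianReal 0 1).prod (Measure.pi fun _ : ι ↦ gaussianReal 0 1)) := by
  have hf : ∀ i : ι, MeasurePreserving (fun p : ℝ × (ι → ℝ) ↦ p.2 i)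
      ((gaussianReal 0 1).prod (Measure.pi fun _ : ι ↦ gaussianReal 0 1)) (gaussianReal 0 1) :=
    fun i ↦ (measurePreserving_eval (fun _ : ι ↦ gaussianReal 0 1) i).comp measurePreserving_snd
  have hs : MeasurePreserving (fun p : ℝ × (ι → ℝ) ↦ p.1)
      ((gaussianReal 0 1).prod (Measure.pi fun _ : ι ↦ gaussianReal 0 1)) (gaussianReal 0 1) :=
    measurePreserving_fst
  have hmean : ∀ {f : ℝ × (ι → ℝ) → ℝ}, MeasurePreserving f
      ((gaussianReal 0 1).prod (Measure.pi fun _ : ι ↦ gaussianReal 0 1)) (gaussianReal 0 1) →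
      ∫ p, f p ∂((gaussianReal 0 1).prod (Measure.pi fun _ : ι ↦ gaussianReal 0 1)) = 0 ∧
      Var[f; (gaussianReal 0 1).prod (Measure.pi fun _ : ι ↦ gaussianReal 0 1)] = 1 :=
    fun {f} hf ↦ by
      have hl : HasLaw f (gaussianReal 0 1)
        ((gaussianReal 0 1).prod (Measure.pi fun _ : ι ↦ gaussianReal 0 1)) :=
        ⟨hf.measurable.aemeasurable, hf.map_eq⟩
      exact ⟨by rw [hl.integral_eq, integral_id_gaussianReal],
        by rw [hl.variance_eq, variance_id_gaussianReal]; simp⟩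
  refine
    { gaussian := ?_
      meas_left := fun i ↦ (hf i).measurable
      meas_right := fun _ ↦ hs.measurable
      mean_left := fun i ↦ (hmean (hf i)).1
      mean_right := fun _ ↦ (hmean hs).1
      var_left := fun i ↦ (hmean (hf i)).2
      var_right := fun _ ↦ (hmean hs).2
      uncorrelated := fun i j ↦ ?_ }
  · let T : ℝ × (ι → ℝ) →L[ℝ] (ι → ℝ) × (ι → ℝ) :=
      ContinuousLinearMap.prod (ContinuousLinearMap.snd ℝ ℝ (ι → ℝ))
        (ContinuousLinearMap.pi fun _ ↦ ContinuousLinearMap.fst ℝ ℝ (ι → ℝ))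
    exact (IsGaussian.hasGaussianLaw_id
      (μ := (gaussianReal 0 1).prod (Measure.pi fun _ : ι ↦ gaussianReal 0 1))).map_fun T
  · rw [covariance_comm]
    exact covariance_fst_snd_prod (X := fun x ↦ x) (Y := fun x : ι → ℝ ↦ x i)
      (memLp_id_gaussianReal 2)
      ((IsGaussian.hasGaussianLaw_id (μ := Measure.pi fun _ : ι ↦ gaussianReal 0 1)).eval i).memLp_two

/-- The law of `(√(1 - ρ) ξ_i + √ρ Z)_i` with independent standard normal `Z` and `ξ_i`. -/
noncomputable def equicorrelated (ι : Type*) [Fintype ι] (ρ : ℝ) : Measure (ι → ℝ) :=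
  ((gaussianReal 0 1).prod (Measure.pi fun _ : ι ↦ gaussianReal 0 1)).map
    fun p i ↦ √(1 - ρ) * p.2 i + √ρ * p.1

instance isGaussian_equicorrelated (ρ : ℝ) : IsGaussian (equicorrelated ι ρ) := by
  let T : ℝ × (ι → ℝ) →L[ℝ] ι → ℝ :=
    √(1 - ρ) • ContinuousLinearMap.snd ℝ ℝ (ι → ℝ) +
      √ρ • ContinuousLinearMap.pi fun _ ↦ ContinuousLinearMap.fst ℝ ℝ (ι → ℝ)
  exact isGaussian_map (μ := (gaussianReal 0 1).prod (Measure.pi fun _ : ι ↦ gaussianReal 0 1)) T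

lemma measurable_noise_common {ι : Type*} (ρ : ℝ) :
    Measurable fun (p : ℝ × (ι → ℝ)) (i : ι) ↦ √(1 - ρ) * p.2 i + √ρ * p.1 := by
  refine measurable_pi_iff.2 fun i ↦ ?_
  have : Measurable fun p : ℝ × (ι → ℝ) ↦ p.2 i := (measurable_pi_apply i).comp measurable_snd
  fun_prop

lemma integral_equicorrelated (ρ : ℝ) (i : ι) : ∫ x, x i ∂(equicorrelated ι ρ) = 0 := by
  rw [equicorrelated, integral_map (measurable_noise_common ρ).aemeasurable
    (measurable_pi_apply i).aestronglyMeasurable]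
  exact isStdGaussianPair_noise_common.integral_linearComb _ _ i

lemma covariance_equicorrelated_eq (ρ : ℝ) (i j : ι) :
    cov[fun x ↦ x i, fun x ↦ x j; equicorrelated ι ρ] =
      √(1 - ρ) * √(1 - ρ) * cov[fun p : ℝ × (ι → ℝ) ↦ p.2 i, fun p ↦ p.2 j;
        (gaussianReal 0 1).prod (Measure.pi fun _ : ι ↦ gaussianReal 0 1)] + √ρ * √ρ := by
  rw [equicorrelated, covariance_map_fun (measurable_pi_apply i).aestronglyMeasurable
    (measurable_pi_apply j).aestronglyMeasurable (measurable_noise_common ρ).aemeasurable,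
    isStdGaussianPair_noise_common.covariance_linearComb (√(1 - ρ)) (√ρ) (√(1 - ρ)) (√ρ) i j,
    covariance_self (by fun_prop), isStdGaussianPair_noise_common.var_right i, mul_one]

lemma covariance_equicorrelated {ρ : ℝ} (hρ : 0 ≤ ρ) {i j : ι} (hij : i ≠ j) :
    cov[fun x ↦ x i, fun x ↦ x j; equicorrelated ι ρ] = ρ := by
  have h0 : cov[fun p : ℝ × (ι → ℝ) ↦ p.2 i, fun p ↦ p.2 j;
      (gaussianReal 0 1).prod (Measure.pi fun _ : ι ↦ gaussianReal 0 1)] = 0 := by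
    have hind := (iIndepFun_pi (μ := fun _ : ι ↦ gaussianReal 0 1) (X := fun _ x ↦ x)
      fun _ ↦ aemeasurable_id).indepFun hij
    have hm := IsGaussian.hasGaussianLaw_id (μ := Measure.pi fun _ : ι ↦ gaussianReal 0 1)
    have := hind.covariance_eq_zero (hm.eval i).memLp_two (hm.eval j).memLp_two
    refine Eq.trans ?_ this
    have hs : ((gaussianReal 0 1).prod (Measure.pi fun _ : ι ↦ gaussianReal 0 1)).map Prod.snd
      = Measure.pi fun _ : ι ↦ gaussianReal 0 1 := measurePreserving_snd.map_eq
    conv_rhs => rw [← hs]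
    rw [covariance_map_fun (measurable_pi_apply i).aestronglyMeasurable
      (measurable_pi_apply j).aestronglyMeasurable (by fun_prop)]
  rw [covariance_equicorrelated_eq, h0, Real.mul_self_sqrt hρ]
  ring

lemma variance_equicorrelated {ρ : ℝ} (hρ : 0 ≤ ρ) (hρ1 : ρ ≤ 1) (i : ι) :
    Var[fun x ↦ x i; equicorrelated ι ρ] = 1 := by
  rw [← covariance_self (measurable_pi_apply i).aemeasurable, covariance_equicorrelated_eq,
    covariance_self (isStdGaussianPair_noise_common.meas_left i).aemeasurable,
    isStdGaussianPair_noise_common.var_left i, Real.mul_self_sqrt hρ,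
    Real.mul_self_sqrt (by linarith)]
  ring

lemma measureReal_Iic_gaussianReal (t : ℝ) :
    (gaussianReal 0 1).real (Set.Iic t) = 1 - normalTail t := by
  rw [normalTail, ← Set.compl_Iic, probReal_compl_eq_one_sub measurableSet_Iic]
  ring

/-- Fubini: for a fixed common value `z` the event is a box for the independent noise. -/
lemma measureReal_Iic_equicorrelated {ρ : ℝ} (hρ1 : ρ < 1) (u : ι → ℝ) :
    (equicorrelated ι ρ).real (Set.Iic u)
      = ∫ z, ∏ i, (1 - normalTail ((u i - √ρ * z) / √(1 - ρ))) ∂(gaussianReal 0 1) := by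
  have hs : 0 < √(1 - ρ) := Real.sqrt_pos.2 (by linarith)
  have hmeas : MeasurableSet ((fun (p : ℝ × (ι → ℝ)) (i : ι) ↦ √(1 - ρ) * p.2 i + √ρ * p.1) ⁻¹'
    Set.Iic u) := measurable_noise_common ρ measurableSet_Iic
  rw [equicorrelated, measureReal_def, Measure.map_apply (measurable_noise_common ρ)
    measurableSet_Iic, Measure.prod_apply hmeas, ← integral_toReal
    (measurable_measure_prodMk_left hmeas).aemeasurable
    (ae_of_all _ fun z ↦ measure_lt_top _ _)]
  refine integral_congr_ae (ae_of_all _ fun z ↦ ?_)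
  have : Prod.mk z ⁻¹' ((fun (p : ℝ × (ι → ℝ)) (i : ι) ↦ √(1 - ρ) * p.2 i + √ρ * p.1) ⁻¹'
      Set.Iic u) = Set.pi Set.univ fun i ↦ Set.Iic ((u i - √ρ * z) / √(1 - ρ)) := by
    ext ξ
    simp only [Set.mem_preimage, Set.mem_Iic, Pi.le_def, Set.mem_pi, Set.mem_univ, true_imp_iff]
    refine forall_congr' fun i ↦ ?_
    rw [le_div_iff₀ hs, le_sub_iff_add_le, mul_comm]
  simp only [this, Measure.pi_pi, ENNReal.toReal_prod]
  exact Finset.prod_congr rfl fun i _ ↦ measureReal_Iic_gaussianReal _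

end Equicorrelated

/-! ### The finite index set and the equicorrelated limit -/

/-- The indices `i ∈ ℤ` at which the line of slope `β = exp (-L)` lies between the level `s` (on the
negative half-axis) or `t` (on the positive half-axis) and the cutoff `3 √L`. -/
noncomputable def crossSet (L s t : ℝ) : Finset ℤ :=
  (Finset.Ioc (lineIndex L s) (lineIndex L (3 * √L))).image (fun n : ℕ ↦ -(n : ℤ)) ∪
    (Finset.Ioc (lineIndex L t) (lineIndex L (3 * √L))).image fun n : ℕ ↦ (n : ℤ)

lemma disjoint_crossSet (L s t : ℝ) :
    Disjoint ((Finset.Ioc (lineIndex L s) (lineIndex L (3 * √L))).image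
      fun n : ℕ ↦ -(n : ℤ))
    ((Finset.Ioc (lineIndex L t) (lineIndex L (3 * √L))).image
      fun n : ℕ ↦ (n : ℤ)) := by
  rw [Finset.disjoint_left]
  intro i hi hi'
  simp only [Finset.mem_image, Finset.mem_Ioc] at hi hi'
  obtain ⟨a, ha, rfl⟩ := hi
  obtain ⟨b, hb, hab⟩ := hi'
  omega

lemma prod_crossSet (L s t : ℝ) (f : ℕ → ℝ) :
    ∏ i ∈ crossSet L s t, f i.natAbs
      = (∏ i ∈ Finset.Ioc (lineIndex L s) (lineIndex L (3 * √L)), f i) *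
        ∏ i ∈ Finset.Ioc (lineIndex L t) (lineIndex L (3 * √L)), f i := by
  rw [crossSet, Finset.prod_union (disjoint_crossSet L s t), Finset.prod_image (fun a _ b _ h ↦ by simpa using h),
    Finset.prod_image (fun a _ b _ h ↦ by simpa using h)]
  simp

lemma sum_crossSet (L s t : ℝ) (f : ℕ → ℝ) :
    ∑ i ∈ crossSet L s t, f i.natAbs
      = (∑ i ∈ Finset.Ioc (lineIndex L s) (lineIndex L (3 * √L)), f i) +
        ∑ i ∈ Finset.Ioc (lineIndex L t) (lineIndex L (3 * √L)), f i := by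
  rw [crossSet, Finset.sum_union (disjoint_crossSet L s t), Finset.sum_image (fun a _ b _ h ↦ by simpa using h),
    Finset.sum_image (fun a _ b _ h ↦ by simpa using h)]
  simp

lemma mem_crossSet {L s t : ℝ} (hs : 0 ≤ s) (ht : 0 ≤ t) {i : ℤ} :
    i ∈ crossSet L s t ↔ Real.exp (-L) * i.natAbs ≤ 3 * √L ∧
      ((i < 0 ∧ s < Real.exp (-L) * i.natAbs) ∨ (0 < i ∧ t < Real.exp (-L) * i.natAbs)) := by
  have h3 : 0 ≤ 3 * √L := by positivity
  simp only [crossSet, Finset.mem_union, Finset.mem_image, mem_Ioc_lineIndex hs h3,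
    mem_Ioc_lineIndex ht h3]
  have key : ∀ {a : ℝ} {n : ℕ}, 0 ≤ a → a < Real.exp (-L) * n → n ≠ 0 := by
    rintro a n ha h rfl
    simp at h
    linarith
  constructor
  · rintro (⟨n, ⟨h1, h2⟩, rfl⟩ | ⟨n, ⟨h1, h2⟩, rfl⟩)
    · have := key hs h1
      rw [Int.natAbs_neg, Int.natAbs_natCast]
      exact ⟨h2, Or.inl ⟨by omega, h1⟩⟩
    · have := key ht h1
      rw [Int.natAbs_natCast]
      exact ⟨h2, Or.inr ⟨by omega, h1⟩⟩
  · rintro ⟨h1, ⟨h2, h3⟩ | ⟨h2, h3⟩⟩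
    · exact Or.inl ⟨i.natAbs, ⟨h3, h1⟩, by omega⟩
    · exact Or.inr ⟨i.natAbs, ⟨h3, h1⟩, by omega⟩

lemma measurable_normalTail : Measurable normalTail := normalTail_antitone.measurable

/-- The limit law for the equicorrelated Gaussian family. -/
lemma tendsto_measureReal_equicorrelated {v₁ v₂ : ℝ → ℝ} {κ₁ κ₂ γ : ℝ}
    (h₁ : IsLevel v₁ κ₁) (h₁' : ∀ᶠ L in atTop, 0 ≤ v₁ L)
    (h₂ : IsLevel v₂ κ₂) (h₂' : ∀ᶠ L in atTop, 0 ≤ v₂ L) (hγ : 0 ≤ γ) :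
    Tendsto (fun L ↦ (equicorrelated (crossSet L (v₁ L) (v₂ L)) (γ / L)).real
        (Set.Iic fun i ↦ Real.exp (-L) * (i : ℤ).natAbs)) atTop
      (𝓝 (∫ z, Real.exp (-(Real.exp (-(κ₁ + γ - √(2 * γ) * z)) +
        Real.exp (-(κ₂ + γ - √(2 * γ) * z)))) ∂(gaussianReal 0 1))) := by
  have key : Tendsto (fun L ↦ ∫ z, (∏ i ∈ Finset.Ioc (lineIndex L (v₁ L)) (lineIndex L (3 * √L)),
      (1 - normalTail (condLevel γ z L i))) *
      ∏ i ∈ Finset.Ioc (lineIndex L (v₂ L)) (lineIndex L (3 * √L)),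
      (1 - normalTail (condLevel γ z L i)) ∂(gaussianReal 0 1)) atTop
      (𝓝 (∫ z, Real.exp (-(Real.exp (-(κ₁ + γ - √(2 * γ) * z)) +
        Real.exp (-(κ₂ + γ - √(2 * γ) * z)))) ∂(gaussianReal 0 1))) := by
    have hle : ∀ (s : Finset ℕ) (z L : ℝ),
        |∏ i ∈ s, (1 - normalTail (condLevel γ z L i))| ≤ 1 := fun s z L ↦ by
      rw [Finset.abs_prod]
      refine Finset.prod_le_one (fun _ _ ↦ abs_nonneg _) fun i _ ↦ ?_
      rw [abs_le]
      have h0 := normalTail_nonneg (condLevel γ z L i)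
      have h1 : normalTail (condLevel γ z L i) ≤ 1 := measureReal_le_one
      constructor <;> linarith
    refine tendsto_integral_filter_of_dominated_convergence (fun _ ↦ 1)
      (Eventually.of_forall fun L ↦ ?_) (Eventually.of_forall fun L ↦ ae_of_all _ fun z ↦ ?_)
      (integrable_const _) (ae_of_all _ fun z ↦ ?_)
    · have := measurable_normalTail
      refine Measurable.aestronglyMeasurable ?_
      unfold condLevel
      fun_prop
    · rw [Real.norm_eq_abs, abs_mul]
      exact mul_le_one₀ (hle _ _ _) (abs_nonneg _) (hle _ _ _)
    · rw [neg_add, Real.exp_add]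
      exact (tendsto_prod_one_sub_normalTail h₁ h₁' hγ z).mul
        (tendsto_prod_one_sub_normalTail h₂ h₂' hγ z)
  refine key.congr' ?_
  filter_upwards [eventually_gt_atTop 0, eventually_gt_atTop γ] with L hL hLγ
  rw [measureReal_Iic_equicorrelated (by rw [div_lt_one hL]; exact hLγ)]
  refine integral_congr_ae (ae_of_all _ fun z ↦ ?_)
  simp only
  rw [← prod_crossSet L (v₁ L) (v₂ L) fun i ↦ 1 - normalTail (condLevel γ z L i),
    ← Finset.prod_coe_sort]
  rfl

/-! ### Splitting the comparison sum by lag -/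

/-- The summand of the normal comparison inequality for correlations `a` and `b` and levels `s`
and `t`. -/
noncomputable def compTerm (a b s t : ℝ) : ℝ :=
  |a - b| * ((√(1 - max |a| |b| ^ 2))⁻¹ *
    Real.exp (-(s ^ 2 + t ^ 2) / (2 * (1 + max |a| |b|))))

/-- For short lags the correlation is only known to be at most `δ`. The exponent `2/(1+δ) > 1` on
`E` is the gain that will beat the number of pairs. -/
lemma compTerm_le_of_le {a b s t δ E : ℝ} (ha : |a| ≤ δ) (hb : |b| ≤ δ) (hδ : δ < 1)
    (hs : Real.exp (-s ^ 2 / 2) ≤ E) (ht : Real.exp (-t ^ 2 / 2) ≤ E) :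
    compTerm a b s t ≤ 2 * (√(1 - δ ^ 2))⁻¹ * (E ^ 2) ^ (1 / (1 + δ)) := by
  have hδ0 : 0 ≤ δ := (abs_nonneg a).trans ha
  have hw : max |a| |b| ≤ δ := max_le ha hb
  have hw0 : 0 ≤ max |a| |b| := (abs_nonneg a).trans (le_max_left _ _)
  have h1 : |a - b| ≤ 2 := (abs_sub _ _).trans (by linarith)
  have h2 : (√(1 - max |a| |b| ^ 2))⁻¹ ≤ (√(1 - δ ^ 2))⁻¹ := by
    have : 0 < 1 - δ ^ 2 := by nlinarith
    gcongr
  have h3 : Real.exp (-(s ^ 2 + t ^ 2) / (2 * (1 + max |a| |b|)))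
      ≤ (E ^ 2) ^ (1 / (1 + δ)) := by
    calc _ ≤ Real.exp (-(s ^ 2 + t ^ 2) / (2 * (1 + δ))) := by
          rw [neg_div, neg_div]
          gcongr
      _ = (Real.exp (-s ^ 2 / 2) * Real.exp (-t ^ 2 / 2)) ^ (1 / (1 + δ)) := by
          rw [← Real.exp_add, ← Real.exp_mul]
          congr 1
          field_simp
          ring
      _ ≤ _ := by
          have := mul_le_mul hs ht (Real.exp_nonneg _) ((Real.exp_nonneg _).trans hs)
          exact Real.rpow_le_rpow (by positivity) (this.trans_eq (sq E).symm) (by positivity)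
  rw [compTerm, mul_assoc]
  gcongr

/-- When correlations are at most `w`, the exponent is the independent one up to `Q w`, so the two
Gaussian weights factor. With `Q = 9L` (the cutoff) and `w` of order `1/L` the price stays bounded.
-/
lemma compTerm_le_mul {a b s t δ w Q : ℝ} (ha : |a| ≤ δ) (hb : |b| ≤ δ) (hδ : δ < 1)
    (haw : |a| ≤ w) (hbw : |b| ≤ w) (hs : s ^ 2 ≤ Q) (ht : t ^ 2 ≤ Q) :
    compTerm a b s t ≤ |a - b| * ((√(1 - δ ^ 2))⁻¹ * Real.exp (Q * w)) *
      (Real.exp (-s ^ 2 / 2) * Real.exp (-t ^ 2 / 2)) := by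
  have hδ0 : 0 ≤ δ := (abs_nonneg a).trans ha
  set m := max |a| |b| with hm
  have hw : m ≤ δ := max_le ha hb
  have hmw : m ≤ w := max_le haw hbw
  have hw0 : 0 ≤ m := (abs_nonneg a).trans (le_max_left _ _)
  have h2 : (√(1 - m ^ 2))⁻¹ ≤ (√(1 - δ ^ 2))⁻¹ := by
    have : 0 < 1 - δ ^ 2 := by nlinarith
    gcongr
  have h3 : Real.exp (-(s ^ 2 + t ^ 2) / (2 * (1 + m)))
      ≤ Real.exp (Q * w) * (Real.exp (-s ^ 2 / 2) * Real.exp (-t ^ 2 / 2)) := by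
    rw [← Real.exp_add, ← Real.exp_add]
    refine Real.exp_le_exp.2 ?_
    have hx : 0 ≤ s ^ 2 + t ^ 2 := by positivity
    have e : -(s ^ 2 + t ^ 2) / (2 * (1 + m))
        = -(s ^ 2 + t ^ 2) / 2 + (s ^ 2 + t ^ 2) / 2 * (m / (1 + m)) := by
      field_simp
      ring
    have h4 : m / (1 + m) ≤ w := (div_le_self hw0 (by linarith)).trans hmw
    have h5 : (s ^ 2 + t ^ 2) / 2 * (m / (1 + m)) ≤ Q * w := by
      refine mul_le_mul (by linarith) h4 (by positivity) ((sq_nonneg s).trans hs)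
    rw [e]
    linarith
  rw [compTerm, ← hm]
  calc _ ≤ |a - b| * ((√(1 - δ ^ 2))⁻¹ *
        (Real.exp (Q * w) * (Real.exp (-s ^ 2 / 2) * Real.exp (-t ^ 2 / 2)))) := by gcongr
    _ = _ := by ring

lemma sum_sum_ite_natAbs_sub_le (S : Finset ℤ) {m : ℝ} (hm : 0 ≤ m) {f : ℤ → ℝ}
    (hf : ∀ i ∈ S, 0 ≤ f i) :
    ∑ i ∈ S, ∑ j ∈ S.erase i, (if ((i - j).natAbs : ℝ) ≤ m then f i else 0)
      ≤ (2 * m + 1) * ∑ i ∈ S, f i := by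
  rw [Finset.mul_sum]
  refine Finset.sum_le_sum fun i hi ↦ ?_
  rw [← Finset.sum_filter, Finset.sum_const, nsmul_eq_mul]
  refine mul_le_mul_of_nonneg_right ?_ (hf i hi)
  have hsub : (S.erase i).filter (fun j ↦ ((i - j).natAbs : ℝ) ≤ m)
      ⊆ Finset.Icc (i - ⌊m⌋₊) (i + ⌊m⌋₊) := fun j hj ↦ by
    have h1 := (Finset.mem_filter.1 hj).2
    have h2 : (i - j).natAbs ≤ ⌊m⌋₊ := Nat.le_floor h1
    rw [Finset.mem_Icc]
    omega
  have h1 := Finset.card_le_card hsub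
  rw [Int.card_Icc] at h1
  have h2 : ((S.erase i).filter (fun j ↦ ((i - j).natAbs : ℝ) ≤ m)).card ≤ 2 * ⌊m⌋₊ + 1 := by
    omega
  have h3 : (⌊m⌋₊ : ℝ) ≤ m := Nat.floor_le hm
  calc _ ≤ ((2 * ⌊m⌋₊ + 1 : ℕ) : ℝ) := by exact_mod_cast h2
    _ ≤ _ := by push_cast; linarith

/-- A bound of the sum in the normal comparison inequality, by short lags (at most `m₁`),
intermediate lags (at most `m₂`) and long lags. -/
lemma sum_compTerm_le (S : Finset ℤ) {c : ℤ → ℝ} {r : ℕ → ℝ} {ρ δ E Q m₁ m₂ w η : ℝ}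
    (hδ : δ < 1) (hr : ∀ n, 1 ≤ n → |r n| ≤ δ) (hρ : |ρ| ≤ δ)
    (hE : ∀ i ∈ S, Real.exp (-c i ^ 2 / 2) ≤ E) (hE0 : 0 ≤ E) (hQ : ∀ i ∈ S, c i ^ 2 ≤ Q)
    (hm₁ : 0 ≤ m₁) (hm₂ : 0 ≤ m₂) (hw : ∀ n : ℕ, m₁ < n → |r n| ≤ w) (hρw : |ρ| ≤ w) (hη0 : 0 ≤ η)
    (hη : ∀ i ∈ S, ∀ j ∈ S, m₂ < (i - j).natAbs → |r (i - j).natAbs - ρ| ≤ η) :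
    ∑ i ∈ S, ∑ j ∈ S.erase i, compTerm (r (i - j).natAbs) ρ (c i) (c j)
      ≤ 2 * (√(1 - δ ^ 2))⁻¹ * (E ^ 2) ^ (1 / (1 + δ)) * ((2 * m₁ + 1) * S.card) +
        2 * w * ((√(1 - δ ^ 2))⁻¹ * Real.exp (Q * w)) * E *
          ((2 * m₂ + 1) * ∑ i ∈ S, Real.exp (-c i ^ 2 / 2)) +
        η * ((√(1 - δ ^ 2))⁻¹ * Real.exp (Q * w)) * (∑ i ∈ S, Real.exp (-c i ^ 2 / 2)) ^ 2 := by
  have hw0 : 0 ≤ w := (abs_nonneg ρ).trans hρw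
  set K := (√(1 - δ ^ 2))⁻¹ with hK
  have hK0 : 0 ≤ K := by positivity
  set T₁ := 2 * K * (E ^ 2) ^ (1 / (1 + δ)) with hT₁
  have hT₁0 : 0 ≤ T₁ := by positivity
  set M := K * Real.exp (Q * w) with hM
  have hM0 : 0 ≤ M := by positivity
  -- One summand per lag regime: counting for short lags, one weight bounded by `E` for intermediate
  -- ones, both weights kept for long ones. All summands are nonnegative, so each regime may discard
  -- the others.
  have key : ∀ i ∈ S, ∀ j ∈ S.erase i, compTerm (r (i - j).natAbs) ρ (c i) (c j)
      ≤ T₁ * (if ((i - j).natAbs : ℝ) ≤ m₁ then 1 else 0) +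
        2 * w * M * E * (if ((i - j).natAbs : ℝ) ≤ m₂ then Real.exp (-c i ^ 2 / 2) else 0) +
        η * M * (Real.exp (-c i ^ 2 / 2) * Real.exp (-c j ^ 2 / 2)) := fun i hi j hj ↦ by
    obtain ⟨hji, hjS⟩ := Finset.mem_erase.1 hj
    have hn : 1 ≤ (i - j).natAbs := by omega
    have p2 : 0 ≤ 2 * w * M * E * (if ((i - j).natAbs : ℝ) ≤ m₂ then Real.exp (-c i ^ 2 / 2)
        else 0) := by
      refine mul_nonneg (by positivity) ?_
      split_ifs <;> positivity
    have p3 : 0 ≤ η * M * (Real.exp (-c i ^ 2 / 2) * Real.exp (-c j ^ 2 / 2)) := by positivity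
    by_cases h1 : ((i - j).natAbs : ℝ) ≤ m₁
    · have := compTerm_le_of_le (hr _ hn) hρ hδ (hE i hi) (hE j hjS)
      rw [if_pos h1, mul_one]
      linarith
    have hrw := hw _ (not_le.1 h1)
    have hle := compTerm_le_mul (hr _ hn) hρ hδ hrw hρw (hQ i hi) (hQ j hjS)
    rw [if_neg h1, mul_zero, zero_add]
    by_cases h2 : ((i - j).natAbs : ℝ) ≤ m₂
    · rw [if_pos h2]
      have h3 : |r (i - j).natAbs - ρ| ≤ 2 * w := (abs_sub _ _).trans (by linarith)
      have h4 := hE j hjS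
      calc _ ≤ _ := hle
        _ ≤ 2 * w * M * (Real.exp (-c i ^ 2 / 2) * E) := by gcongr
        _ = 2 * w * M * E * Real.exp (-c i ^ 2 / 2) := by ring
        _ ≤ _ := by linarith
    · rw [if_neg h2, mul_zero, zero_add]
      refine hle.trans ?_
      have := hη i hi j hjS (not_le.1 h2)
      gcongr
  refine (Finset.sum_le_sum fun i hi ↦ Finset.sum_le_sum (key i hi)).trans ?_
  simp_rw [Finset.sum_add_distrib, ← Finset.mul_sum]
  gcongr ?_ + ?_ + ?_
  · have := sum_sum_ite_natAbs_sub_le S hm₁ (f := fun _ ↦ 1) fun _ _ ↦ zero_le_one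
    simp only [Finset.sum_const, nsmul_eq_mul, mul_one] at this
    gcongr
  · have := sum_sum_ite_natAbs_sub_le S hm₂ (f := fun i ↦ Real.exp (-c i ^ 2 / 2))
      fun _ _ ↦ (Real.exp_nonneg _)
    gcongr
  · rw [sq, Finset.sum_mul_sum]
    simp_rw [Finset.mul_sum]
    gcongr
    exact Finset.erase_subset _ _

/-! ### Vanishing of the comparison sum -/

section Asymptotics

variable {r : ℕ → ℝ} {γ : ℝ}

/-- Such lags have `log n > εL`, and `|r_n log n|` is eventually below `γ + 1`. -/
lemma eventually_abs_le_div (hr : Tendsto (fun n : ℕ ↦ r n * Real.log n) atTop (𝓝 γ)) (hγ : 0 ≤ γ)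
    {ε : ℝ} (hε : 0 < ε) :
    ∀ᶠ L : ℝ in atTop, ∀ n : ℕ, Real.exp (ε * L) < n → |r n| ≤ (γ + 1) / ε / L := by
  have h1 : ∀ᶠ n : ℕ in atTop, |r n * Real.log n| < γ + 1 := by
    have := hr.abs
    rw [abs_of_nonneg hγ] at this
    exact this.eventually_lt_const (by linarith)
  obtain ⟨N, hN⟩ := eventually_atTop.1 h1
  have h2 : Tendsto (fun L : ℝ ↦ Real.exp (ε * L)) atTop atTop :=
    Real.tendsto_exp_atTop.comp (tendsto_id.const_mul_atTop hε)
  filter_upwards [h2.eventually_ge_atTop (N : ℝ), eventually_gt_atTop 0] with L hL hL0 n hn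
  have hn' : N ≤ n := by exact_mod_cast hL.trans hn.le
  have hlog : ε * L < Real.log n := by
    rw [Real.lt_log_iff_exp_lt ((Real.exp_pos _).trans hn)]
    exact hn
  have hεL : 0 < ε * L := by positivity
  have h3 := hN n hn'
  rw [abs_mul, abs_of_pos (hεL.trans hlog)] at h3
  rw [div_div, le_div_iff₀ hεL]
  calc _ ≤ |r n| * Real.log n := by gcongr
    _ ≤ _ := h3.le

/-- In this window `log n = L + O(log L)`, so `γ / log n` and `γ/L` differ by `o(1/L)`. -/
lemma eventually_abs_sub_le_div (hr : Tendsto (fun n : ℕ ↦ r n * Real.log n) atTop (𝓝 γ))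
    (hγ : 0 ≤ γ) {η : ℝ} (hη : 0 < η) :
    ∀ᶠ L : ℝ in atTop, ∀ n : ℕ, Real.exp L / L ^ 3 < n → (n : ℝ) ≤ 6 * L * Real.exp L →
      |r n - γ / L| ≤ η / L := by
  have h1 : ∀ᶠ n : ℕ in atTop, |r n * Real.log n - γ| < η / 4 := by
    have := (hr.sub_const γ).abs
    rw [sub_self, abs_zero] at this
    exact this.eventually_lt_const (by linarith)
  obtain ⟨N, hN⟩ := eventually_atTop.1 h1
  have h2 : Tendsto (fun L : ℝ ↦ Real.exp L / L ^ 3) atTop atTop :=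
    Real.tendsto_exp_div_pow_atTop 3
  have hlog : Tendsto (fun L : ℝ ↦ (3 * Real.log L + Real.log 6) / L) atTop (𝓝 0) := by
    have h1 : Tendsto (fun x : ℝ ↦ Real.log x / x) atTop (𝓝 0) := by
      simpa using Real.isLittleO_log_id_atTop.tendsto_div_nhds_zero
    have := (h1.const_mul 3).add (tendsto_div_id_atTop (Real.log 6))
    rw [mul_zero, zero_add] at this
    refine this.congr fun L ↦ ?_
    ring
  -- The bound `1/2` gives `log n ≥ L/2`; the other makes replacing `log n` by `L` cost at most
  -- `η/4`.
  set θ := min (1 / 2) (η / (4 * (γ + 1))) with hθ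
  have hθ0 : 0 < θ := lt_min (by norm_num) (by positivity)
  have hθη : γ * θ ≤ η / 4 := by
    have : θ ≤ η / (4 * (γ + 1)) := min_le_right _ _
    rw [le_div_iff₀ (by positivity)] at this
    nlinarith
  filter_upwards [h2.eventually_ge_atTop (N : ℝ), eventually_ge_atTop 1,
    hlog.eventually_lt_const hθ0] with L hL hL1 hL2 n hn hn2
  have hL0 : 0 < L := by linarith
  have hn' : N ≤ n := by exact_mod_cast hL.trans hn.le
  have hn0 : 0 < (n : ℝ) := lt_of_le_of_lt (by positivity) hn
  have hlo : L - 3 * Real.log L ≤ Real.log n := by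
    have := Real.log_le_log (by positivity) hn.le
    rw [Real.log_div (by positivity) (by positivity), Real.log_exp, Real.log_pow] at this
    push_cast at this
    exact this
  have hhi : Real.log n ≤ L + (3 * Real.log L + Real.log 6) := by
    have := Real.log_le_log hn0 hn2
    rw [Real.log_mul (by positivity) (by positivity), Real.log_mul (by positivity) (by positivity),
      Real.log_exp] at this
    linarith [Real.log_nonneg hL1]
  rw [div_lt_iff₀ hL0] at hL2
  have h6 : 0 ≤ Real.log 6 := Real.log_nonneg (by norm_num)
  have hdiff : |L - Real.log n| ≤ θ * L := by
    rw [abs_le]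
    constructor <;> linarith
  have hhalf : L / 2 ≤ Real.log n := by
    have : θ ≤ 1 / 2 := min_le_left _ _
    nlinarith [abs_le.1 hdiff]
  have hlogpos : 0 < Real.log n := by linarith
  have h3 := (hN n hn').le
  have e : r n - γ / L = ((r n * Real.log n - γ) * L + γ * (L - Real.log n)) / (Real.log n * L) := by
    field_simp
    ring
  rw [e, abs_div, abs_of_pos (by positivity : 0 < Real.log n * L), div_le_div_iff₀ (by positivity) hL0]
  have h4 : |(r n * Real.log n - γ) * L + γ * (L - Real.log n)| ≤ η / 2 * L := by
    refine (abs_add_le _ _).trans ?_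
    rw [abs_mul, abs_mul, abs_of_pos hL0, abs_of_nonneg hγ]
    have := mul_le_mul_of_nonneg_left hdiff hγ
    have := mul_le_mul_of_nonneg_right h3 hL0.le
    have := mul_le_mul_of_nonneg_right hθη hL0.le
    linarith
  calc _ ≤ η / 2 * L * L := by gcongr
    _ = η * (L / 2 * L) := by ring
    _ ≤ _ := by gcongr

variable {v : ℝ → ℝ} {κ : ℝ}

lemma IsLevel.exists_exp_le (hv : IsLevel v κ) :
    ∃ C, 1 ≤ C ∧ ∀ᶠ L in atTop, Real.exp (-v L ^ 2 / 2) ≤ C * L * Real.exp (-L) := by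
  refine ⟨max 1 (Real.exp (-(κ - 1)) * 2 * √(2 * Real.pi)), le_max_left _ _, ?_⟩
  filter_upwards [hv.eventually_const_lt (show κ - 1 < κ by linarith), eventually_gt_atTop 0]
    with L h1 hL
  have e1 : Real.exp (Real.log (2 * L)) = 2 * L := Real.exp_log (by linarith)
  have e2 : Real.exp (Real.log (2 * Real.pi) / 2) = √(2 * Real.pi) := by
    rw [← Real.log_sqrt (by positivity), Real.exp_log (Real.sqrt_pos.2 (by positivity))]
  calc Real.exp (-v L ^ 2 / 2) ≤ Real.exp (-(κ - 1) + (Real.log (2 * L) +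
        (Real.log (2 * Real.pi) / 2 + -L))) := Real.exp_le_exp.2 (by linarith)
    _ = Real.exp (-(κ - 1)) * 2 * √(2 * Real.pi) * L * Real.exp (-L) := by
        rw [Real.exp_add, Real.exp_add, Real.exp_add, e1, e2]
        ring
    _ ≤ _ := by
        gcongr
        exact le_max_right _ _

/-- The lower Mills bound gives `exp (-c²/2) ≤ 2√(2π) c Ψ(c)`, where `c ≤ 3√L`, and the tail sum
converges (case `γ = 0`). Hence the order `√L`. -/
lemma IsLevel.exists_sum_exp_le (hv : IsLevel v κ) (hv0 : ∀ᶠ L in atTop, 0 ≤ v L) :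
    ∃ C, 0 ≤ C ∧ ∀ᶠ L in atTop,
      ∑ i ∈ Finset.Ioc (lineIndex L (v L)) (lineIndex L (3 * √L)),
        Real.exp (-(Real.exp (-L) * i) ^ 2 / 2) ≤ C * √L := by
  have hsum := tendsto_sum_normalTail hv hv0 le_rfl 0
  refine ⟨6 * √(2 * Real.pi) * (Real.exp (-(κ + 0 - √(2 * 0) * 0)) + 1), by positivity, ?_⟩
  filter_upwards [hsum.eventually_lt_const (lt_add_one _), hv0, eventually_gt_atTop 0,
    (hv.tendsto_atTop hv0).eventually_ge_atTop 2] with L h1 h2 h3 h4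
  have hterm : ∀ i ∈ Finset.Ioc (lineIndex L (v L)) (lineIndex L (3 * √L)),
      Real.exp (-(Real.exp (-L) * i) ^ 2 / 2)
        ≤ 6 * √(2 * Real.pi) * √L * normalTail (condLevel 0 0 L i) := fun i hi ↦ by
    rw [mem_Ioc_lineIndex h2 (by positivity)] at hi
    have e : condLevel 0 0 L i = Real.exp (-L) * i := by simp [condLevel]
    rw [e]
    set c := Real.exp (-L) * i
    have hc : 2 ≤ c := by linarith
    have hc0 : 0 < c := by linarith
    have hmills := le_normalTail hc0
    have h5 : (1 : ℝ) / 2 ≤ 1 - 1 / c ^ 2 := by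
      have : 1 / c ^ 2 ≤ 1 / 2 ^ 2 := by gcongr
      linarith
    have h6 : gaussianPDFReal 0 1 c / (3 * √L) * (1 / 2) ≤ normalTail c := by
      refine le_trans ?_ hmills
      have := gaussianPDFReal_nonneg 0 1 c
      gcongr
      exact hi.2
    rw [gaussianPDFReal_zero_one] at h6
    have hsL : 0 < √L := Real.sqrt_pos.2 h3
    have hsp : 0 < √(2 * Real.pi) := Real.sqrt_pos.2 (by positivity)
    calc Real.exp (-c ^ 2 / 2) = 6 * √(2 * Real.pi) * √L *
          ((√(2 * Real.pi))⁻¹ * Real.exp (-(1 / 2) * c ^ 2) / (3 * √L) * (1 / 2)) := by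
          have : -c ^ 2 / 2 = -(1 / 2) * c ^ 2 := by ring
          rw [this]
          field_simp
          norm_num
      _ ≤ _ := by gcongr
  refine (Finset.sum_le_sum hterm).trans ?_
  rw [← Finset.mul_sum]
  calc _ ≤ 6 * √(2 * Real.pi) * √L * (Real.exp (-(κ + 0 - √(2 * 0) * 0)) + 1) := by gcongr
    _ = _ := by ring

lemma card_crossSet_le {L s t : ℝ} (hL : 1 ≤ L) :
    ((crossSet L s t).card : ℝ) ≤ 6 * L * Real.exp L := by
  have h1 := sum_crossSet L s t fun _ ↦ 1
  simp only [Finset.sum_const, nsmul_eq_mul, mul_one, Nat.card_Ioc] at h1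
  have h2 : (lineIndex L (3 * √L) : ℝ) ≤ 3 * L * Real.exp L := by
    refine (Nat.floor_le (by positivity)).trans ?_
    have : √L ≤ L := Real.sqrt_le_iff.2 ⟨by linarith, by nlinarith⟩
    gcongr
  have h3 : ((lineIndex L (3 * √L) - lineIndex L s : ℕ) : ℝ) ≤ lineIndex L (3 * √L) := by
    exact_mod_cast Nat.sub_le _ _
  have h4 : ((lineIndex L (3 * √L) - lineIndex L t : ℕ) : ℝ) ≤ lineIndex L (3 * √L) := by
    exact_mod_cast Nat.sub_le _ _
  linarith

lemma natAbs_sub_le_of_mem_crossSet {L s t : ℝ} (hL : 1 ≤ L) (hs : 0 ≤ s) (ht : 0 ≤ t) {i j : ℤ}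
    (hi : i ∈ crossSet L s t) (hj : j ∈ crossSet L s t) :
    ((i - j).natAbs : ℝ) ≤ 6 * L * Real.exp L := by
  rw [mem_crossSet hs ht] at hi hj
  have h3 : √L ≤ L := Real.sqrt_le_iff.2 ⟨by linarith, by nlinarith⟩
  have h4 : ∀ n : ℕ, Real.exp (-L) * n ≤ 3 * √L → (n : ℝ) ≤ 3 * L * Real.exp L := fun n hn ↦ by
    rw [Real.exp_neg, ← div_eq_inv_mul, div_le_iff₀ (Real.exp_pos L)] at hn
    refine hn.trans ?_
    gcongr
  have h5 : (i - j).natAbs ≤ i.natAbs + j.natAbs := by omega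
  have h6 : ((i - j).natAbs : ℝ) ≤ i.natAbs + j.natAbs := by exact_mod_cast h5
  linarith [h4 _ hi.1, h4 _ hj.1]

/-- This `ε` makes the exponents add up to `-2/(1+δ) + ε + 1 = -2ε + ε = -ε`: correlation gain,
number of lags, number of indices. -/
lemma short_lag_bound {C K L δ ε N : ℝ} (hδ : 0 < δ) (hC : 1 ≤ C) (hK : 0 ≤ K) (hL : 1 ≤ L)
    (hε : ε = (1 - δ) / (2 * (1 + δ))) (hε0 : 0 < ε)
    (hN0 : 0 ≤ N) (hN : N ≤ 6 * L * Real.exp L) :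
    2 * K * ((C * L * Real.exp (-L)) ^ 2) ^ (1 / (1 + δ)) * ((2 * Real.exp (ε * L) + 1) * N)
      ≤ 36 * K * C ^ 2 * (L ^ 3 * Real.exp (-ε * L)) := by
  have hpow : ((C * L * Real.exp (-L)) ^ 2) ^ (1 / (1 + δ))
      ≤ C ^ 2 * L ^ 2 * Real.exp (-2 * L / (1 + δ)) := by
    have e : (C * L * Real.exp (-L)) ^ 2 = C ^ 2 * L ^ 2 * Real.exp (-2 * L) := by
      rw [mul_pow, mul_pow, ← Real.exp_nat_mul]
      push_cast
      ring_nf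
    have h1 : 1 ≤ C ^ 2 * L ^ 2 := one_le_mul_of_one_le_of_one_le (one_le_pow₀ hC) (one_le_pow₀ hL)
    rw [e, Real.mul_rpow (by positivity) (by positivity), ← Real.exp_mul, mul_one_div]
    refine mul_le_mul_of_nonneg_right ?_ (Real.exp_nonneg _)
    refine (Real.rpow_le_rpow_of_exponent_le h1 (y := 1 / (1 + δ)) (z := 1) ?_).trans
      (le_of_eq (Real.rpow_one _))
    rw [div_le_one (by positivity)]
    linarith
  have hone : 1 ≤ Real.exp (ε * L) := Real.one_le_exp (by positivity)
  have hexp : Real.exp (-2 * L / (1 + δ)) * Real.exp (ε * L) * Real.exp L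
      = Real.exp (-ε * L) := by
    rw [← Real.exp_add, ← Real.exp_add]
    congr 1
    rw [hε]
    field_simp
    ring
  calc _ ≤ 2 * K * (C ^ 2 * L ^ 2 * Real.exp (-2 * L / (1 + δ))) *
        ((2 * Real.exp (ε * L) + Real.exp (ε * L)) * (6 * L * Real.exp L)) := by gcongr
    _ = 36 * K * C ^ 2 * (L ^ 3 * (Real.exp (-2 * L / (1 + δ)) * Real.exp (ε * L) *
          Real.exp L)) := by ring
    _ = _ := by rw [hexp]

/-- The maximal weight `L exp (-L)` cancels the lag range `exp L / L³`. The cube leaves enough room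
to bound `√L` crudely by `L`. -/
lemma intermediate_lag_bound {G M C A L s : ℝ} (hG : 0 ≤ G) (hM : 0 ≤ M) (hA : 0 ≤ A) (hC : 0 ≤ C)
    (hL : 1 ≤ L) (hm : 1 ≤ Real.exp L / L ^ 3) (hs0 : 0 ≤ s) (hs : s ≤ A * √L) :
    2 * (G / L) * M * (C * L * Real.exp (-L)) * ((2 * (Real.exp L / L ^ 3) + 1) * s)
      ≤ 6 * G * M * C * A / L := by
  have hL0 : 0 < L := by linarith
  have hsL : √L ≤ L := Real.sqrt_le_iff.2 ⟨by linarith, by nlinarith⟩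
  have hs' : s ≤ A * L := hs.trans (by gcongr)
  calc _ ≤ 2 * (G / L) * M * (C * L * Real.exp (-L)) *
        ((2 * (Real.exp L / L ^ 3) + Real.exp L / L ^ 3) * (A * L)) := by gcongr
    _ = 6 * G * M * C * A / L * (1 / L) := by
        rw [Real.exp_neg]
        field_simp
        ring
    _ ≤ 6 * G * M * C * A / L * 1 := by
        gcongr
        rw [div_le_one hL0]
        exact hL
    _ = _ := mul_one _

set_option maxHeartbeats 1000000 in
/-- The bound of the normal comparison inequality vanishes in the limit. -/
lemma tendsto_sum_compTerm (hr : Tendsto (fun n : ℕ ↦ r n * Real.log n) atTop (𝓝 γ)) (hγ : 0 ≤ γ)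
    {δ : ℝ} (hδ0 : 0 < δ) (hδ : δ < 1) (hrδ : ∀ n, 1 ≤ n → |r n| ≤ δ)
    {v₁ v₂ : ℝ → ℝ} {κ₁ κ₂ : ℝ}
    (h₁ : IsLevel v₁ κ₁) (h₁' : ∀ᶠ L in atTop, 0 ≤ v₁ L)
    (h₂ : IsLevel v₂ κ₂) (h₂' : ∀ᶠ L in atTop, 0 ≤ v₂ L) :
    Tendsto (fun L ↦ ∑ i ∈ crossSet L (v₁ L) (v₂ L), ∑ j ∈ (crossSet L (v₁ L) (v₂ L)).erase i,
      compTerm (r (i - j).natAbs) (γ / L) (Real.exp (-L) * i.natAbs) (Real.exp (-L) * j.natAbs))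
      atTop (𝓝 0) := by
  obtain ⟨C₁, hC₁, hE₁⟩ := h₁.exists_exp_le
  obtain ⟨C₂, hC₂, hE₂⟩ := h₂.exists_exp_le
  obtain ⟨A₁, hA₁, hS₁⟩ := h₁.exists_sum_exp_le h₁'
  obtain ⟨A₂, hA₂, hS₂⟩ := h₂.exists_sum_exp_le h₂'
  set C := max C₁ C₂ with hC
  have hC1 : 1 ≤ C := hC₁.trans (le_max_left _ _)
  set A := A₁ + A₂ with hA
  have hA0 : 0 ≤ A := by positivity
  set ε := (1 - δ) / (2 * (1 + δ)) with hε
  have hε0 : 0 < ε := div_pos (by linarith) (by positivity)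
  have hε1 : ε ≤ 1 := by
    rw [hε, div_le_one (by positivity)]
    linarith
  set G := (γ + 1) / ε with hG
  have hGγ : γ ≤ G := by
    rw [hG, le_div_iff₀ hε0]
    nlinarith
  set K := (√(1 - δ ^ 2))⁻¹ with hK
  have hK0 : 0 ≤ K := by positivity
  set M := K * Real.exp (9 * G) with hM
  have hM0 : 0 ≤ M := by positivity
  have hB₁ : Tendsto (fun L : ℝ ↦ 36 * K * C ^ 2 * (L ^ 3 * Real.exp (-ε * L))) atTop (𝓝 0) := by
    have h := Real.tendsto_pow_mul_exp_neg_atTop_nhds_zero 3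
    have h2 := (h.comp (tendsto_id.const_mul_atTop hε0)).const_mul (36 * K * C ^ 2 * (1 / ε ^ 3))
    rw [mul_zero] at h2
    refine h2.congr fun L ↦ ?_
    simp only [Function.comp_apply, id]
    rw [neg_mul]
    field_simp
  have hB₂ : Tendsto (fun L : ℝ ↦ 6 * G * M * C * A / L) atTop (𝓝 0) := tendsto_div_id_atTop _
  refine (tendsto_order.2 ⟨fun a ha ↦ Eventually.of_forall fun L ↦ ha.trans_le ?_, fun a ha ↦ ?_⟩)
  · exact Finset.sum_nonneg fun i _ ↦ Finset.sum_nonneg fun j _ ↦ by unfold compTerm; positivity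
  -- The long lags contribute at most `η M A²`, which this choice keeps below `a/2`.
  set η := a / (2 * (M * A ^ 2 + 1)) with hη
  have hη0 : 0 < η := by positivity
  have hB := (hB₁.add hB₂).add_const (η * (M * A ^ 2))
  have hlt : 0 + 0 + η * (M * A ^ 2) < a := by
    have : η * (2 * (M * A ^ 2 + 1)) = a := by rw [hη]; field_simp
    nlinarith [mul_nonneg hM0 (sq_nonneg A)]
  filter_upwards [hE₁, hE₂, hS₁, hS₂, h₁', h₂', hB.eventually_lt_const hlt,
    eventually_abs_le_div hr hγ hε0, eventually_abs_sub_le_div hr hγ hη0, eventually_ge_atTop 1,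
    (tendsto_div_id_atTop γ).eventually_lt_const hδ0,
    (Real.tendsto_exp_div_pow_atTop 3).eventually_ge_atTop 1]
    with L hE₁ hE₂ hS₁ hS₂ h₁' h₂' hB hw hη' hL hρδ hm2
  refine lt_of_le_of_lt ?_ hB
  have hL0 : 0 < L := by linarith
  have hρ0 : 0 ≤ γ / L := by positivity
  set S := crossSet L (v₁ L) (v₂ L) with hS
  have hcE : ∀ i ∈ S, Real.exp (-(Real.exp (-L) * i.natAbs) ^ 2 / 2) ≤ C * L * Real.exp (-L) := by
    intro i hi
    rw [hS, mem_crossSet h₁' h₂'] at hi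
    have aux : ∀ {v c : ℝ}, 0 ≤ v → v < c → Real.exp (-c ^ 2 / 2) ≤ Real.exp (-v ^ 2 / 2) :=
      fun hv hvc ↦ Real.exp_le_exp.2 (by nlinarith)
    rcases hi.2 with h | h
    · refine (aux h₁' h.2).trans (hE₁.trans ?_)
      gcongr
      exact le_max_left _ _
    · refine (aux h₂' h.2).trans (hE₂.trans ?_)
      gcongr
      exact le_max_right _ _
  have hcQ : ∀ i ∈ S, (Real.exp (-L) * i.natAbs) ^ 2 ≤ 9 * L := by
    intro i hi
    rw [hS, mem_crossSet h₁' h₂'] at hi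
    have := pow_le_pow_left₀ (by positivity) hi.1 2
    rw [mul_pow 3, Real.sq_sqrt hL0.le] at this
    linarith
  have hsumS : ∑ i ∈ S, Real.exp (-(Real.exp (-L) * i.natAbs) ^ 2 / 2) ≤ A * √L := by
    have := sum_crossSet L (v₁ L) (v₂ L) fun n ↦ Real.exp (-(Real.exp (-L) * n) ^ 2 / 2)
    rw [hS, this, hA, add_mul]
    exact add_le_add hS₁ hS₂
  have hlag : ∀ i ∈ S, ∀ j ∈ S, ((i - j).natAbs : ℝ) ≤ 6 * L * Real.exp L := fun i hi j hj ↦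
    natAbs_sub_le_of_mem_crossSet hL h₁' h₂' hi hj
  have hbound := sum_compTerm_le S (c := fun i ↦ Real.exp (-L) * i.natAbs) (r := r) (ρ := γ / L)
    (δ := δ) (E := C * L * Real.exp (-L)) (Q := 9 * L) (m₁ := Real.exp (ε * L))
    (m₂ := Real.exp L / L ^ 3) (w := G / L) (η := η / L) hδ hrδ
    (by rw [abs_of_nonneg hρ0]; exact hρδ.le) hcE (by positivity) hcQ (Real.exp_nonneg _)
    (by positivity) hw (by rw [abs_of_nonneg hρ0]; gcongr) (by positivity)
    fun i hi j hj hn ↦ hη' _ hn (hlag i hi j hj)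
  have hQw : 9 * L * (G / L) = 9 * G := by field_simp
  rw [hQw, ← hK, ← hM] at hbound
  refine hbound.trans ?_
  have hcard : (S.card : ℝ) ≤ 6 * L * Real.exp L := card_crossSet_le hL
  have hG0 : 0 ≤ G := hγ.trans hGγ
  have hsL : √L ≤ L := Real.sqrt_le_iff.2 ⟨by linarith, by nlinarith⟩
  refine add_le_add (add_le_add ?_ ?_) ?_
  · exact short_lag_bound hδ0 hC1 hK0 hL hε hε0 (Nat.cast_nonneg _) hcard
  · exact intermediate_lag_bound hG0 hM0 hA0 (by linarith) hL hm2
      (Finset.sum_nonneg fun i _ ↦ Real.exp_nonneg _) hsumS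
  · have hsq := pow_le_pow_left₀ (Finset.sum_nonneg fun i _ ↦ Real.exp_nonneg _) hsumS 2
    rw [mul_pow, Real.sq_sqrt hL0.le] at hsq
    calc _ ≤ η / L * M * (A ^ 2 * L) := mul_le_mul_of_nonneg_left hsq (by positivity)
      _ = _ := by field_simp

end Asymptotics

/-! ### Covariances of the stationary sequence -/

section Stationary

variable {Ω : Type*} [MeasurableSpace Ω] {P : Measure Ω} {X : ℤ → Ω → ℝ}

namespace IsStationaryStdGaussian

variable (hX : IsStationaryStdGaussian X P)

include hX

lemma memLp_two (i : ℤ) : MemLp (X i) 2 P := (hX.gaussian.hasGaussianLaw_eval i).memLp_two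

lemma map_eq (i : ℤ) : P.map (X i) = gaussianReal 0 1 := by
  rw [(hX.gaussian.hasGaussianLaw_eval i).map_eq_gaussianReal, hX.mean_zero, hX.variance_one,
    Real.toNNReal_one]

lemma measureReal_lt (i : ℤ) (c : ℝ) : P.real {ω | c < X i ω} = normalTail c := by
  rw [normalTail, ← hX.map_eq i, map_measureReal_apply_of_aemeasurable
    (hX.gaussian.aemeasurable i) measurableSet_Ioi]
  rfl

lemma integral_mul_add (i j k : ℤ) :
    ∫ ω, X (i + k) ω * X (j + k) ω ∂P = ∫ ω, X i ω * X j ω ∂P := by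
  have h := (hX.stationary k).comp (u := fun f : ℤ → ℝ ↦ f i * f j)
    ((measurable_pi_apply i).mul (measurable_pi_apply j))
  exact h.integral_eq

lemma integral_mul_eq_covFun (i j : ℤ) :
    ∫ ω, X i ω * X j ω ∂P = covFun X P (i - j).natAbs := by
  have key : ∀ a b : ℤ, a ≤ b → ∫ ω, X a ω * X b ω ∂P = covFun X P (a - b).natAbs := by
    intro a b hab
    have := hX.integral_mul_add 1 (((a - b).natAbs : ℤ) + 1) (a - 1)
    rw [covFun, ← this]
    have e1 : 1 + (a - 1) = a := by ring
    have e2 : ((a - b).natAbs : ℤ) + 1 + (a - 1) = b := by omega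
    rw [e1, e2]
  rcases le_total i j with h | h
  · exact key i j h
  · have := key j i h
    have e : (j - i).natAbs = (i - j).natAbs := by omega
    rw [e] at this
    rw [← this]
    simp_rw [mul_comm]

lemma covariance_eq (i j : ℤ) : cov[X i, X j; P] = covFun X P (i - j).natAbs := by
  have := hX.gaussian.isProbabilityMeasure
  rw [covariance_eq_sub (hX.memLp_two i) (hX.memLp_two j), hX.mean_zero, hX.mean_zero, mul_zero,
    sub_zero, ← hX.integral_mul_eq_covFun]
  rfl

lemma covFun_zero : covFun X P 0 = 1 := by
  have := hX.covariance_eq 0 0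
  rw [covariance_self (hX.gaussian.aemeasurable 0), hX.variance_one] at this
  simpa using this.symm

/-- Equality in Cauchy–Schwarz: `E (X_{m+n} - s X_m)² = 1 - s² ≤ 0` forces `X_{m+n} = s X_m` almost
surely. -/
lemma covFun_add_of_one_le_abs {n : ℕ} (hn : 1 ≤ |covFun X P n|) (m : ℕ) :
    covFun X P (m + n) = covFun X P n * covFun X P m := by
  set s := covFun X P n with hs
  have hlp : ∀ i j : ℤ, Integrable (fun ω ↦ X i ω * X j ω) P := fun i j ↦
    (hX.memLp_two i).integrable_mul (hX.memLp_two j)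
  have hint : ∫ ω, (X (m + n) ω - s * X m ω) ^ 2 ∂P = 1 - s ^ 2 := by
    have e : (fun ω ↦ (X (m + n) ω - s * X m ω) ^ 2) = fun ω ↦
        X (m + n) ω * X (m + n) ω - 2 * s * (X (m + n) ω * X m ω) + s ^ 2 * (X m ω * X m ω) := by
      ext ω; ring
    have hi : Integrable (fun ω ↦ X (m + n) ω * X (m + n) ω - 2 * s * (X (m + n) ω * X m ω)) P :=
      (hlp _ _).sub ((hlp _ _).const_mul _)
    rw [e, integral_add hi ((hlp _ _).const_mul _),
      integral_sub (hlp _ _) ((hlp _ _).const_mul _), integral_const_mul, integral_const_mul,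
      hX.integral_mul_eq_covFun, hX.integral_mul_eq_covFun, hX.integral_mul_eq_covFun]
    have e1 : ((m : ℤ) + n - m).natAbs = n := by omega
    rw [e1, ← hs]
    simp only [sub_self, Int.natAbs_zero, hX.covFun_zero]
    ring
  have hs2 : 1 ≤ s ^ 2 := by
    rw [← sq_abs]
    exact one_le_pow₀ hn
  have hsq : Integrable (fun ω ↦ (X (m + n) ω - s * X m ω) ^ 2) P :=
    ((hX.memLp_two _).sub ((hX.memLp_two m).const_mul s)).integrable_sq
  have h0 : ∫ ω, (X (m + n) ω - s * X m ω) ^ 2 ∂P = 0 :=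
    le_antisymm (by linarith) (integral_nonneg fun ω ↦ sq_nonneg _)
  have hae := (integral_eq_zero_iff_of_nonneg (fun ω ↦ sq_nonneg _) hsq).1 h0
  have e2 := hX.integral_mul_eq_covFun 0 (m + n)
  have e3 := hX.integral_mul_eq_covFun 0 m
  have e4 : ((0 : ℤ) - (m + n)).natAbs = m + n := by omega
  have e5 : ((0 : ℤ) - m).natAbs = m := by omega
  rw [e4] at e2
  rw [e5] at e3
  rw [← e2, ← e3, ← integral_const_mul]
  refine integral_congr_ae ?_
  filter_upwards [hae] with ω hω
  have h1 : X (m + n) ω - s * X m ω = 0 := pow_eq_zero_iff two_ne_zero |>.1 hω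
  have h2 : X (m + n) ω = s * X m ω := by linarith
  rw [h2]
  ring

/-- Otherwise `|r_{kn}| ≥ 1` for every `k` by iteration, against `r → 0`. -/
lemma abs_covFun_lt_one (h : Tendsto (covFun X P) atTop (𝓝 0)) {n : ℕ} (hn : 1 ≤ n) :
    |covFun X P n| < 1 := by
  by_contra hc
  rw [not_lt] at hc
  have hmul : ∀ k : ℕ, 1 ≤ |covFun X P (k * n)| := by
    intro k
    induction k with
    | zero => simp [hX.covFun_zero]
    | succ k ih =>
      rw [Nat.succ_mul, hX.covFun_add_of_one_le_abs hc, abs_mul]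
      exact one_le_mul_of_one_le_of_one_le hc ih
  have ht : Tendsto (fun k : ℕ ↦ |covFun X P (k * n)|) atTop (𝓝 0) := by
    have := (h.comp (tendsto_id.atTop_mul_const' (show 0 < n by omega))).abs
    simpa using! this
  exact absurd (ge_of_tendsto' ht hmul) (by norm_num)

/-- All but finitely many covariances are below `1/2`, and the remaining ones are individually below
`1`. -/
lemma exists_abs_covFun_le (h : Tendsto (covFun X P) atTop (𝓝 0)) :
    ∃ δ, 0 < δ ∧ δ < 1 ∧ ∀ n, 1 ≤ n → |covFun X P n| ≤ δ := by
  have h1 : ∀ᶠ n in atTop, |covFun X P n| < 1 / 2 := by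
    have := h.abs
    rw [abs_zero] at this
    exact this.eventually_lt_const (by norm_num)
  obtain ⟨N, hN⟩ := eventually_atTop.1 h1
  have hfin : ∀ M : ℕ, ∃ δ, 0 < δ ∧ δ < 1 ∧ ∀ n, 1 ≤ n → n < M → |covFun X P n| ≤ δ := by
    intro M
    induction M with
    | zero => exact ⟨1 / 2, by norm_num, by norm_num, by omega⟩
    | succ M ih =>
      obtain ⟨δ, h0, h1, h2⟩ := ih
      rcases Nat.eq_zero_or_pos M with rfl | hM
      · exact ⟨δ, h0, h1, by omega⟩
      refine ⟨max δ |covFun X P M|, lt_max_of_lt_left h0, max_lt h1 (hX.abs_covFun_lt_one h hM),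
        fun n hn hnM ↦ ?_⟩
      rcases Nat.lt_succ_iff_lt_or_eq.1 hnM with h3 | rfl
      · exact (h2 n hn h3).trans (le_max_left _ _)
      · exact le_max_right _ _
  obtain ⟨δ, h0, h1, h2⟩ := hfin N
  refine ⟨max δ (1 / 2), lt_max_of_lt_left h0, max_lt h1 (by norm_num), fun n hn ↦ ?_⟩
  rcases lt_or_ge n N with h3 | h3
  · exact (h2 n hn h3).trans (le_max_left _ _)
  · exact (hN n h3).le.trans (le_max_right _ _)

/-- The comparison of the finite-dimensional distributions with equicorrelated ones. -/
lemma abs_measureReal_sub_equicorrelated_le {δ : ℝ} (hδ : δ < 1)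
    (hr : ∀ n, 1 ≤ n → |covFun X P n| ≤ δ) {ρ : ℝ} (hρ0 : 0 ≤ ρ) (hρ1 : ρ < 1) (S : Finset ℤ)
    {c : ℤ → ℝ} (hc : ∀ i, 0 ≤ c i) :
    |P.real {ω | ∀ i ∈ S, X i ω ≤ c i} - (equicorrelated S ρ).real (Set.Iic fun i ↦ c i)|
      ≤ ∑ i ∈ S, ∑ j ∈ S.erase i, compTerm (covFun X P (i - j).natAbs) ρ (c i) (c j) := by
  classical
  have hP := hX.gaussian.isProbabilityMeasure
  set f : Ω → S → ℝ := fun ω ↦ S.restrict (X · ω) with hf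
  have hG : HasGaussianLaw f P := hX.gaussian.hasGaussianLaw S
  have hfm : AEMeasurable f P := hG.aemeasurable
  have hgauss : IsGaussian (P.map f) := hG.isGaussian_map
  have hevent : P.real {ω | ∀ i ∈ S, X i ω ≤ c i} = (P.map f).real (Set.Iic fun i ↦ c i) := by
    rw [map_measureReal_apply_of_aemeasurable hfm measurableSet_Iic]
    congr 1
    ext ω
    simp [hf, Pi.le_def]
  have hcov : ∀ i j : S, cov[fun x ↦ x i, fun x ↦ x j; P.map f]
      = covFun X P ((i : ℤ) - j).natAbs := fun i j ↦ by
    rw [covariance_map_fun (measurable_pi_apply i).aestronglyMeasurable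
      (measurable_pi_apply j).aestronglyMeasurable hfm, ← hX.covariance_eq]
    rfl
  have hne : ∀ {i j : S}, i ≠ j → 1 ≤ ((i : ℤ) - j).natAbs := fun {i j} hij ↦ by
    have : (i : ℤ) ≠ j := fun h ↦ hij (Subtype.ext h)
    omega
  have key := abs_measureReal_Iic_sub_le (P.map f) (equicorrelated S ρ)
    (w := fun i j ↦ max |covFun X P ((i : ℤ) - j).natAbs| |ρ|) (u := fun i : S ↦ c i)
    (fun i ↦ by
      rw [integral_map hfm (measurable_pi_apply i).aestronglyMeasurable]
      exact hX.mean_zero i)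
    (integral_equicorrelated ρ)
    (fun i ↦ by
      rw [← covariance_self (measurable_pi_apply i).aemeasurable, hcov]
      simp [hX.covFun_zero])
    (variance_equicorrelated hρ0 hρ1.le)
    (fun i j _ ↦ by rw [hcov]; exact le_max_left _ _)
    (fun i j hij ↦ by rw [covariance_equicorrelated hρ0 hij]; exact le_max_right _ _)
    (fun i j hij ↦ max_lt ((hr _ (hne hij)).trans_lt hδ) (by rwa [abs_of_nonneg hρ0]))
    (fun i ↦ hc i)
  rw [hevent]
  refine key.trans (le_of_eq ?_)
  rw [← Finset.sum_coe_sort S]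
  refine Finset.sum_congr rfl fun i _ ↦ ?_
  -- Each off-diagonal sum is written as a full sum minus its diagonal term, in order to pass
  -- between `S` and its subtype.
  rw [Finset.sum_erase_eq_sub i.2, ← Finset.sum_coe_sort S,
    ← Finset.sum_erase_eq_sub (Finset.mem_univ i) (f := fun j : S ↦
      compTerm (covFun X P ((i : ℤ) - j).natAbs) ρ (c i) (c j))]
  refine Finset.sum_congr rfl fun j hj ↦ ?_
  rw [hcov, covariance_equicorrelated hρ0 (Finset.ne_of_mem_erase hj).symm]
  rfl

end IsStationaryStdGaussian

end Stationary

/-! ### From crossing times to events on the sequence -/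

section Events

/-- The event that there is no crossing of the two lines of slope `exp (-L)` above level `s` on the
negative half-axis, and none above level `t` on the positive half-axis. -/
def noCrossing {Ω : Type*} (X : ℤ → Ω → ℝ) (L s t : ℝ) : Set Ω :=
  {ω | ∀ i : ℤ, (i < 0 ∧ s < Real.exp (-L) * i.natAbs) ∨ (0 < i ∧ t < Real.exp (-L) * i.natAbs) →
    X i ω ≤ Real.exp (-L) * i.natAbs}

/-- A bound on an infimum or supremum is a bound on every element, so the identity needs no
attainment and covers infinite values. Nonnegative `s` and `t` put every forbidden index strictly on
its own side of `0`. -/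
lemma setOf_firstCrossing_lastExit_eq {Ω : Type*} {X : ℤ → Ω → ℝ} {L s t : ℝ} (hs : 0 ≤ s) (ht : 0 ≤ t) :
    {ω | ((-s : ℝ) : EReal) ≤ firstCrossing X (Real.exp (-L)) ω ∧
      lastExit X (Real.exp (-L)) ω ≤ (t : EReal)}
      = noCrossing X L (Real.exp (-L) * s) (Real.exp (-L) * t) := by
  have hβ := Real.exp_pos (-L)
  ext ω
  simp only [Set.mem_ofPred_eq, noCrossing, firstCrossing, lastExit, le_sInf_iff, sSup_le_iff,
    Set.forall_mem_image, EReal.coe_le_coe_iff, mul_lt_mul_iff_right₀ hβ]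
  constructor
  · rintro ⟨h1, h2⟩ i (⟨hi, hsi⟩ | ⟨hi, hti⟩)
    · have e : (i.natAbs : ℝ) = -i := by
        rw [Nat.cast_natAbs, Int.cast_abs, abs_of_neg (by exact_mod_cast hi)]
      rw [e] at hsi ⊢
      by_contra hc
      have := h1 (x := i) (by linarith)
      linarith
    · have e : (i.natAbs : ℝ) = i := by
        rw [Nat.cast_natAbs, Int.cast_abs, abs_of_pos (by exact_mod_cast hi)]
      rw [e] at hti ⊢
      by_contra hc
      have := h2 (x := i) ⟨hi.le, not_le.1 hc⟩
      linarith
  · intro h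
    constructor
    · intro i hi
      by_contra hc
      rw [not_le] at hc
      have hi0 : i < 0 := by
        have : (i : ℝ) < 0 := by linarith
        exact_mod_cast this
      have e : (i.natAbs : ℝ) = -i := by
        rw [Nat.cast_natAbs, Int.cast_abs, abs_of_neg (by exact_mod_cast hi0)]
      have := h i (Or.inl ⟨hi0, by rw [e]; linarith⟩)
      rw [e] at this
      linarith
    · rintro i ⟨hi, hix⟩
      by_contra hc
      rw [not_le] at hc
      have hi0 : 0 < i := by
        have : (0 : ℝ) < i := by linarith
        exact_mod_cast this
      have e : (i.natAbs : ℝ) = i := by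
        rw [Nat.cast_natAbs, Int.cast_abs, abs_of_pos (by exact_mod_cast hi0)]
      have := h i (Or.inr ⟨hi0, by rw [e]; exact hc⟩)
      rw [e] at this
      linarith

variable {Ω : Type*} [MeasurableSpace Ω] {P : Measure Ω} {X : ℤ → Ω → ℝ}

/-- Half of the Gaussian exponent is spent on `c² ≥ 9L`, the other half on `exp (-c²/4) ≤ 4/c²`. As
`c² = exp (-2L) i²`, what remains is `exp (-9L/4 + 2L)`, with a summable `1/i²`. -/
lemma normalTail_le_of_cutoff_lt {L : ℝ} (hL : 1 ≤ L) {i : ℤ}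
    (hi : 3 * √L < Real.exp (-L) * i.natAbs) :
    normalTail (Real.exp (-L) * i.natAbs) ≤ 4 * Real.exp (-(L / 4)) * (1 / (i : ℝ) ^ 2) := by
  set c := Real.exp (-L) * i.natAbs with hc
  have hL1 : 1 ≤ √L := Real.one_le_sqrt.2 hL
  have hc1 : 1 ≤ c := by linarith
  have hc9 : 9 * L ≤ c ^ 2 := by
    have := pow_le_pow_left₀ (by positivity) hi.le 2
    rw [mul_pow, Real.sq_sqrt (by linarith)] at this
    linarith
  have hi2 : c ^ 2 = Real.exp (-2 * L) * (i : ℝ) ^ 2 := by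
    rw [hc, mul_pow, ← Real.exp_nat_mul, Nat.cast_natAbs, Int.cast_abs, sq_abs]
    push_cast
    ring_nf
  have hi0 : 0 < (i : ℝ) ^ 2 := by
    have : 0 < c ^ 2 := by positivity
    rw [hi2] at this
    exact pos_of_mul_pos_right this (Real.exp_nonneg _)
  calc normalTail c ≤ gaussianPDFReal 0 1 c / c := normalTail_le (by linarith)
    _ ≤ gaussianPDFReal 0 1 c := div_le_self (gaussianPDFReal_nonneg _ _ _) hc1
    _ ≤ Real.exp (-(1 / 2) * c ^ 2) := gaussianPDFReal_zero_one_le c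
    _ = Real.exp (-(c ^ 2 / 4)) * Real.exp (-(c ^ 2 / 4)) := by
        rw [← Real.exp_add]; congr 1; ring
    _ ≤ Real.exp (-(9 * L / 4)) * (4 / c ^ 2) := by
        gcongr
        rw [Real.exp_neg, inv_le_comm₀ (Real.exp_pos _) (by positivity), inv_div]
        linarith [Real.add_one_le_exp (c ^ 2 / 4)]
    _ = 4 * (Real.exp (-(9 * L / 4)) / Real.exp (-2 * L)) * (1 / (i : ℝ) ^ 2) := by
        rw [hi2]
        field_simp
    _ = _ := by
        rw [← Real.exp_sub]
        ring_nf

lemma measureReal_iUnion_cutoff_le (hX : IsStationaryStdGaussian X P) {L : ℝ} (hL : 1 ≤ L) :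
    P.real (⋃ i : ℤ, {ω | 3 * √L < Real.exp (-L) * i.natAbs ∧ Real.exp (-L) * i.natAbs < X i ω})
      ≤ 4 * Real.exp (-(L / 4)) * ∑' i : ℤ, 1 / (i : ℝ) ^ 2 := by
  have hP := hX.gaussian.isProbabilityMeasure
  have hsum : Summable fun i : ℤ ↦ 4 * Real.exp (-(L / 4)) * (1 / (i : ℝ) ^ 2) :=
    (Real.summable_one_div_int_pow.2 one_lt_two).mul_left _
  rw [← tsum_mul_left, measureReal_def]
  refine ENNReal.toReal_le_of_le_ofReal (tsum_nonneg fun i ↦ by positivity) ?_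
  rw [ENNReal.ofReal_tsum_of_nonneg (fun i ↦ by positivity) hsum]
  refine (measure_iUnion_le _).trans (ENNReal.tsum_le_tsum fun i ↦ ?_)
  by_cases hi : 3 * √L < Real.exp (-L) * i.natAbs
  · simp only [hi, true_and]
    rw [← ofReal_measureReal, hX.measureReal_lt]
    exact ENNReal.ofReal_le_ofReal (normalTail_le_of_cutoff_lt hL hi)
  · simp only [hi, false_and]
    simp

lemma abs_measureReal_noCrossing_sub_le (hX : IsStationaryStdGaussian X P) {L s t : ℝ}
    (hL : 1 ≤ L) (hs : 0 ≤ s) (ht : 0 ≤ t) :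
    |P.real (noCrossing X L s t) -
        P.real {ω | ∀ i ∈ crossSet L s t, X i ω ≤ Real.exp (-L) * i.natAbs}|
      ≤ 4 * Real.exp (-(L / 4)) * ∑' i : ℤ, 1 / (i : ℝ) ^ 2 := by
  have hP := hX.gaussian.isProbabilityMeasure
  have hsub : noCrossing X L s t ⊆
      {ω | ∀ i ∈ crossSet L s t, X i ω ≤ Real.exp (-L) * i.natAbs} := fun ω hω i hi ↦
    hω i ((mem_crossSet hs ht).1 hi).2
  have hcover : {ω | ∀ i ∈ crossSet L s t, X i ω ≤ Real.exp (-L) * i.natAbs} ⊆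
      noCrossing X L s t ∪
        ⋃ i : ℤ, {ω | 3 * √L < Real.exp (-L) * i.natAbs ∧ Real.exp (-L) * i.natAbs < X i ω} := by
    intro ω hω
    by_cases hc : ω ∈ noCrossing X L s t
    · exact Or.inl hc
    · simp only [noCrossing, Set.mem_ofPred_eq, not_forall, not_le] at hc
      obtain ⟨i, hi, hlt⟩ := hc
      refine Or.inr (Set.mem_iUnion.2 ⟨i, ?_, hlt⟩)
      by_contra h3
      exact absurd (hω i ((mem_crossSet hs ht).2 ⟨not_lt.1 h3, hi⟩)) (not_le.2 hlt)
  have h1 : P.real (noCrossing X L s t) ≤ _ := measureReal_mono hsub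
  have h2 := (measureReal_mono (μ := P) hcover).trans (measureReal_union_le _ _)
  have h3 := measureReal_iUnion_cutoff_le hX hL
  rw [abs_le]
  constructor <;> linarith [measureReal_nonneg (μ := P) (s := ⋃ i : ℤ,
    {ω | 3 * √L < Real.exp (-L) * i.natAbs ∧ Real.exp (-L) * i.natAbs < X i ω})]

lemma tendsto_zero_of_tendsto_mul_log {r : ℕ → ℝ} {γ : ℝ}
    (hr : Tendsto (fun n : ℕ ↦ r n * Real.log n) atTop (𝓝 γ)) : Tendsto r atTop (𝓝 0) := by
  have hlog : Tendsto (fun n : ℕ ↦ Real.log n) atTop atTop :=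
    Real.tendsto_log_atTop.comp tendsto_natCast_atTop_atTop
  refine (hr.div_atTop hlog).congr' ?_
  filter_upwards [hlog.eventually_gt_atTop 0] with n hn
  field_simp

/-- Truncation error and comparison error both vanish, which transfers the equicorrelated limit. -/
lemma tendsto_measureReal_noCrossing (hX : IsStationaryStdGaussian X P) {γ : ℝ} (hγ : 0 ≤ γ)
    (hr : Tendsto (fun n : ℕ ↦ covFun X P n * Real.log n) atTop (𝓝 γ)) {v₁ v₂ : ℝ → ℝ} {κ₁ κ₂ : ℝ}
    (h₁ : IsLevel v₁ κ₁) (h₁' : ∀ᶠ L in atTop, 0 ≤ v₁ L)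
    (h₂ : IsLevel v₂ κ₂) (h₂' : ∀ᶠ L in atTop, 0 ≤ v₂ L) :
    Tendsto (fun L ↦ P.real (noCrossing X L (v₁ L) (v₂ L))) atTop
      (𝓝 (∫ z, Real.exp (-(Real.exp (-(κ₁ + γ - √(2 * γ) * z)) +
        Real.exp (-(κ₂ + γ - √(2 * γ) * z)))) ∂(gaussianReal 0 1))) := by
  obtain ⟨δ, hδ0, hδ1, hδ⟩ := hX.exists_abs_covFun_le (tendsto_zero_of_tendsto_mul_log hr)
  have hcomp := tendsto_sum_compTerm hr hγ hδ0 hδ1 hδ h₁ h₁' h₂ h₂'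
  have htail : Tendsto (fun L : ℝ ↦ 4 * Real.exp (-(L / 4)) * ∑' i : ℤ, 1 / (i : ℝ) ^ 2) atTop
      (𝓝 0) := by
    have h := Real.tendsto_exp_neg_atTop_nhds_zero.comp
      (tendsto_id.atTop_div_const (show (0 : ℝ) < 4 by norm_num))
    have := (h.const_mul 4).mul_const (∑' i : ℤ, 1 / (i : ℝ) ^ 2)
    simpa using! this
  have hdiff : Tendsto (fun L ↦ P.real (noCrossing X L (v₁ L) (v₂ L)) -
      (equicorrelated (crossSet L (v₁ L) (v₂ L)) (γ / L)).real
        (Set.Iic fun i ↦ Real.exp (-L) * (i : ℤ).natAbs)) atTop (𝓝 0) := by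
    have hsum := htail.add hcomp
    rw [add_zero] at hsum
    refine squeeze_zero_norm' ?_ hsum
    filter_upwards [h₁', h₂', eventually_ge_atTop 1,
      (tendsto_div_id_atTop γ).eventually_lt_const one_pos] with L h1 h2 hL hρ
    have e1 := abs_measureReal_noCrossing_sub_le hX hL h1 h2
    have e2 := hX.abs_measureReal_sub_equicorrelated_le hδ1 hδ
      (show 0 ≤ γ / L from div_nonneg hγ (by linarith)) hρ (crossSet L (v₁ L) (v₂ L))
      (c := fun i ↦ Real.exp (-L) * i.natAbs) fun i ↦ by positivity
    rw [Real.norm_eq_abs]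
    exact (abs_sub_le _ _ _).trans (add_le_add e1 e2)
  have := hdiff.add (tendsto_measureReal_equicorrelated h₁ h₁' h₂ h₂' hγ)
  simpa using this

/-- The joint limit law of the first crossing point and the last exit time. -/
theorem tendsto_measureReal_firstCrossing_lastExit (hX : IsStationaryStdGaussian X P) {γ : ℝ}
    (hγ : 0 ≤ γ) (hr : Tendsto (fun n : ℕ ↦ covFun X P n * Real.log n) atTop (𝓝 γ))
    {u₁ u₂ : ℝ → ℝ} {κ₁ κ₂ : ℝ}
    (h₁ : IsLevel (fun L ↦ Real.exp (-L) * u₁ (Real.exp (-L))) κ₁)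
    (h₁' : ∀ᶠ L in atTop, 0 ≤ u₁ (Real.exp (-L)))
    (h₂ : IsLevel (fun L ↦ Real.exp (-L) * u₂ (Real.exp (-L))) κ₂)
    (h₂' : ∀ᶠ L in atTop, 0 ≤ u₂ (Real.exp (-L))) :
    Tendsto (fun β : ℝ ↦ P.real {ω | ((-u₁ β : ℝ) : EReal) ≤ firstCrossing X β ω ∧
        lastExit X β ω ≤ ((u₂ β : ℝ) : EReal)}) (𝓝[>] 0)
      (𝓝 (∫ z, Real.exp (-(Real.exp (-(κ₁ + γ - √(2 * γ) * z)) +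
        Real.exp (-(κ₂ + γ - √(2 * γ) * z)))) ∂(gaussianReal 0 1))) := by
  have key := tendsto_measureReal_noCrossing hX hγ hr h₁
    (h₁'.mono fun L hL ↦ mul_nonneg (Real.exp_nonneg _) hL) h₂
    (h₂'.mono fun L hL ↦ mul_nonneg (Real.exp_nonneg _) hL)
  have hexp : Tendsto (fun L : ℝ ↦ P.real {ω | ((-u₁ (Real.exp (-L)) : ℝ) : EReal) ≤
      firstCrossing X (Real.exp (-L)) ω ∧
      lastExit X (Real.exp (-L)) ω ≤ ((u₂ (Real.exp (-L)) : ℝ) : EReal)}) atTop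
      (𝓝 (∫ z, Real.exp (-(Real.exp (-(κ₁ + γ - √(2 * γ) * z)) +
        Real.exp (-(κ₂ + γ - √(2 * γ) * z)))) ∂(gaussianReal 0 1))) := by
    refine key.congr' ?_
    filter_upwards [h₁', h₂'] with L h1 h2
    rw [setOf_firstCrossing_lastExit_eq h1 h2]
  have hlog : Tendsto (fun β : ℝ ↦ -Real.log β) (𝓝[>] 0) atTop :=
    tendsto_neg_atBot_atTop.comp Real.tendsto_log_nhdsGT_zero
  refine (hexp.comp hlog).congr' ?_
  filter_upwards [self_mem_nhdsWithin] with β hβ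
  simp only [Function.comp_apply, neg_neg, Real.exp_log (Set.mem_Ioi.1 hβ)]

end Events

/-! ### The two normalizations as levels -/

section Levels

/-- Half the square of `levelA (exp (-L))`. -/
noncomputable def halfSqLevel (L : ℝ) : ℝ := L - Real.log (2 * L) - Real.log (2 * Real.pi) / 2

lemma tendsto_halfSqLevel_div : Tendsto (fun L ↦ halfSqLevel L / L) atTop (𝓝 1) := by
  have h := (tendsto_log_two_mul_div_atTop.add
    (tendsto_div_id_atTop (Real.log (2 * Real.pi) / 2))).const_sub 1
  norm_num at h
  refine h.congr' ?_
  filter_upwards [eventually_gt_atTop 0] with L hL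
  rw [halfSqLevel]
  field_simp
  ring

lemma tendsto_halfSqLevel : Tendsto halfSqLevel atTop atTop := by
  refine (tendsto_halfSqLevel_div.pos_mul_atTop one_pos tendsto_id).congr' ?_
  filter_upwards [eventually_gt_atTop 0] with L hL
  simp only [id]
  field_simp

lemma levelA_eq {β : ℝ} : levelA β = √(2 * halfSqLevel (-Real.log β)) := by
  rw [levelA, halfSqLevel, Real.log_inv, Real.log_rpow (by positivity)]
  congr 1
  ring

lemma isLevel_levelA : IsLevel (fun L ↦ levelA (Real.exp (-L))) 0 := by
  refine tendsto_const_nhds.congr' ?_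
  filter_upwards [tendsto_halfSqLevel.eventually_ge_atTop 0] with L hL
  rw [levelA_eq, Real.log_exp, neg_neg, Real.sq_sqrt (by linarith), halfSqLevel]
  ring

/-- The shift `x/a` times `√(2L)` tends to `x` because `a ~ √(2L)`. -/
lemma isLevel_weakLevel (x : ℝ) :
    IsLevel (fun L ↦ Real.exp (-L) * weakLevel (Real.exp (-L)) x) x := by
  have h0 : ∀ᶠ L in atTop, 0 ≤ levelA (Real.exp (-L)) := Eventually.of_forall fun L ↦
    Real.sqrt_nonneg _
  have hd : Tendsto (fun L ↦ x / levelA (Real.exp (-L)) * √(2 * L)) atTop (𝓝 x) := by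
    have := (isLevel_levelA.tendsto_div_sqrt h0).inv₀ one_ne_zero
    have := this.const_mul x
    rw [inv_one, mul_one] at this
    refine this.congr fun L ↦ ?_
    rw [inv_div]
    ring
  have := isLevel_levelA.add_div_sqrt h0 hd 0
  rw [zero_add, zero_add] at this
  refine Tendsto.congr (fun L ↦ ?_) this
  have he : Real.exp (-L) ≠ 0 := (Real.exp_pos _).ne'
  simp only [weakLevel, zero_div, sub_zero, Real.sqrt_one, div_one]
  rw [mul_comm (Real.exp (-L)), mul_assoc, inv_mul_cancel₀ he, mul_one]

lemma rhoLevel_exp_neg {γ L : ℝ} (hL : 0 ≤ L) : rhoLevel γ (Real.exp (-L)) = γ / L := by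
  rw [rhoLevel, Real.log_exp, abs_neg, abs_of_nonneg hL]

/-- With `g = -log (β/√(1-ρ)) = L + o(1)`, half the square of `b` is `(1 - γ/L) halfSqLevel (g L)`.
Only `(γ/L) halfSqLevel (g L) → γ` survives in the comparison with `halfSqLevel L`. This `-γ`
compensates the `+γ` produced by conditioning. -/
lemma isLevel_levelB (γ : ℝ) : IsLevel (fun L ↦ levelB (Real.exp (-L)) (γ / L)) (-γ) := by
  have hρ := tendsto_one_sub_div_atTop γ
  have hlogρ : Tendsto (fun L ↦ Real.log (1 - γ / L) / 2) atTop (𝓝 0) := by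
    have := (hρ.log one_ne_zero).div_const 2
    simpa using this
  set g : ℝ → ℝ := fun L ↦ L + Real.log (1 - γ / L) / 2 with hg
  have hgL : Tendsto (fun L ↦ g L / L) atTop (𝓝 1) := by
    have := (hlogρ.div_atTop tendsto_id).const_add 1
    rw [add_zero] at this
    refine this.congr' ?_
    filter_upwards [eventually_gt_atTop 0] with L hL
    simp only [hg, id]
    field_simp
  have hgtop : Tendsto g atTop atTop := by
    refine (hgL.pos_mul_atTop one_pos tendsto_id).congr' ?_
    filter_upwards [eventually_gt_atTop 0] with L hL
    simp only [id]
    field_simp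
  have hM : Tendsto (fun L ↦ γ * (halfSqLevel (g L) / g L * (g L / L))) atTop (𝓝 γ) := by
    have := ((tendsto_halfSqLevel_div.comp hgtop).mul hgL).const_mul γ
    simpa using! this
  have hlogg : Tendsto (fun L ↦ Real.log (g L / L)) atTop (𝓝 0) := by
    simpa using hgL.log one_ne_zero
  have hlim := (hlogρ.sub hlogg).sub hM
  rw [sub_zero, zero_sub] at hlim
  refine hlim.congr' ?_
  filter_upwards [eventually_gt_atTop 0, eventually_gt_atTop γ, hgtop.eventually_gt_atTop 0,
    (tendsto_halfSqLevel.comp hgtop).eventually_ge_atTop 0] with L hL hLγ hg0 hM0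
  have hρ0 : 0 < 1 - γ / L := by rw [sub_pos, div_lt_one hL]; exact hLγ
  have e1 : -Real.log (Real.exp (-L) / √(1 - γ / L)) = g L := by
    rw [Real.log_div (Real.exp_pos _).ne' (Real.sqrt_pos.2 hρ0).ne', Real.log_exp,
      Real.log_sqrt hρ0.le, hg]
    ring
  have hM0' : 0 ≤ halfSqLevel (g L) := hM0
  rw [levelB, levelA_eq, e1, mul_pow, Real.sq_sqrt hρ0.le, Real.sq_sqrt
    (mul_nonneg zero_le_two hM0'), Real.log_div hg0.ne' hL.ne', halfSqLevel,
    Real.log_mul two_ne_zero hg0.ne', Real.log_mul two_ne_zero hL.ne']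
  have e2 : Real.log (1 - γ / L) / 2 = g L - L := by simp [hg]
  rw [e2]
  field_simp
  ring

lemma isLevel_strongLevel {γ : ℝ} (hγ : 0 ≤ γ) (x : ℝ) :
    IsLevel (fun L ↦ Real.exp (-L) * strongLevel γ (Real.exp (-L)) x) (-γ + √(2 * γ) * x) := by
  have h0 : ∀ᶠ L in atTop, 0 ≤ levelB (Real.exp (-L)) (γ / L) := Eventually.of_forall fun L ↦
    mul_nonneg (Real.sqrt_nonneg _) (Real.sqrt_nonneg _)
  have hd : Tendsto (fun L ↦ √(γ / L) * x * √(2 * L)) atTop (𝓝 (√(2 * γ) * x)) := by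
    refine tendsto_const_nhds.congr' ?_
    filter_upwards [eventually_gt_atTop 0] with L hL
    rw [← sqrt_div_mul_sqrt hγ hL]
    ring
  have := (isLevel_levelB γ).add_div_sqrt h0 hd 0
  rw [add_zero] at this
  refine Tendsto.congr' ?_ this
  filter_upwards [eventually_ge_atTop 0] with L hL
  have he : Real.exp (-L) ≠ 0 := (Real.exp_pos _).ne'
  simp only [strongLevel, rhoLevel_exp_neg hL, zero_div, sub_zero, Real.sqrt_one, div_one]
  rw [mul_comm (Real.exp (-L)), mul_assoc, inv_mul_cancel₀ he, mul_one]

lemma eventually_weakLevel_nonneg (x : ℝ) :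
    ∀ᶠ L in atTop, 0 ≤ weakLevel (Real.exp (-L)) x := by
  have h0 : ∀ᶠ L in atTop, 0 ≤ levelA (Real.exp (-L)) := Eventually.of_forall fun L ↦
    Real.sqrt_nonneg _
  have ht := isLevel_levelA.tendsto_atTop h0
  filter_upwards [ht.eventually_ge_atTop (|x| + 1)] with L hL
  have hx := abs_nonneg x
  have hpos : 0 < levelA (Real.exp (-L)) := by linarith
  refine mul_nonneg ?_ (inv_nonneg.2 (Real.exp_nonneg _))
  have : -|x| ≤ x / levelA (Real.exp (-L)) := by
    rw [le_div_iff₀ hpos]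
    nlinarith [neg_abs_le x]
  linarith

lemma eventually_strongLevel_nonneg (γ x : ℝ) :
    ∀ᶠ L in atTop, 0 ≤ strongLevel γ (Real.exp (-L)) x := by
  have h0 : ∀ᶠ L in atTop, 0 ≤ levelB (Real.exp (-L)) (γ / L) := Eventually.of_forall fun L ↦
    mul_nonneg (Real.sqrt_nonneg _) (Real.sqrt_nonneg _)
  have hρ : Tendsto (fun L ↦ √(γ / L) * x) atTop (𝓝 0) := by
    simpa using (tendsto_div_id_atTop γ).sqrt.mul_const x
  filter_upwards [((isLevel_levelB γ).tendsto_atTop h0).eventually_ge_atTop 1,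
    hρ.eventually_const_lt (show (-1 : ℝ) < 0 by norm_num), eventually_ge_atTop 0] with L h1 h2 hL
  rw [strongLevel, rhoLevel_exp_neg hL]
  exact mul_nonneg (by linarith) (inv_nonneg.2 (Real.exp_nonneg _))

end Levels

end CrossingExit

/-! ### The two limit laws -/

theorem corollary2p1 {Ω : Type*} [MeasurableSpace Ω] (P : Measure Ω) [IsProbabilityMeasure P]
    (X : ℤ → Ω → ℝ) (hX : CrossingExit.IsStationaryStdGaussian X P) :
    (Tendsto (fun n : ℕ ↦ CrossingExit.covFun X P n * Real.log (n : ℝ)) atTop (𝓝 0) →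
      ∀ x y : ℝ,
        Tendsto
          (fun β : ℝ ↦ P.real {ω |
            ((-CrossingExit.weakLevel β x : ℝ) : EReal) ≤ CrossingExit.firstCrossing X β ω ∧
            CrossingExit.lastExit X β ω ≤ ((CrossingExit.weakLevel β y : ℝ) : EReal)})
          (𝓝[>] 0)
          (𝓝 (Real.exp (-(Real.exp (-x) + Real.exp (-y)))))) ∧
    (∀ γ : ℝ, 0 < γ →
      Tendsto (fun n : ℕ ↦ CrossingExit.covFun X P n * Real.log (n : ℝ)) atTop (𝓝 γ) →
      ∀ x y : ℝ,
        Tendsto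
          (fun β : ℝ ↦ P.real {ω |
            ((-CrossingExit.strongLevel γ β x : ℝ) : EReal) ≤ CrossingExit.firstCrossing X β ω ∧
            CrossingExit.lastExit X β ω ≤ ((CrossingExit.strongLevel γ β y : ℝ) : EReal)})
          (𝓝[>] 0)
          (𝓝 (∫ z : ℝ, Real.exp (-(Real.exp (-(Real.sqrt (2 * γ) * (x - z)))
            + Real.exp (-(Real.sqrt (2 * γ) * (y - z))))) ∂(gaussianReal 0 1)))) := by
  refine ⟨fun hr x y ↦ ?_, fun γ hγ hr x y ↦ ?_⟩
  · have := CrossingExit.tendsto_measureReal_firstCrossing_lastExit hX le_rfl hr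
      (u₁ := fun β ↦ CrossingExit.weakLevel β x) (u₂ := fun β ↦ CrossingExit.weakLevel β y)
      (CrossingExit.isLevel_weakLevel x) (CrossingExit.eventually_weakLevel_nonneg x)
      (CrossingExit.isLevel_weakLevel y) (CrossingExit.eventually_weakLevel_nonneg y)
    -- For `γ = 0` the integrand no longer depends on `z`, and the integral is its constant value.
    simpa using this
  · have := CrossingExit.tendsto_measureReal_firstCrossing_lastExit hX hγ.le hr
      (u₁ := fun β ↦ CrossingExit.strongLevel γ β x) (u₂ := fun β ↦ CrossingExit.strongLevel γ β y)
      (CrossingExit.isLevel_strongLevel hγ.le x) (CrossingExit.eventually_strongLevel_nonneg γ x)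
      (CrossingExit.isLevel_strongLevel hγ.le y) (CrossingExit.eventually_strongLevel_nonneg γ y)
    have e : ∀ x z : ℝ, -γ + √(2 * γ) * x + γ - √(2 * γ) * z = √(2 * γ) * (x - z) :=
      fun x z ↦ by ring
    simpa only [e] using this
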